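/- Let $n,m\ge 1$ be integers and $\mathbf N=n+m$. Write points of $\mathbb R^{\mathbf N}=\mathbb R^n\times\mathbb R^m$ as $\xi=(\tau,\lambda)$. **Setting.** Let $\Phi(x,\xi)$ be real-valued, homogeneous of degree $1$ in $\xi$, and smooth in $(x,\xi)$ for $\xi\ne0$. Let $\sigma\in C^\infty(\mathbb R^{\mathbf N}\times\mathbb R^{\mathbf N})$ be complex-valued with compact support in $x$. Assume that $\Phi$ is uniformly non-degenerate on the support of $\sigma$: there is $c>0$ with $$\Big|\det\Big[\frac{\partial^2\Phi}{\partial x\,\partial\xi}\Big](x,\xi)\Big|\ge c\qquad\text{for all }(x,\xi)\in\operatorname{supp}\sigma,\ \xi\neq0 .$$ For $\rho\ge 0$ say that $\sigma\in\mathbf S^{-\rho}$ with exponents $(\rho_1,\rho_2)$ if for all multi-indices $\alpha,\beta,\gamma$ there is a constant $B_{\alpha\beta\gamma}$ with $$|\partial_\tau^\alpha\partial_\lambda^\beta\partial_x^\gamma\sigma(x,\xi)|\le B_{\alpha\beta\gamma}\,(1+|\tau|)^{-|\alpha|-\rho_1}(1+|\lambda|)^{-|\beta|-\rho_2},$$ where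 $\rho_1=\rho_2=0$ if $\rho=0$, while $\rho_1>\frac{n-1}{\mathbf N-1}\rho$, $\rho_2>\frac{m-1}{\mathbf N-1}\rho$ and $\rho_1+\rho_2=\rho$ if $\rho>0$. **Cone decomposition.** Let $\varphi\in C_c^\infty(\mathbb R)$ with $\varphi(t)=1$ for $|t|\le1$ and $\varphi(t)=0$ for $|t|>2$. For $\ell,j\in\mathbb Z$ put $$\delta_\ell(\xi)=\varphi\big(2^{-\ell}\tfrac{|\tau|}{|\lambda|}\big)-\varphi\big(2^{-\ell+1}\tfrac{|\tau|}{|\lambda|}\big),\qquad \phi_j(\xi)=\varphi(2^{-j}|\xi|)-\varphi(2^{-j+1}|\xi|),$$ $$\mathfrak S_j^+(\xi)=1-\varphi\big(2^{-j+1}\tfrac{|\tau|}{|\lambda|}\big),\qquad \mathfrak S_j^-(\xi)=\varphi\big(2^{j}\tfrac{|\tau|}{|\lambda|}\big).$$ For a bounded, compactly supported cut-off $\psi(\xi)$ let $\Omega[\psi](x,y)=\int e^{2\pi i[\Phi(x,\xi)-y\cdot\xi]}\psi(\xi)\sigma(x,\xi)\,d\xi$, and put $$\Omega_o=\Omega[\varphi(|\cdot|)],\qquad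 \Omega_{\ell j}=\Omega[\delta_\ell\phi_j],$$ $${}^\sharp\Omega_j=\sum_{j/2\le\ell<j}\Omega_{\ell j}+\Omega[\mathfrak S_j^+\phi_j],\qquad {}^\flat\Omega_j=\sum_{-j<\ell\le-j/2}\Omega_{\ell j}+\Omega[\mathfrak S_j^-\phi_j].$$ Let $\mathfrak F_o$, $\mathfrak F_{\ell j}$, ${}^\sharp\mathfrak F_j$, ${}^\flat\mathfrak F_j$ be the integral operators $f\mapsto\int f(y)\,\Omega(x,y)\,dy$ with these kernels $\Omega$, and let $\mathfrak F_{\ell j}^*f(x)=\int f(y)\,\overline{\Omega_{\ell j}(y,x)}\,dy$. Define $${}^\natural\mathfrak F_\ell f=\sum_{j>2|\ell|}\mathfrak F_{\ell j}f,\qquad {}^\natural\mathfrak F_\ell^* f=\sum_{j>2|\ell|}\mathfrak F^*_{\ell j}f,\qquad {}^\natural\mathfrak F f=\sum_{j>0}\ \sum_{-j/2<\ell<j/2}\mathfrak F_{\ell j}f=\sum_{\ell\in\mathbb Z}{}^\natural\mathfrak F_\ell f,$$ $${}^\sharp\mathfrak F f=\sum_{j>0}{}^\sharp\mathfrak F_jf,\qquad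 {}^\flat\mathfrak F f=\sum_{j>0}{}^\flat\mathfrak F_jf.$$ All infinite sums are unconditionally convergent sums in $L^2(\mathbb R^{\mathbf N})$; their convergence, for every $f$ in the space on the right-hand side of the respective estimate below, and the equality of the two expressions for ${}^\natural\mathfrak F f$, for $f\in L^2$, are part of the claim. Finally let $$\|f\|_{L^{p_1}L^{p_2}}=\Big\{\int_{\mathbb R^n}\Big\{\int_{\mathbb R^m}|f(u,v)|^{p_2}dv\Big\}^{p_1/p_2}du\Big\}^{1/p_1}.$$ **Proposition One.** (1) If $\sigma\in\mathbf S^0$, there is a constant $C$ such that for every $f\in L^2(\mathbb R^{\mathbf N})$ $$\|\mathfrak F_of\|_{L^2}+\|{}^\natural\mathfrak Ff\|_{L^2}+\|{}^\sharp\mathfrak Ff\|_{L^2}+\|{}^\flat\mathfrak Ff\|_{L^2}\le C\|f\|_{L^2}.$$ Now let $0\le\rho\le(\mathbf N-1)/2$ and let $\sigma\in\mathbf S^{-\rho}$ with exponents $(\rho_1,\rho_2)$. (2) If $\frac{\rho_1}{n}=\frac1{p_1}-\frac12$ and $\frac{\rho_2}{m}=\frac1{p_2}-\frac12$, there is a constant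 $C$, independent of $\ell$ and $f$, such that for every $f\in L^{p_1}L^{p_2}(\mathbb R^n\times\mathbb R^m)$ $$\|{}^\natural\mathfrak F_\ell f\|_{L^2}\le C\|f\|_{L^{p_1}L^{p_2}}\ (\ell\in\mathbb Z),\qquad \|{}^\sharp\mathfrak F f\|_{L^2}\le C\|f\|_{L^{p_1}L^{p_2}},\qquad \|{}^\flat\mathfrak F f\|_{L^2}\le C\|f\|_{L^{p_1}L^{p_2}}.$$ (3) There is $\varepsilon>0$, depending only on $n,m,\rho_1,\rho_2$, such that if $\frac{\rho}{\mathbf N}=\frac1p-\frac12$, then there is a constant $C$, independent of $\ell$ and $f$, with $$\|{}^\natural\mathfrak F_\ell^*f\|_{L^2}\le C\,2^{[\frac{\mathbf N}2-\rho-\varepsilon]|\ell|}\,\|f\|_{L^p(\mathbb R^{\mathbf N})}\qquad\text{for every }\ell\in\mathbb Z\text{ and every }f\in L^p(\mathbb R^{\mathbf N}).$$ -/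

import Mathlib

open MeasureTheory Filter Topology
open scoped ENNReal NNReal ContDiff

noncomputable section

namespace ConeFIO

/-- The space `ℝᴺ = ℝⁿ × ℝᵐ` with its Euclidean norm and Lebesgue measure. -/
abbrev RN (n m : ℕ) : Type := EuclideanSpace ℝ (Fin n ⊕ Fin m)

variable {n m : ℕ}

/-- The component `τ ∈ ℝⁿ` of `ξ = (τ, λ)`. -/
def fstPart (ξ : RN n m) : EuclideanSpace ℝ (Fin n) := WithLp.toLp 2 fun i => ξ (Sum.inl i)

/-- The component `λ ∈ ℝᵐ` of `ξ = (τ, λ)`. -/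
def sndPart (ξ : RN n m) : EuclideanSpace ℝ (Fin m) := WithLp.toLp 2 fun k => ξ (Sum.inr k)

/-- The point `(u, v)` of `ℝⁿ × ℝᵐ`. -/
def join (u : EuclideanSpace ℝ (Fin n)) (v : EuclideanSpace ℝ (Fin m)) : RN n m :=
  WithLp.toLp 2 (Sum.elim (fun i => u i) (fun k => v k))

/-- The coordinate vectors of `ℝᴺ`. -/
def coordVec (i : Fin n ⊕ Fin m) : RN n m := EuclideanSpace.single i (1 : ℝ)

/-! ### Phases and symbols -/

/-- A phase function: real-valued, smooth in `(x, ξ)` for `ξ ≠ 0`, and homogeneous of degree one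
in `ξ`. -/
structure IsPhase (Φ : RN n m → RN n m → ℝ) : Prop where
  smooth : ContDiffOn ℝ ∞ (Function.uncurry Φ) {q | q.2 ≠ 0}
  homogeneous : ∀ (x ξ : RN n m) (t : ℝ), 0 < t → Φ x (t • ξ) = t * Φ x ξ

/-- The matrix of the mixed second derivatives `∂²Φ/∂x_i∂ξ_k` at `(x, ξ)`. -/
def mixedHessian (Φ : RN n m → RN n m → ℝ) (x ξ : RN n m) :
    Matrix (Fin n ⊕ Fin m) (Fin n ⊕ Fin m) ℝ :=
  Matrix.of fun i k =>
    fderiv ℝ (fun z : RN n m => fderiv ℝ (Φ z) ξ (coordVec k)) x (coordVec i)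

/-- Non-degeneracy of the phase on the support of `σ`, with a uniform lower bound. (The determinant
is homogeneous of degree zero in `ξ`, so if it has no zero with `x` in a compact set and `ξ ≠ 0`,
then it has such a bound there.) -/
def IsNondegenerateOn (Φ : RN n m → RN n m → ℝ) (σ : RN n m → RN n m → ℂ) : Prop :=
  ∃ c : ℝ, 0 < c ∧ ∀ x ξ : RN n m, (x, ξ) ∈ tsupport (Function.uncurry σ) → ξ ≠ 0 →
    c ≤ |(mixedHessian Φ x ξ).det|

/-- The two-parameter symbols of orders `-ρ₁` in `τ` and `-ρ₂` in `λ`: smooth, compactly supported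
in `x`, with `|∂_τ^α ∂_λ^β ∂_x^γ σ| ≤ B_{αβγ} (1+|τ|)^{-|α|-ρ₁} (1+|λ|)^{-|β|-ρ₂}`. A multi-index of
order `a` is written as the tuple of the `a` coordinate directions of differentiation. -/
structure IsSymbol (ρ₁ ρ₂ : ℝ) (σ : RN n m → RN n m → ℂ) : Prop where
  smooth : ContDiff ℝ ∞ (Function.uncurry σ)
  compact_support : ∃ K : Set (RN n m), IsCompact K ∧ ∀ x ∉ K, ∀ ξ, σ x ξ = 0
  bound : ∀ (a b c : ℕ) (α : Fin a → Fin n) (β : Fin b → Fin m) (γ : Fin c → Fin n ⊕ Fin m),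
    ∃ B : ℝ, ∀ x ξ : RN n m,
      ‖iteratedFDeriv ℝ (a + b + c) (Function.uncurry σ) (x, ξ)
        (Fin.append
          (Fin.append (fun i => ((0 : RN n m), (coordVec (Sum.inl (α i)) : RN n m)))
            (fun i => ((0 : RN n m), (coordVec (Sum.inr (β i)) : RN n m))))
          (fun i => ((coordVec (γ i) : RN n m), (0 : RN n m))))‖
      ≤ B * (1 / (1 + ‖fstPart ξ‖)) ^ ((a : ℝ) + ρ₁) * (1 / (1 + ‖sndPart ξ‖)) ^ ((b : ℝ) + ρ₂)

/-- The admissible splittings `ρ = ρ₁ + ρ₂` of the order. -/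
def IsAdmissible (n m : ℕ) (ρ ρ₁ ρ₂ : ℝ) : Prop :=
  (ρ = 0 → ρ₁ = 0 ∧ ρ₂ = 0) ∧
  (0 < ρ → ((n : ℝ) - 1) / ((n : ℝ) + m - 1) * ρ < ρ₁ ∧
    ((m : ℝ) - 1) / ((n : ℝ) + m - 1) * ρ < ρ₂ ∧ ρ₁ + ρ₂ = ρ)

/-! ### The cone decomposition -/

/-- The cut-off functions of the decomposition: smooth, `1` on `|t| ≤ 1`, `0` on `|t| > 2`. -/
structure IsCutoff (φ : ℝ → ℂ) : Prop where
  smooth : ContDiff ℝ ∞ φ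
  eq_one : ∀ t, |t| ≤ 1 → φ t = 1
  eq_zero : ∀ t, 2 < |t| → φ t = 0

/-- `δ_ℓ(ξ) = φ(2^{-ℓ}|τ|/|λ|) - φ(2^{-ℓ+1}|τ|/|λ|)`. -/
def coneCut (φ : ℝ → ℂ) (l : ℤ) (ξ : RN n m) : ℂ :=
  φ ((2 : ℝ) ^ (-l) * (‖fstPart ξ‖ / ‖sndPart ξ‖)) -
    φ ((2 : ℝ) ^ (-l + 1) * (‖fstPart ξ‖ / ‖sndPart ξ‖))

/-- `𝔖_j⁺(ξ) = 1 - φ(2^{-j+1}|τ|/|λ|)`. -/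
def upperCut (φ : ℝ → ℂ) (j : ℤ) (ξ : RN n m) : ℂ :=
  1 - φ ((2 : ℝ) ^ (-j + 1) * (‖fstPart ξ‖ / ‖sndPart ξ‖))

/-- `𝔖_j⁻(ξ) = φ(2^j|τ|/|λ|)`. -/
def lowerCut (φ : ℝ → ℂ) (j : ℤ) (ξ : RN n m) : ℂ :=
  φ ((2 : ℝ) ^ j * (‖fstPart ξ‖ / ‖sndPart ξ‖))

/-- `φ_j(ξ) = φ(2^{-j}|ξ|) - φ(2^{-j+1}|ξ|)`. -/
def shellCut (φ : ℝ → ℂ) (j : ℤ) (ξ : RN n m) : ℂ :=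
  φ ((2 : ℝ) ^ (-j) * ‖ξ‖) - φ ((2 : ℝ) ^ (-j + 1) * ‖ξ‖)

/-- The kernel `∫ e^{2πi[Φ(x,ξ) - y·ξ]} ψ(ξ) σ(x,ξ) dξ`. -/
def kern (Φ : RN n m → RN n m → ℝ) (σ : RN n m → RN n m → ℂ) (ψ : RN n m → ℂ)
    (x y : RN n m) : ℂ :=
  ∫ ξ : RN n m,
    Complex.exp (2 * Real.pi * Complex.I * ((Φ x ξ - inner ℝ y ξ : ℝ) : ℂ)) * ψ ξ * σ x ξ

/-- The integral operator `f ↦ ∫ f(y) Ω(x,y) dy`. -/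
def kernelOp (Ω : RN n m → RN n m → ℂ) (f : RN n m → ℂ) (x : RN n m) : ℂ :=
  ∫ y : RN n m, f y * Ω x y

/-- The adjoint integral operator, with kernel `(x, y) ↦ conj Ω(y,x)`. -/
def adjointOp (Ω : RN n m → RN n m → ℂ) (f : RN n m → ℂ) (x : RN n m) : ℂ :=
  ∫ y : RN n m, f y * (starRingEnd ℂ) (Ω y x)

section Operators

variable (φ : ℝ → ℂ) (Φ : RN n m → RN n m → ℝ) (σ : RN n m → RN n m → ℂ)

/-- The kernel `Ω_o`, with frequency cut-off `φ(|ξ|)`. -/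
def kernO : RN n m → RN n m → ℂ := kern Φ σ fun ξ => φ ‖ξ‖

/-- The kernel `Ω_{ℓj}`. -/
def kernLJ (l j : ℤ) : RN n m → RN n m → ℂ := kern Φ σ fun ξ => coneCut φ l ξ * shellCut φ j ξ

/-- The kernel `♯Ω_j = ∑_{j/2 ≤ ℓ < j} Ω_{ℓj} + ⁺Ω_j`. -/
def kernSharp (j : ℤ) (x y : RN n m) : ℂ :=
  (∑ l ∈ (Finset.Ico 0 j).filter (fun l => j ≤ 2 * l), kernLJ φ Φ σ l j x y) +
    kern Φ σ (fun ξ => upperCut φ j ξ * shellCut φ j ξ) x y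

/-- The kernel `♭Ω_j = ∑_{-j < ℓ ≤ -j/2} Ω_{ℓj} + ⁻Ω_j`. -/
def kernFlat (j : ℤ) (x y : RN n m) : ℂ :=
  (∑ l ∈ (Finset.Ioc (-j) 0).filter (fun l => 2 * l ≤ -j), kernLJ φ Φ σ l j x y) +
    kern Φ σ (fun ξ => lowerCut φ j ξ * shellCut φ j ξ) x y

/-- `𝔉_o`. -/
def opO (f : RN n m → ℂ) : RN n m → ℂ := kernelOp (kernO φ Φ σ) f

/-- `𝔉_{ℓj}`. -/
def opLJ (l j : ℤ) (f : RN n m → ℂ) : RN n m → ℂ := kernelOp (kernLJ φ Φ σ l j) f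

/-- `𝔉*_{ℓj}`. -/
def opLJAdj (l j : ℤ) (f : RN n m → ℂ) : RN n m → ℂ := adjointOp (kernLJ φ Φ σ l j) f

/-- `♮𝔉_j = ∑_{-j/2 < ℓ < j/2} 𝔉_{ℓj}`, for `j > 0`. -/
def opNaturalJ (j : ℤ) (f : RN n m → ℂ) (x : RN n m) : ℂ :=
  ∑ l ∈ (Finset.Ioo (-j) j).filter (fun l => -j < 2 * l ∧ 2 * l < j), opLJ φ Φ σ l j f x

/-- `♯𝔉_j`. -/
def opSharpJ (j : ℤ) (f : RN n m → ℂ) : RN n m → ℂ := kernelOp (kernSharp φ Φ σ j) f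

/-- `♭𝔉_j`. -/
def opFlatJ (j : ℤ) (f : RN n m → ℂ) : RN n m → ℂ := kernelOp (kernFlat φ Φ σ j) f

end Operators

/-- `g = ∑_i u_i`, with unconditional convergence in `L²`. This determines `g` up to a null set. -/
def IsL2Sum {ι : Type} (u : ι → RN n m → ℂ) (g : RN n m → ℂ) : Prop :=
  (∀ i, MemLp (u i) 2 volume) ∧ MemLp g 2 volume ∧
  Tendsto (fun s : Finset ι => eLpNorm (fun x => g x - ∑ i ∈ s, u i x) 2 volume) atTop (𝓝 0)

section Sums

variable (φ : ℝ → ℂ) (Φ : RN n m → RN n m → ℝ) (σ : RN n m → RN n m → ℂ)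

/-- `g = ♮𝔉_ℓ f = ∑_{j > 2|ℓ|} 𝔉_{ℓj} f`. -/
def IsNaturalL (l : ℤ) (f g : RN n m → ℂ) : Prop :=
  IsL2Sum (fun j : {j : ℤ // 2 * |l| < j} => opLJ φ Φ σ l j f) g

/-- `g = ♮𝔉*_ℓ f = ∑_{j > 2|ℓ|} 𝔉*_{ℓj} f`. -/
def IsNaturalLAdj (l : ℤ) (f g : RN n m → ℂ) : Prop :=
  IsL2Sum (fun j : {j : ℤ // 2 * |l| < j} => opLJAdj φ Φ σ l j f) g

/-- `g = ♮𝔉 f = ∑_{j > 0} ♮𝔉_j f = ∑_ℓ ♮𝔉_ℓ f`. -/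
def IsNatural (f g : RN n m → ℂ) : Prop :=
  IsL2Sum (fun j : {j : ℤ // 0 < j} => opNaturalJ φ Φ σ j f) g ∧
  ∃ h : ℤ → RN n m → ℂ, (∀ l, IsNaturalL φ Φ σ l f (h l)) ∧ IsL2Sum h g

/-- `g = ♯𝔉 f = ∑_{j > 0} ♯𝔉_j f`. -/
def IsSharp (f g : RN n m → ℂ) : Prop :=
  IsL2Sum (fun j : {j : ℤ // 0 < j} => opSharpJ φ Φ σ j f) g

/-- `g = ♭𝔉 f = ∑_{j > 0} ♭𝔉_j f`. -/
def IsFlat (f g : RN n m → ℂ) : Prop :=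
  IsL2Sum (fun j : {j : ℤ // 0 < j} => opFlatJ φ Φ σ j f) g

end Sums

/-- The mixed norm `{∫ {∫ |f(u,v)|^{p₂} dv}^{p₁/p₂} du}^{1/p₁}`. -/
def mixedNorm (p₁ p₂ : ℝ) (f : RN n m → ℂ) : ℝ≥0∞ :=
  (∫⁻ u : EuclideanSpace ℝ (Fin n),
    (∫⁻ v : EuclideanSpace ℝ (Fin m), ‖f (join u v)‖ₑ ^ p₂) ^ (p₁ / p₂)) ^ (1 / p₁)

/-- Membership in `L^{p₁}L^{p₂}(ℝⁿ × ℝᵐ)`. -/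
def MemMixed (p₁ p₂ : ℝ) (f : RN n m → ℂ) : Prop :=
  AEStronglyMeasurable f volume ∧ mixedNorm p₁ p₂ f < ⊤

end ConeFIO

end

/-! As a function of `y`, a frequency-localized kernel is a Fourier transform. By the multiplication
formula every localized operator therefore sends `f` to `T(ψF)`, where `F` is the transform of `f`,
`ψ` is the cut-off and `T g(x) = ∫ e^{2πiΦ(x,ξ)} s(x,ξ) g(ξ) dξ`. The cut-offs act on the input of
one fixed operator `T`. So once `T` is bounded on `L²`, the convergence of the sums, their order,
and their bounds all reduce to the bounded overlap of the cut-offs (`IsL2Op.summable`).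

Boundedness of `T` (`IsAmplitude.exists_L2_bound`) needs bounded `x`-derivatives of the amplitude
but no smoothness in `ξ`. The kernel of `T*T` at `(ξ,η)` is an oscillatory integral in `x` with
phase `Φ(x,ξ) - Φ(x,η)`. If both frequencies lie in one narrow cone, non-degeneracy makes the
`x`-gradient of this phase at least a multiple of `|ξ-η|`. Integration by parts then gives decay
`(1+|ξ-η|)^{-N-1}`, and Schur's test applies. Finitely many cones cover all directions, and since
`ξ`-regularity is irrelevant, sharp truncation to a cone is harmless.

For the mixed norms, the amplitude is divided by a weight `W(ξ)` comparable from below with its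
size, which leaves an amplitude of order zero. The weight is a product of Fourier transforms of
positive superpositions of Gaussians, so it passes to `f` as convolution with a product of potential
kernels. Hardy–Littlewood–Sobolev in each group of variables, joined by Minkowski's inequality,
takes `L^{p₁}L^{p₂}` into `L²`. Admissibility places both orders strictly between zero and half the
dimension, as this inequality requires.

For the adjoints, Plancherel reduces the estimate to the `L²` norm of `S f(ξ) = ∫ f(y)
conj(e^{2πiΦ(y,ξ)} σ(y,ξ)) dy` over the cone of index `l`. On its intersection with the shell `|ξ| ~
2^k` there is an `L²` bound from the size of the symbol, and an `L¹` bound from that size and the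
volume. Cutting `f` at a height that depends on `k` and summing over `k` is real interpolation by
hand (`exists_tsum_le_of_levels`). What is left is a power of the aperture of the cone, and the
admissibility condition keeps its exponent below `N/2 - ρ` by at least `1/(2N)`. -/

noncomputable section

namespace ConeFIO

variable {n m : ℕ}

/-! ### Families of smooth functions with uniformly bounded partial derivatives -/

section UniformBounds

variable {ι P E 𝔸 : Type*} [NormedAddCommGroup E] [NormedSpace ℝ E]
  [NormedRing 𝔸] [NormedAlgebra ℝ 𝔸]

/-- The derivative of each member of a family in the direction `e i`. -/
def dirDeriv (e : ι → E) (i : ι) (F : P → E → 𝔸) (p : P) (x : E) : 𝔸 := fderiv ℝ (F p) x (e i)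

/-- All iterated derivatives of order at most `k` along the directions `e i` are bounded,
uniformly over the family. -/
def UnifBdd (e : ι → E) : ℕ → (P → E → 𝔸) → Prop
  | 0, F => ∃ C : ℝ, ∀ p x, ‖F p x‖ ≤ C
  | k + 1, F => (∃ C : ℝ, ∀ p x, ‖F p x‖ ≤ C) ∧ ∀ i, UnifBdd e k (dirDeriv e i F)

/-- A family of smooth functions. -/
def SmoothFam (F : P → E → 𝔸) : Prop := ∀ p, ContDiff ℝ ∞ (F p)

variable {e : ι → E}

theorem SmoothFam.dirDeriv {F : P → E → 𝔸} (hF : SmoothFam F) (i : ι) :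
    SmoothFam (dirDeriv e i F) := fun p =>
  ((hF p).fderiv_right (m := ∞) (by simp)).clm_apply contDiff_const

theorem SmoothFam.differentiable {F : P → E → 𝔸} (hF : SmoothFam F) (p : P) :
    Differentiable ℝ (F p) := (hF p).differentiable (by simp)

theorem UnifBdd.of_succ {k : ℕ} : ∀ {F : P → E → 𝔸}, UnifBdd e (k + 1) F → UnifBdd e k F := by
  induction k with
  | zero => exact fun h => h.1
  | succ k ih => exact fun h => ⟨h.1, fun i => ih (h.2 i)⟩

theorem UnifBdd.reindex {Q : Type*} (π : Q → P) {k : ℕ} :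
    ∀ {F : P → E → 𝔸}, UnifBdd e k F → UnifBdd e k (fun q => F (π q)) := by
  induction k with
  | zero => exact fun ⟨C, h⟩ => ⟨C, fun q x => h _ x⟩
  | succ k ih =>
    intro F h
    obtain ⟨C, hC⟩ := h.1
    exact ⟨⟨C, fun q x => hC _ x⟩, fun i => ih (h.2 i)⟩

theorem UnifBdd.add {k : ℕ} : ∀ {F G : P → E → 𝔸}, SmoothFam F → SmoothFam G →
    UnifBdd e k F → UnifBdd e k G → UnifBdd e k (fun p x => F p x + G p x) := by
  induction k with
  | zero =>
    rintro F G - - ⟨C, hC⟩ ⟨D, hD⟩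
    exact ⟨C + D, fun p x => (norm_add_le _ _).trans (add_le_add (hC p x) (hD p x))⟩
  | succ k ih =>
    rintro F G sF sG ⟨⟨C, hC⟩, hF⟩ ⟨⟨D, hD⟩, hG⟩
    refine ⟨⟨C + D, fun p x => (norm_add_le _ _).trans (add_le_add (hC p x) (hD p x))⟩,
      fun i => ?_⟩
    have : ConeFIO.dirDeriv e i (fun p x => F p x + G p x) =
        fun p x => ConeFIO.dirDeriv e i F p x + ConeFIO.dirDeriv e i G p x := by
      funext p x
      simp only [ConeFIO.dirDeriv]
      rw [fderiv_fun_add (sF.differentiable p x) (sG.differentiable p x)]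
      rfl
    rw [this]
    exact ih (sF.dirDeriv i) (sG.dirDeriv i) (hF i) (hG i)

theorem UnifBdd.mul {k : ℕ} : ∀ {F G : P → E → 𝔸}, SmoothFam F → SmoothFam G →
    UnifBdd e k F → UnifBdd e k G → UnifBdd e k (fun p x => F p x * G p x) := by
  have key : ∀ {F G : P → E → 𝔸}, (∃ C : ℝ, ∀ p x, ‖F p x‖ ≤ C) → (∃ C : ℝ, ∀ p x, ‖G p x‖ ≤ C) →
      ∃ C : ℝ, ∀ p x, ‖F p x * G p x‖ ≤ C := by
    rintro F G ⟨C, hC⟩ ⟨D, hD⟩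
    refine ⟨C * D, fun p x => (norm_mul_le _ _).trans ?_⟩
    exact mul_le_mul (hC p x) (hD p x) (norm_nonneg _) ((norm_nonneg _).trans (hC p x))
  induction k with
  | zero => exact fun _ _ hF hG => key hF hG
  | succ k ih =>
    rintro F G sF sG hF hG
    refine ⟨key hF.1 hG.1, fun i => ?_⟩
    have : ConeFIO.dirDeriv e i (fun p x => F p x * G p x) =
        fun p x => F p x * ConeFIO.dirDeriv e i G p x + ConeFIO.dirDeriv e i F p x * G p x := by
      funext p x
      simp only [ConeFIO.dirDeriv]
      rw [fderiv_fun_mul' (sF.differentiable p x) (sG.differentiable p x)]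
      rfl
    rw [this]
    exact UnifBdd.add (fun p => (sF p).mul (sG.dirDeriv i p))
      (fun p => (sF.dirDeriv i p).mul (sG p)) (ih sF (sG.dirDeriv i) hF.of_succ (hG.2 i))
      (ih (sF.dirDeriv i) sG (hF.2 i) hG.of_succ)

theorem SmoothFam.sum {κ : Type*} {s : Finset κ} {F : κ → P → E → 𝔸}
    (hF : ∀ j ∈ s, SmoothFam (F j)) : SmoothFam (fun p x => ∑ j ∈ s, F j p x) :=
  fun p => ContDiff.sum fun j hj => hF j hj p

theorem UnifBdd.zero {k : ℕ} : UnifBdd e k (fun (_ : P) (_ : E) => (0 : 𝔸)) := by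
  induction k with
  | zero => exact ⟨0, by simp⟩
  | succ k ih =>
    refine ⟨⟨0, by simp⟩, fun i => ?_⟩
    have : dirDeriv e i (fun (_ : P) (_ : E) => (0 : 𝔸)) = fun _ _ => 0 := by
      funext p x; simp [dirDeriv]
    rwa [this]

theorem UnifBdd.sum {κ : Type*} {s : Finset κ} {F : κ → P → E → 𝔸} {k : ℕ}
    (sF : ∀ j ∈ s, SmoothFam (F j)) (hF : ∀ j ∈ s, UnifBdd e k (F j)) :
    UnifBdd e k (fun p x => ∑ j ∈ s, F j p x) := by
  classical
  induction s using Finset.induction_on with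
  | empty => simpa using UnifBdd.zero
  | insert j s hj ih =>
    simp only [Finset.sum_insert hj]
    exact UnifBdd.add (sF j (by simp)) (SmoothFam.sum fun i hi => sF i (by simp [hi]))
      (hF j (by simp)) (ih (fun i hi => sF i (by simp [hi])) fun i hi => hF i (by simp [hi]))

/-- Composition with a continuous linear map of the values. -/
theorem UnifBdd.clm_comp {𝔹 : Type*} [NormedRing 𝔹] [NormedAlgebra ℝ 𝔹] (T : 𝔸 →L[ℝ] 𝔹) {k : ℕ} :
    ∀ {F : P → E → 𝔸}, SmoothFam F → UnifBdd e k F → UnifBdd e k (fun p x => T (F p x)) := by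
  have key : ∀ {F : P → E → 𝔸}, (∃ C : ℝ, ∀ p x, ‖F p x‖ ≤ C) →
      ∃ C : ℝ, ∀ p x, ‖T (F p x)‖ ≤ C := by
    rintro F ⟨C, hC⟩
    exact ⟨‖T‖ * C, fun p x => T.le_of_opNorm_le_of_le le_rfl (hC p x)⟩
  induction k with
  | zero => exact fun _ h => key h
  | succ k ih =>
    intro F sF h
    refine ⟨key h.1, fun i => ?_⟩
    have : dirDeriv e i (fun p x => T (F p x)) = fun p x => T (dirDeriv e i F p x) := by
      funext p x
      exact congrArg (fun L : E →L[ℝ] 𝔹 => L (e i))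
        ((T.hasFDerivAt.comp x (sF.differentiable p x).hasFDerivAt).fderiv)
    rw [this]
    exact ih (sF.dirDeriv i) (h.2 i)

theorem SmoothFam.clm_comp {𝔹 : Type*} [NormedRing 𝔹] [NormedAlgebra ℝ 𝔹] (T : 𝔸 →L[ℝ] 𝔹)
    {F : P → E → 𝔸} (hF : SmoothFam F) : SmoothFam (fun p x => T (F p x)) :=
  fun p => T.contDiff.comp (hF p)

/-- Composition of a bounded real family with a fixed smooth function. -/
theorem UnifBdd.smooth_comp {k : ℕ} : ∀ {g : ℝ → ℝ} {V : P → E → ℝ}, ContDiff ℝ ∞ g →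
    SmoothFam V → UnifBdd e k V → UnifBdd e k (fun p x => g (V p x)) := by
  have key : ∀ {g : ℝ → ℝ} {V : P → E → ℝ}, ContDiff ℝ ∞ g → (∃ C : ℝ, ∀ p x, ‖V p x‖ ≤ C) →
      ∃ C : ℝ, ∀ p x, ‖g (V p x)‖ ≤ C := by
    rintro g V hg ⟨C, hC⟩
    obtain ⟨D, hD⟩ := (isCompact_Icc (a := -C) (b := C)).exists_bound_of_continuousOn
      hg.continuous.continuousOn
    exact ⟨D, fun p x => hD _ (abs_le.1 (hC p x))⟩
  induction k with
  | zero => exact fun hg _ h => key hg h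
  | succ k ih =>
    intro g V hg sV h
    refine ⟨key hg h.1, fun i => ?_⟩
    have : dirDeriv e i (fun p x => g (V p x)) =
        fun p x => deriv g (V p x) * dirDeriv e i V p x := by
      funext p x
      have h1 : HasDerivAt g (deriv g (V p x)) (V p x) :=
        (hg.differentiable (by simp) _).hasDerivAt
      have h2 := (h1.comp_hasFDerivAt x (sV.differentiable p x).hasFDerivAt).fderiv
      exact congrArg (fun L : E →L[ℝ] ℝ => L (e i)) h2
    rw [this]
    -- The chain rule replaces `g` by `deriv g`, so the induction on the order has to run over all
    -- smooth `g` at once.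
    have hg' : ContDiff ℝ ∞ (deriv g) := (contDiff_infty_iff_deriv.1 hg).2
    exact UnifBdd.mul (fun p => hg'.comp (sV p)) (sV.dirDeriv i) (ih hg' sV h.of_succ) (h.2 i)

end UniformBounds

/-! ### Non-stationary phase -/

/-- A smooth function on the line that equals `1/t` for `t ≥ c`. -/
theorem exists_smooth_inv {c : ℝ} (hc : 0 < c) :
    ∃ g : ℝ → ℝ, ContDiff ℝ ∞ g ∧ ∀ t, c ≤ t → g t = t⁻¹ := by
  -- The transition function vanishes for `t ≤ c/2`, which removes the pole at the origin, and is
  -- one from `t = c` on.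
  refine ⟨fun t => Real.smoothTransition (2 * t / c - 1) * t⁻¹, ?_, fun t ht => ?_⟩
  · rw [contDiff_iff_contDiffAt]
    intro t
    by_cases h : t = 0
    · have : (fun t => Real.smoothTransition (2 * t / c - 1) * t⁻¹) =ᶠ[𝓝 t] fun _ => 0 := by
        filter_upwards [Iio_mem_nhds (show t < c / 2 by rw [h]; positivity)] with s hs
        rw [Real.smoothTransition.zero_of_nonpos, zero_mul]
        have : s < c / 2 := hs
        rw [sub_nonpos, div_le_one hc]; linarith
      exact contDiffAt_const.congr_of_eventuallyEq this
    · refine ContDiffAt.mul ?_ (contDiffAt_inv ℝ h)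
      exact (Real.smoothTransition.contDiff.comp (by fun_prop :
        ContDiff ℝ ∞ fun t : ℝ => 2 * t / c - 1)).contDiffAt
  · simp only
    rw [Real.smoothTransition.one_of_one_le, one_mul]
    rw [le_sub_iff_add_le, le_div_iff₀ hc]; linarith

section NonStationary

variable {ι P E : Type*} [NormedAddCommGroup E] [NormedSpace ℝ E] [FiniteDimensional ℝ E]
  [MeasurableSpace E] [BorelSpace E] {μ : Measure E} [μ.IsAddHaarMeasure]
  [Fintype ι] {e : ι → E}

/-- The vector field `L = ∑ a_i ∂_i` satisfies `Lθ = 1` on the support of `b`, so `(2πiR)⁻¹ L`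
reproduces the exponential there. Integration by parts moves `L` to the amplitude and gains a factor
`R⁻¹`. -/
theorem integral_exp_mul_eq {θ : E → ℝ} (hθ : ContDiff ℝ ∞ θ) {b : E → ℂ} (hb : ContDiff ℝ ∞ b)
    (hbc : HasCompactSupport b) {a : ι → E → ℝ} (ha : ∀ i, ContDiff ℝ ∞ (a i))
    (h1 : ∀ x ∈ tsupport b, ∑ i, a i x * fderiv ℝ θ x (e i) = 1) {R : ℝ} (hR : R ≠ 0) :
    ∫ x, Complex.exp (2 * Real.pi * Complex.I * ((R * θ x : ℝ) : ℂ)) * b x ∂μ =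
      -(2 * Real.pi * Complex.I * R)⁻¹ *
        ∫ x, Complex.exp (2 * Real.pi * Complex.I * ((R * θ x : ℝ) : ℂ)) *
          ∑ i, fderiv ℝ (fun y => (a i y : ℂ) * b y) x (e i) ∂μ := by
  set ex : E → ℂ := fun x => Complex.exp (2 * Real.pi * Complex.I * ((R * θ x : ℝ) : ℂ)) with hex
  set κ : ℂ := 2 * Real.pi * Complex.I * R with hκ
  have hκ0 : κ ≠ 0 := by
    simp [hκ, hR, Real.pi_ne_zero]
  have hexs : ContDiff ℝ ∞ ex := by
    refine Complex.contDiff_exp.comp (contDiff_const.mul ?_)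
    exact Complex.ofRealCLM.contDiff.comp (contDiff_const.mul hθ)
  have hd : ∀ x v, fderiv ℝ ex x v = κ * (fderiv ℝ θ x v : ℂ) * ex x := by
    intro x v
    have h2 : HasFDerivAt θ (fderiv ℝ θ x) x := (hθ.differentiable (by simp) x).hasFDerivAt
    have h3 := ((Complex.ofRealCLM.hasFDerivAt.comp x (h2.const_mul R)).const_mul
      (2 * Real.pi * Complex.I : ℂ)).cexp
    have h4 := congrArg (fun L : E →L[ℝ] ℂ => L v) h3.fderiv
    refine Eq.trans h4 ?_
    simp [hκ, hex]
    ring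
  have hab : ∀ i, ContDiff ℝ ∞ (fun y => (a i y : ℂ) * b y) := fun i =>
    (Complex.ofRealCLM.contDiff.comp (ha i)).mul hb
  have habc : ∀ i, HasCompactSupport (fun y => (a i y : ℂ) * b y) := fun i => hbc.mul_left
  have int1 : ∀ {u w : E → ℂ}, Continuous u → Continuous w → HasCompactSupport w →
      Integrable (fun x => u x * w x) μ := fun hu hw hc =>
    (hu.mul hw).integrable_of_hasCompactSupport hc.mul_left
  have hfd : ∀ i, Continuous fun x => fderiv ℝ (fun y => (a i y : ℂ) * b y) x (e i) := fun i =>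
    ((hab i).continuous_fderiv (by simp)).clm_apply continuous_const
  have hfdc : ∀ i, HasCompactSupport fun x => fderiv ℝ (fun y => (a i y : ℂ) * b y) x (e i) :=
    fun i => (habc i).fderiv_apply ℝ (e i)
  have hexd : ∀ i, Continuous fun x => fderiv ℝ ex x (e i) := fun i =>
    (hexs.continuous_fderiv (by simp)).clm_apply continuous_const
  have ibp : ∀ i, ∫ x, ex x * fderiv ℝ (fun y => (a i y : ℂ) * b y) x (e i) ∂μ =
      -∫ x, fderiv ℝ ex x (e i) * ((a i x : ℂ) * b x) ∂μ := fun i =>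
    integral_mul_fderiv_eq_neg_fderiv_mul_of_integrable
      (int1 (hexd i) (hab i).continuous (habc i))
      (int1 hexs.continuous (hfd i) (hfdc i))
      (int1 hexs.continuous (hab i).continuous (habc i))
      (fun x _ => hexs.differentiable (by simp) x)
      (fun x _ => (hab i).differentiable (by simp) x)
  have e1 : ∫ x, ex x * ∑ i, fderiv ℝ (fun y => (a i y : ℂ) * b y) x (e i) ∂μ =
      -(κ * ∫ x, ex x * b x ∂μ) := by
    simp only [Finset.mul_sum]
    rw [integral_finsetSum _ fun i _ => int1 hexs.continuous (hfd i) (hfdc i)]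
    simp only [ibp]
    rw [Finset.sum_neg_distrib, ← integral_finsetSum _ fun i _ =>
      int1 (hexd i) (hab i).continuous (habc i), ← integral_const_mul]
    congr 2
    funext x
    simp only [hd]
    by_cases hx : x ∈ tsupport b
    · have h3 : ((∑ i, a i x * fderiv ℝ θ x (e i) : ℝ) : ℂ) = 1 := by rw [h1 x hx]; simp
      calc _ = κ * ex x * b x * ((∑ i, a i x * fderiv ℝ θ x (e i) : ℝ) : ℂ) := by
            push_cast
            rw [Finset.mul_sum]
            exact Finset.sum_congr rfl fun i _ => by ring
        _ = _ := by rw [h3]; ring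
    · simp [image_eq_zero_of_notMem_tsupport hx]
  change ∫ x, ex x * b x ∂μ = _
  rw [e1]
  field_simp

/-- Rapid decay of oscillatory integrals with non-stationary phase, uniformly over a family of
phases `θ` and amplitudes `b`. The functions `a i` are the coefficients of a vector field with
`∑ a_i ∂_i θ = 1` on the support of the amplitude. -/
theorem nonstationary_phase {θ : P → E → ℝ} (hθ : SmoothFam θ) {a : ι → P → E → ℝ}
    (ha : ∀ i, SmoothFam (a i)) (ha' : ∀ i k, UnifBdd e k (a i)) {K : Set E} (hK : IsCompact K)
    (M : ℕ) : ∀ {b : P → E → ℂ}, SmoothFam b → (∀ k, UnifBdd e k b) →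
    (∀ p, tsupport (b p) ⊆ K) →
    (∀ p, ∀ x ∈ tsupport (b p), ∑ i, a i p x * fderiv ℝ (θ p) x (e i) = 1) →
    ∃ C : ℝ, 0 ≤ C ∧ ∀ p, ∀ R : ℝ, 0 < R →
      ‖∫ x, Complex.exp (2 * Real.pi * Complex.I * ((R * θ p x : ℝ) : ℂ)) * b p x ∂μ‖ ≤
        C * R⁻¹ ^ M := by
  induction M with
  | zero =>
    intro b sb hb hbK _
    obtain ⟨C, hC⟩ := hb 0
    refine ⟨|C| * μ.real K, by positivity, fun p R _ => ?_⟩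
    rw [pow_zero, mul_one]
    have : ∫ x, Complex.exp (2 * Real.pi * Complex.I * ((R * θ p x : ℝ) : ℂ)) * b p x ∂μ =
        ∫ x in K, Complex.exp (2 * Real.pi * Complex.I * ((R * θ p x : ℝ) : ℂ)) * b p x ∂μ := by
      rw [setIntegral_eq_integral_of_forall_compl_eq_zero]
      intro x hx
      rw [image_eq_zero_of_notMem_tsupport fun h => hx (hbK p h), mul_zero]
    rw [this]
    refine norm_setIntegral_le_of_norm_le_const hK.measure_lt_top fun x _ => ?_
    rw [norm_mul]
    have : ‖Complex.exp (2 * Real.pi * Complex.I * ((R * θ p x : ℝ) : ℂ))‖ = 1 := by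
      rw [show (2 * Real.pi * Complex.I * ((R * θ p x : ℝ) : ℂ)) =
        ((2 * Real.pi * (R * θ p x) : ℝ) : ℂ) * Complex.I by push_cast; ring]
      exact Complex.norm_exp_ofReal_mul_I _
    rw [this, one_mul]
    exact (hC p x).trans (le_abs_self C)
  | succ M ih =>
    intro b sb hb hbK h1
    set b' : P → E → ℂ := fun p x => ∑ i, fderiv ℝ (fun y => (a i p y : ℂ) * b p y) x (e i)
      with hb'
    have sa : ∀ i, SmoothFam (fun p x => (a i p x : ℂ)) := fun i =>
      SmoothFam.clm_comp Complex.ofRealCLM (ha i)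
    have sab : ∀ i, SmoothFam (fun p x => (a i p x : ℂ) * b p x) := fun i p =>
      (sa i p).mul (sb p)
    have uab : ∀ i k, UnifBdd e k (fun p x => (a i p x : ℂ) * b p x) := fun i k =>
      UnifBdd.mul (sa i) sb (UnifBdd.clm_comp Complex.ofRealCLM (ha i) (ha' i k)) (hb k)
    have sb' : SmoothFam b' := SmoothFam.sum fun i _ => (sab i).dirDeriv (e := e) i
    -- Each integration by parts spends one derivative of the amplitude; this is why bounds of every
    -- order are assumed. The support, and with it the normalization of the vector field, is
    -- inherited by the new amplitude.
    have ub' : ∀ k, UnifBdd e k b' := fun k =>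
      UnifBdd.sum (fun i _ => (sab i).dirDeriv (e := e) i) fun i _ => (uab i (k + 1)).2 i
    have supp : ∀ p, tsupport (b' p) ⊆ tsupport (b p) := by
      intro p
      refine closure_minimal (fun x hx => ?_) (isClosed_tsupport _)
      by_contra hx'
      refine hx (Finset.sum_eq_zero fun i _ => ?_)
      have : x ∉ tsupport (fun y => (a i p y : ℂ) * b p y) := fun h =>
        hx' (closure_mono (Function.support_mul_subset_right _ _) h)
      rw [fderiv_of_notMem_tsupport _ this]
      rfl
    obtain ⟨C, hC0, hC⟩ := ih sb' ub' (fun p => (supp p).trans (hbK p))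
      fun p x hx => h1 p x (supp p hx)
    refine ⟨C, hC0, fun p R hR => ?_⟩
    rw [integral_exp_mul_eq (hθ p) (sb p)
      (hK.of_isClosed_subset (isClosed_tsupport _) (hbK p)) (fun i => ha i p) (h1 p) hR.ne', norm_mul]
    have hn : ‖-(2 * Real.pi * Complex.I * (R : ℂ))⁻¹‖ ≤ R⁻¹ := by
      rw [norm_neg, norm_inv]
      refine inv_anti₀ hR ?_
      simp only [norm_mul, Complex.norm_I, Complex.norm_real, mul_one, Complex.norm_ofNat,
        Real.norm_eq_abs, abs_of_pos hR, abs_of_pos Real.pi_pos]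
      nlinarith [Real.pi_gt_three]
    calc _ ≤ R⁻¹ * (C * R⁻¹ ^ M) := mul_le_mul hn (hC p R hR) (norm_nonneg _) (by positivity)
      _ = _ := by ring

end NonStationary

/-! ### Phase functions -/

theorem isOpen_snd_ne_zero : IsOpen {q : RN n m × RN n m | q.2 ≠ 0} :=
  isOpen_ne_fun continuous_snd continuous_const

/-- Bounds for functions that are homogeneous of degree zero. -/
theorem exists_bound_of_homogeneous_zero {V : Type*} [NormedAddCommGroup V] {G : RN n m × RN n m → V}
    (hG : ContinuousOn G {q | q.2 ≠ 0})
    (hh : ∀ (x ξ : RN n m) (t : ℝ), 0 < t → ξ ≠ 0 → G (x, t • ξ) = G (x, ξ))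
    {K : Set (RN n m)} (hK : IsCompact K) :
    ∃ C : ℝ, ∀ x ∈ K, ∀ ξ, ξ ≠ 0 → ‖G (x, ξ)‖ ≤ C := by
  obtain ⟨C, hC⟩ := (hK.prod (isCompact_sphere (0 : RN n m) 1)).exists_bound_of_continuousOn
    (hG.mono fun q hq => Metric.ne_of_mem_sphere hq.2 one_ne_zero)
  refine ⟨C, fun x hx ξ hξ => ?_⟩
  rw [← hh x ξ ‖ξ‖⁻¹ (by positivity) hξ]
  exact hC _ ⟨hx, by simp [norm_smul, hξ]⟩

/-- By homogeneity the function is determined on `K` times the unit sphere, where it is uniformly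
continuous. Hence closeness of directions suffices, whatever the lengths of the vectors. -/
theorem exists_close_of_homogeneous_zero {V : Type*} [NormedAddCommGroup V] {G : RN n m × RN n m → V}
    (hG : ContinuousOn G {q | q.2 ≠ 0})
    (hh : ∀ (x ξ : RN n m) (t : ℝ), 0 < t → ξ ≠ 0 → G (x, t • ξ) = G (x, ξ))
    {K : Set (RN n m)} (hK : IsCompact K) {ε : ℝ} (hε : 0 < ε) :
    ∃ r : ℝ, 0 < r ∧ ∀ x ∈ K, ∀ ξ ζ : RN n m, ξ ≠ 0 → ζ ≠ 0 →
      ‖‖ξ‖⁻¹ • ξ - ‖ζ‖⁻¹ • ζ‖ < r → ‖G (x, ξ) - G (x, ζ)‖ ≤ ε := by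
  have h := (hK.prod (isCompact_sphere (0 : RN n m) 1)).uniformContinuousOn_of_continuous
    (hG.mono fun q hq => Metric.ne_of_mem_sphere hq.2 one_ne_zero)
  obtain ⟨r, hr, h⟩ := Metric.uniformContinuousOn_iff.1 h ε hε
  refine ⟨r, hr, fun x hx ξ ζ hξ hζ hd => ?_⟩
  rw [← hh x ξ ‖ξ‖⁻¹ (by positivity) hξ, ← hh x ζ ‖ζ‖⁻¹ (by positivity) hζ, ← dist_eq_norm]
  refine (h _ ⟨hx, by simp [norm_smul, hξ]⟩ _ ⟨hx, by simp [norm_smul, hζ]⟩ ?_).le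
  rw [Prod.dist_eq, dist_self, dist_eq_norm]
  exact max_lt hr hd

namespace IsPhase

variable {H : RN n m → RN n m → ℝ}

theorem contDiffAt (hH : IsPhase H) {x ξ : RN n m} (hξ : ξ ≠ 0) :
    ContDiffAt ℝ ∞ (Function.uncurry H) (x, ξ) :=
  hH.smooth.contDiffAt (isOpen_snd_ne_zero.mem_nhds hξ)

theorem differentiableAt (hH : IsPhase H) {x ξ : RN n m} (hξ : ξ ≠ 0) :
    DifferentiableAt ℝ (Function.uncurry H) (x, ξ) :=
  (hH.contDiffAt hξ).differentiableAt (by simp)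

theorem hasFDerivAt_left (hH : IsPhase H) {x ξ : RN n m} (hξ : ξ ≠ 0) :
    HasFDerivAt (fun z => H z ξ) ((fderiv ℝ (Function.uncurry H) (x, ξ)).comp
      (ContinuousLinearMap.inl ℝ (RN n m) (RN n m))) x :=
  HasFDerivAt.comp (g := Function.uncurry H) (f := fun z => (z, ξ)) x (hH.differentiableAt hξ).hasFDerivAt (hasFDerivAt_prodMk_left x ξ)

theorem hasFDerivAt_right (hH : IsPhase H) {x ξ : RN n m} (hξ : ξ ≠ 0) :
    HasFDerivAt (H x) ((fderiv ℝ (Function.uncurry H) (x, ξ)).comp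
      (ContinuousLinearMap.inr ℝ (RN n m) (RN n m))) ξ :=
  HasFDerivAt.comp (g := Function.uncurry H) (f := fun ζ => (x, ζ)) ξ (hH.differentiableAt hξ).hasFDerivAt (hasFDerivAt_prodMk_right x ξ)

theorem contDiff_left (hH : IsPhase H) {ξ : RN n m} (hξ : ξ ≠ 0) :
    ContDiff ℝ ∞ (fun z => H z ξ) :=
  contDiff_iff_contDiffAt.2 fun x =>
    (hH.contDiffAt hξ).comp x (contDiffAt_id.prodMk contDiffAt_const)

theorem contDiffOn_fderiv (hH : IsPhase H) :
    ContDiffOn ℝ ∞ (fderiv ℝ (Function.uncurry H)) {q | q.2 ≠ 0} :=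
  hH.smooth.fderiv_of_isOpen isOpen_snd_ne_zero (by simp)

/-- The derivative of a phase function in `x` in a fixed direction. -/
theorem partial_left (hH : IsPhase H) (v : RN n m) :
    IsPhase (fun x ξ => fderiv ℝ (fun z => H z ξ) x v) where
  smooth := by
    refine (hH.contDiffOn_fderiv.clm_apply (contDiffOn_const (c := ((v, 0) : RN n m × RN n m)))).congr ?_
    rintro ⟨x, ξ⟩ hξ
    simp only [Function.uncurry_apply_pair]
    rw [(hH.hasFDerivAt_left hξ).fderiv]
    rfl
  homogeneous x ξ t ht := by
    simp only [hH.homogeneous _ _ _ ht]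
    exact congrArg (fun L : RN n m → RN n m →L[ℝ] ℝ => L x v)
      (fderiv_const_smul_field t (f := fun z => H z ξ))

theorem continuousOn_fderiv_right (hH : IsPhase H) :
    ContinuousOn (fun q : RN n m × RN n m => fderiv ℝ (H q.1) q.2) {q | q.2 ≠ 0} := by
  refine ((hH.contDiffOn_fderiv.clm_comp (contDiffOn_const
    (c := ContinuousLinearMap.inr ℝ (RN n m) (RN n m)))).continuousOn).congr ?_
  rintro ⟨x, ξ⟩ hξ
  exact (hH.hasFDerivAt_right hξ).fderiv

/-- Differentiating `ζ ↦ H x (t • ζ)` by the chain rule and by homogeneity gives two expressions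
that both carry a factor `t`, which cancels. -/
theorem fderiv_right_smul (hH : IsPhase H) (x ξ : RN n m) (t : ℝ) (ht : 0 < t) :
    fderiv ℝ (H x) (t • ξ) = fderiv ℝ (H x) ξ := by
  have h1 : fderiv ℝ (fun ζ => H x (t • ζ)) ξ = t • fderiv ℝ (H x) (t • ξ) :=
    fderiv_comp_smul (f := H x) (x := ξ) t
  have h2 : fderiv ℝ (fun ζ => H x (t • ζ)) ξ = t • fderiv ℝ (H x) ξ := by
    simp only [hH.homogeneous _ _ _ ht]
    exact congrFun (fderiv_const_smul_field t (f := H x)) ξ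
  exact smul_right_injective _ ht.ne' (h1.symm.trans h2)

/-- The `ξ`-gradient is homogeneous of degree zero, hence bounded over `K`. The segment must avoid
the origin because the phase need not be differentiable there. -/
theorem exists_lipschitz (hH : IsPhase H) {K : Set (RN n m)} (hK : IsCompact K) :
    ∃ C : ℝ, 0 ≤ C ∧ ∀ x ∈ K, ∀ ξ η : RN n m, (∀ ζ ∈ segment ℝ ξ η, ζ ≠ 0) →
      |H x ξ - H x η| ≤ C * ‖ξ - η‖ := by
  obtain ⟨C, hC⟩ := exists_bound_of_homogeneous_zero hH.continuousOn_fderiv_right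
    (fun x ξ t ht _ => hH.fderiv_right_smul x ξ t ht) hK
  refine ⟨|C|, abs_nonneg _, fun x hx ξ η hs => ?_⟩
  exact (convex_segment ξ η).norm_image_sub_le_of_norm_hasFDerivWithin_le
    (fun ζ hζ => ((hH.hasFDerivAt_right (x := x) (hs ζ hζ)).differentiableAt.hasFDerivAt.hasFDerivWithinAt))
    (fun ζ hζ => (hC x hx ζ (hs ζ hζ)).trans (le_abs_self C)) (right_mem_segment ℝ ξ η)
    (left_mem_segment ℝ ξ η)

/-- Symmetry of second derivatives. In this order the Hessian is the `ξ`-gradient of the functions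
in `partial_left`, which are themselves phase functions, so the homogeneity lemmas apply to its
rows. -/
theorem mixedHessian_eq (hH : IsPhase H) {x ξ : RN n m} (hξ : ξ ≠ 0) :
    mixedHessian H x ξ = Matrix.of fun i k =>
      fderiv ℝ (fun ζ => fderiv ℝ (fun z => H z ζ) x (coordVec i)) ξ (coordVec k) := by
  ext i k
  set U := Function.uncurry H with hU
  have hd : DifferentiableAt ℝ (fderiv ℝ U) (x, ξ) :=
    ((hH.contDiffAt hξ).fderiv_right (m := ∞) (by simp)).differentiableAt (by simp)
  have hsym : IsSymmSndFDerivAt ℝ U (x, ξ) := (hH.contDiffAt hξ).isSymmSndFDerivAt (by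
    simp only [minSmoothness_of_isRCLikeNormedField]
    exact WithTop.coe_le_coe.2 le_top)
  have h1 : ∀ v : RN n m, HasFDerivAt (fun z => fderiv ℝ U (z, ξ) (0, v))
      (((fderiv ℝ (fderiv ℝ U) (x, ξ)).flip (0, v)).comp
        (ContinuousLinearMap.inl ℝ (RN n m) (RN n m))) x := fun v =>
    HasFDerivAt.comp (g := fun q => fderiv ℝ U q (0, v)) x ((ContinuousLinearMap.apply ℝ ℝ ((0, v) : RN n m × RN n m)).hasFDerivAt.comp (x, ξ) hd.hasFDerivAt) (hasFDerivAt_prodMk_left x ξ)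
  have h2 : ∀ v : RN n m, HasFDerivAt (fun ζ => fderiv ℝ U (x, ζ) (v, 0))
      (((fderiv ℝ (fderiv ℝ U) (x, ξ)).flip (v, 0)).comp
        (ContinuousLinearMap.inr ℝ (RN n m) (RN n m))) ξ := fun v =>
    HasFDerivAt.comp (g := fun q => fderiv ℝ U q (v, 0)) ξ ((ContinuousLinearMap.apply ℝ ℝ ((v, 0) : RN n m × RN n m)).hasFDerivAt.comp (x, ξ) hd.hasFDerivAt) (hasFDerivAt_prodMk_right x ξ)
  simp only [mixedHessian, Matrix.of_apply]
  have e1 : (fun z : RN n m => fderiv ℝ (H z) ξ (coordVec k)) =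
      fun z => fderiv ℝ U (z, ξ) (0, coordVec k) := by
    funext z
    rw [(hH.hasFDerivAt_right hξ).fderiv]; rfl
  have e2 : (fun ζ : RN n m => fderiv ℝ (fun z => H z ζ) x (coordVec i)) =ᶠ[𝓝 ξ]
      fun ζ => fderiv ℝ U (x, ζ) (coordVec i, 0) := by
    filter_upwards [isOpen_ne.mem_nhds hξ] with ζ hζ
    rw [(hH.hasFDerivAt_left hζ).fderiv]; rfl
  rw [e1, (h1 _).fderiv, e2.fderiv_eq, (h2 _).fderiv]
  exact hsym _ _

/-- The narrow cone of directions around a unit vector. -/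
def _root_.ConeFIO.narrowCone (ϑ : RN n m) (r : ℝ) : Set (RN n m) := {ξ | ‖ξ - ‖ξ‖ • ϑ‖ < r * ‖ξ‖}

theorem _root_.ConeFIO.ne_zero_of_mem_narrowCone {ϑ ξ : RN n m} {r : ℝ} (h : ξ ∈ narrowCone ϑ r) :
    ξ ≠ 0 := by
  rintro rfl
  simp [narrowCone] at h

/-- The point is compared with the convex combination `S` of the two norms: its distance to `S • ϑ`
and the difference between its norm and `S` are both below `r S`, and `S` is at most twice its norm.
The crude factor 4 is harmless, as apertures are chosen with room to spare. -/
theorem _root_.ConeFIO.segment_subset_narrowCone {ϑ ξ η ζ : RN n m} {r : ℝ} (hϑ : ‖ϑ‖ = 1)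
    (hr : r ≤ 1 / 2) (hξ : ξ ∈ narrowCone ϑ r) (hη : η ∈ narrowCone ϑ r)
    (hζ : ζ ∈ segment ℝ ξ η) : ζ ∈ narrowCone ϑ (4 * r) := by
  obtain ⟨a, b, ha, hb, hab, rfl⟩ := hζ
  have hξ0 := norm_pos_iff.2 (ne_zero_of_mem_narrowCone hξ)
  have hη0 := norm_pos_iff.2 (ne_zero_of_mem_narrowCone hη)
  simp only [narrowCone, Set.mem_ofPred_eq] at hξ hη ⊢
  set S := a * ‖ξ‖ + b * ‖η‖ with hS
  have hS0 : 0 < S := by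
    rcases ha.lt_or_eq with h | h
    · positivity
    · have : b = 1 := by linarith
      rw [hS, ← h, this]; simpa using hη0
  have h1 : ‖(a • ξ + b • η) - S • ϑ‖ < r * S := by
    have e : (a • ξ + b • η) - S • ϑ = a • (ξ - ‖ξ‖ • ϑ) + b • (η - ‖η‖ • ϑ) := by
      rw [hS]; module
    rw [e]
    refine (norm_add_le _ _).trans_lt ?_
    rw [norm_smul, norm_smul, Real.norm_of_nonneg ha, Real.norm_of_nonneg hb]
    have h1 := mul_le_mul_of_nonneg_left hξ.le ha
    have h2 := mul_le_mul_of_nonneg_left hη.le hb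
    rcases ha.lt_or_eq with h | h
    · have := mul_lt_mul_of_pos_left hξ h
      rw [hS]; linarith
    · have hb1 : b = 1 := by linarith
      rw [hS, ← h, hb1]; linarith
  have h2 : |‖a • ξ + b • η‖ - S| < r * S := by
    have := abs_norm_sub_norm_le (a • ξ + b • η) (S • ϑ)
    rw [norm_smul, hϑ, mul_one, Real.norm_of_nonneg hS0.le] at this
    exact this.trans_lt h1
  have h3 : ‖(a • ξ + b • η) - ‖a • ξ + b • η‖ • ϑ‖ < 2 * (r * S) := by
    have e : (a • ξ + b • η) - ‖a • ξ + b • η‖ • ϑ =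
      ((a • ξ + b • η) - S • ϑ) - (‖a • ξ + b • η‖ - S) • ϑ := by module
    rw [e]
    refine (norm_sub_le _ _).trans_lt ?_
    rw [norm_smul, hϑ, mul_one, Real.norm_eq_abs]
    linarith
  have hr0 : 0 < r := by
    by_contra h
    have := (norm_nonneg _).trans_lt h1
    nlinarith
  have h4 : S ≤ 2 * ‖a • ξ + b • η‖ := by
    have := (abs_lt.1 h2).1
    nlinarith
  calc _ < 2 * (r * S) := h3
    _ ≤ 4 * r * ‖a • ξ + b • η‖ := by nlinarith

theorem _root_.ConeFIO.norm_normalize_sub_lt {ϑ ξ : RN n m} {r : ℝ} (h : ξ ∈ narrowCone ϑ r) :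
    ‖‖ξ‖⁻¹ • ξ - ϑ‖ < r := by
  have h0 := norm_pos_iff.2 (ne_zero_of_mem_narrowCone h)
  have e : ‖ξ‖⁻¹ • ξ - ϑ = ‖ξ‖⁻¹ • (ξ - ‖ξ‖ • ϑ) := by
    rw [smul_sub, smul_smul, inv_mul_cancel₀ h0.ne', one_smul]
  rw [e, norm_smul, norm_inv, norm_norm, inv_mul_lt_iff₀ h0, mul_comm]
  exact h

/-- Compactness: over unit directions, the points of `K` where the determinant is at least `c` in
modulus form a compact set, on which the matrix is injective. The length of the image of a unit
vector thus has a positive minimum, and homogeneity in `ξ` and linearity in `v` remove the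
normalizations. -/
theorem exists_hessian_lower (hH : IsPhase H) {K : Set (RN n m)} (hK : IsCompact K) {c : ℝ}
    (hc : 0 < c) : ∃ c' : ℝ, 0 < c' ∧ ∀ x ∈ K, ∀ ξ : RN n m, ξ ≠ 0 →
      c ≤ |(mixedHessian H x ξ).det| → ∀ v : RN n m, c' * ‖v‖ ≤ ‖fun i : Fin n ⊕ Fin m =>
        fderiv ℝ (fun ζ => fderiv ℝ (fun z => H z ζ) x (coordVec i)) ξ v‖ := by
  set A : Fin n ⊕ Fin m → RN n m × RN n m → RN n m →L[ℝ] ℝ := fun i q =>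
    fderiv ℝ (fun ζ => fderiv ℝ (fun z => H z ζ) q.1 (coordVec i)) q.2 with hA
  have hAc : ∀ i, ContinuousOn (A i) {q | q.2 ≠ 0} := fun i =>
    (hH.partial_left (coordVec i)).continuousOn_fderiv_right
  have hAh : ∀ i (x ξ : RN n m) (t : ℝ), 0 < t → A i (x, t • ξ) = A i (x, ξ) := fun i x ξ t ht =>
    (hH.partial_left (coordVec i)).fderiv_right_smul x ξ t ht
  set Md : RN n m × RN n m → Matrix (Fin n ⊕ Fin m) (Fin n ⊕ Fin m) ℝ := fun q =>
    Matrix.of fun i k => A i q (coordVec k) with hMd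
  have hMc : ContinuousOn (fun q => |(Md q).det|) {q : RN n m × RN n m | q.2 ≠ 0} := by
    refine ContinuousOn.abs ?_
    refine (continuous_id.matrix_det.comp_continuousOn (?_ : ContinuousOn Md _))
    refine continuousOn_pi.2 fun i => continuousOn_pi.2 fun k => ?_
    exact (hAc i).clm_apply continuousOn_const
  set S := Metric.sphere (0 : RN n m) 1
  have hSne : ∀ q ∈ K ×ˢ S, (q : RN n m × RN n m).2 ≠ 0 := fun q hq =>
    Metric.ne_of_mem_sphere hq.2 one_ne_zero
  set D : Set (RN n m × RN n m) := (K ×ˢ S) ∩ {q | c ≤ |(Md q).det|} with hD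
  have hDc : IsCompact D := by
    have hcl : IsClosed (K ×ˢ S) := (hK.prod (isCompact_sphere _ _)).isClosed
    have := (hMc.mono hSne).preimage_isClosed_of_isClosed hcl (isClosed_Ici (a := c))
    exact (hK.prod (isCompact_sphere _ _)).of_isClosed_subset this Set.inter_subset_left
  have hcont : ContinuousOn (fun p : (RN n m × RN n m) × RN n m =>
      ‖fun i : Fin n ⊕ Fin m => A i p.1 p.2‖) (D ×ˢ S) := by
    refine ContinuousOn.norm (continuousOn_pi.2 fun i => ?_)
    refine ContinuousOn.clm_apply ((hAc i).comp continuousOn_fst fun p hp => hSne _ hp.1.1)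
      continuousOn_snd
  obtain ⟨c', hc', hmin⟩ := (hDc.prod (isCompact_sphere (0 : RN n m) 1)).exists_forall_le'
    hcont (a := 0) (by
      rintro ⟨q, v⟩ ⟨hq, hv⟩
      refine norm_pos_iff.2 fun h0 => ?_
      have hv0 : v ≠ 0 := Metric.ne_of_mem_sphere hv one_ne_zero
      have hdet : (Md q).det ≠ 0 := fun h => by
        have := hq.2
        simp only [Set.mem_ofPred_eq, h, abs_zero] at this
        linarith
      have hmul : Matrix.mulVec (Md q) (fun k => v k) = 0 := by
        funext i
        have hvs : v = ∑ k, v k • coordVec k := by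
          conv_lhs => rw [← (EuclideanSpace.basisFun (Fin n ⊕ Fin m) ℝ).sum_repr v]
          simp [coordVec]
        have h1 : A i q v = 0 := congrFun h0 i
        rw [hvs, map_sum] at h1
        simp only [Matrix.mulVec, dotProduct, hMd, Matrix.of_apply, Pi.zero_apply]
        rw [← h1]
        exact Finset.sum_congr rfl fun k _ => by rw [map_smul, smul_eq_mul, mul_comm]
      have := Matrix.eq_zero_of_mulVec_eq_zero hdet hmul
      exact hv0 (by ext k; exact congrFun this k))
  refine ⟨c', hc', fun x hx ξ hξ hdet v => ?_⟩
  by_cases hv : v = 0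
  · simp [hv]
  have hvn := norm_pos_iff.2 hv
  have hmem : ((x, ‖ξ‖⁻¹ • ξ), ‖v‖⁻¹ • v) ∈ D ×ˢ S := by
    refine ⟨⟨⟨hx, by simp [S, norm_smul, hξ]⟩, ?_⟩, by simp [S, norm_smul, hv]⟩
    have : Md (x, ‖ξ‖⁻¹ • ξ) = mixedHessian H x ξ := by
      rw [hH.mixedHessian_eq hξ, hMd]
      ext i k
      simp only [Matrix.of_apply]
      rw [hAh i x ξ _ (by positivity)]
    simpa [this] using hdet
  have h1 := hmin _ hmem
  simp only at h1
  have e : (fun i : Fin n ⊕ Fin m => A i (x, ‖ξ‖⁻¹ • ξ) (‖v‖⁻¹ • v)) =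
      ‖v‖⁻¹ • fun i : Fin n ⊕ Fin m => A i (x, ξ) v := by
    funext i
    rw [hAh i x ξ _ (by positivity)]
    simp
  rw [e, norm_smul, norm_inv, norm_norm, le_inv_mul_iff₀ hvn, mul_comm] at h1
  exact h1

/-- The gradient in `x` of a non-degenerate phase function separates frequencies in a narrow
cone. -/
theorem exists_gradient_lower (hH : IsPhase H) {K : Set (RN n m)} (hK : IsCompact K) {c : ℝ}
    (hc : 0 < c) : ∃ r c' : ℝ, 0 < r ∧ r ≤ 1 / 16 ∧ 0 < c' ∧ ∀ ϑ : RN n m, ‖ϑ‖ = 1 → ∀ x ∈ K,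
      ∀ ξ ∈ narrowCone ϑ r, ∀ η ∈ narrowCone ϑ r, c ≤ |(mixedHessian H x ξ).det| →
      c' * ‖ξ - η‖ ^ 2 ≤ ∑ i : Fin n ⊕ Fin m, (fderiv ℝ (fun z => H z ξ) x (coordVec i) -
        fderiv ℝ (fun z => H z η) x (coordVec i)) ^ 2 := by
  obtain ⟨c₁, hc₁, hlow⟩ := hH.exists_hessian_lower hK hc
  have hr : ∀ i : Fin n ⊕ Fin m, ∃ r : ℝ, 0 < r ∧ ∀ x ∈ K, ∀ ξ ζ : RN n m, ξ ≠ 0 → ζ ≠ 0 →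
      ‖‖ξ‖⁻¹ • ξ - ‖ζ‖⁻¹ • ζ‖ < r →
      ‖fderiv ℝ (fun ζ => fderiv ℝ (fun z => H z ζ) x (coordVec i)) ξ -
        fderiv ℝ (fun ζ => fderiv ℝ (fun z => H z ζ) x (coordVec i)) ζ‖ ≤ c₁ / 2 := fun i =>
    exists_close_of_homogeneous_zero (hH.partial_left (coordVec i)).continuousOn_fderiv_right
      (fun x ξ t ht _ => (hH.partial_left (coordVec i)).fderiv_right_smul x ξ t ht) hK
      (half_pos hc₁)
  choose r hr0 hr using hr
  obtain ⟨r₀, hr₀, hr₀'⟩ : ∃ r₀ : ℝ, 0 < r₀ ∧ ∀ i, r₀ ≤ r i := by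
    rcases isEmpty_or_nonempty (Fin n ⊕ Fin m) with h | h
    · exact ⟨1, one_pos, fun i => h.elim i⟩
    · obtain ⟨i, hi⟩ := Finite.exists_min r
      exact ⟨r i, hr0 i, hi⟩
  -- A point of the segment lies in the cone of aperture `4r` and `ξ` in that of aperture `r`, so
  -- their directions differ by less than `5r ≤ r₀`. The Hessian then varies by at most `c₁ / 2`
  -- along the segment, and half of the lower bound `c₁` survives linearization at `ξ`.
  refine ⟨min (r₀ / 5) (1 / 16), (c₁ / 2) ^ 2, by positivity, min_le_right _ _, by positivity,
    fun ϑ hϑ x hx ξ hξ η hη hdet => ?_⟩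
  set r₁ := min (r₀ / 5) (1 / 16)
  have hr₁ : r₁ ≤ 1 / 2 := (min_le_right _ _).trans (by norm_num)
  have hr₁' : r₁ ≤ r₀ / 5 := min_le_left _ _
  have hξ0 := ne_zero_of_mem_narrowCone hξ
  have hseg : ∀ ζ ∈ segment ℝ ξ η, ζ ∈ narrowCone ϑ (4 * r₁) := fun ζ hζ =>
    segment_subset_narrowCone hϑ hr₁ hξ hη hζ
  have hmv : ∀ i, |(fderiv ℝ (fun z => H z η) x (coordVec i) -
      fderiv ℝ (fun z => H z ξ) x (coordVec i)) -
      fderiv ℝ (fun ζ => fderiv ℝ (fun z => H z ζ) x (coordVec i)) ξ (η - ξ)| ≤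
      c₁ / 2 * ‖η - ξ‖ := by
    intro i
    refine (convex_segment ξ η).norm_image_sub_le_of_norm_hasFDerivWithin_le'
      (f := fun ζ => fderiv ℝ (fun z => H z ζ) x (coordVec i))
      (f' := fun ζ => fderiv ℝ (fun ζ => fderiv ℝ (fun z => H z ζ) x (coordVec i)) ζ)
      (fun ζ hζ => ?_) (fun ζ hζ => ?_) (left_mem_segment ℝ ξ η) (right_mem_segment ℝ ξ η)
    · exact ((hH.partial_left (coordVec i)).hasFDerivAt_right (x := x)
        (ne_zero_of_mem_narrowCone (hseg ζ hζ))).differentiableAt.hasFDerivAt.hasFDerivWithinAt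
    · refine hr i x hx ζ ξ (ne_zero_of_mem_narrowCone (hseg ζ hζ)) hξ0 ?_
      have h1 := norm_normalize_sub_lt (hseg ζ hζ)
      have h2 := norm_normalize_sub_lt hξ
      have h3 : ‖‖ζ‖⁻¹ • ζ - ‖ξ‖⁻¹ • ξ‖ ≤ ‖‖ζ‖⁻¹ • ζ - ϑ‖ + ‖‖ξ‖⁻¹ • ξ - ϑ‖ := by
        have := norm_sub_le (‖ζ‖⁻¹ • ζ - ϑ) (‖ξ‖⁻¹ • ξ - ϑ)
        rwa [sub_sub_sub_cancel_right] at this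
      linarith [hr₀' i]
  set g : Fin n ⊕ Fin m → ℝ := fun i => fderiv ℝ (fun z => H z η) x (coordVec i) -
      fderiv ℝ (fun z => H z ξ) x (coordVec i) with hg
  set B : Fin n ⊕ Fin m → ℝ := fun i =>
    fderiv ℝ (fun ζ => fderiv ℝ (fun z => H z ζ) x (coordVec i)) ξ (η - ξ) with hB
  have h1 : c₁ * ‖η - ξ‖ ≤ ‖B‖ := hlow x hx ξ hξ0 hdet (η - ξ)
  have h2 : ‖g - B‖ ≤ c₁ / 2 * ‖η - ξ‖ :=
    (pi_norm_le_iff_of_nonneg (by positivity)).2 fun i => hmv i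
  have h3 : c₁ / 2 * ‖η - ξ‖ ≤ ‖g‖ := by
    have : ‖B‖ ≤ ‖g‖ + ‖g - B‖ := by
      have := norm_sub_le g (g - B)
      rwa [sub_sub_cancel] at this
    linarith
  have h4 : ‖g‖ ^ 2 ≤ ∑ i, g i ^ 2 := by
    have : ‖g‖ ≤ √(∑ i, g i ^ 2) := (pi_norm_le_iff_of_nonneg (by positivity)).2 fun i => by
      rw [Real.norm_eq_abs]
      refine Real.abs_le_sqrt ?_
      exact Finset.single_le_sum (f := fun i => g i ^ 2) (fun j _ => sq_nonneg _) (Finset.mem_univ i)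
    calc ‖g‖ ^ 2 ≤ √(∑ i, g i ^ 2) ^ 2 := by gcongr
      _ = _ := Real.sq_sqrt (by positivity)
  calc (c₁ / 2) ^ 2 * ‖ξ - η‖ ^ 2 = (c₁ / 2 * ‖η - ξ‖) ^ 2 := by rw [norm_sub_rev]; ring
    _ ≤ ‖g‖ ^ 2 := by gcongr
    _ ≤ ∑ i, g i ^ 2 := h4
    _ = _ := Finset.sum_congr rfl fun i _ => by rw [hg]; ring

end IsPhase

/-! ### Amplitudes and the `L²` bound -/

/-- Amplitudes with bounded `x`-derivatives and compact `x`-support, on whose support the phase is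
non-degenerate. No smoothness in the frequency is required. -/
structure IsAmplitude (Φ : RN n m → RN n m → ℝ) (s : RN n m → RN n m → ℂ) : Prop where
  measurable : Measurable (Function.uncurry s)
  smooth : SmoothFam (fun ξ x => s x ξ)
  bdd : ∀ k, UnifBdd (coordVec (n := n) (m := m)) k (fun ξ x => s x ξ)
  support : ∃ K : Set (RN n m), IsCompact K ∧ ∀ ξ, tsupport (fun x => s x ξ) ⊆ K
  nondeg : ∃ c : ℝ, 0 < c ∧ ∀ ξ : RN n m, ξ ≠ 0 → ∀ x ∈ tsupport (fun x => s x ξ),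
    c ≤ |(mixedHessian Φ x ξ).det|

/-- The function `e^{2πiΦ(x,ξ)} s(x,ξ)`, set to zero at `ξ = 0`. -/
def osc (Φ : RN n m → RN n m → ℝ) (s : RN n m → RN n m → ℂ) (x ξ : RN n m) : ℂ :=
  if ξ = 0 then 0 else Complex.exp (2 * Real.pi * Complex.I * (Φ x ξ : ℂ)) * s x ξ

/-- The operator `g ↦ ∫ e^{2πiΦ(x,ξ)} s(x,ξ) g(ξ) dξ`. -/
def oscOp (a : RN n m → RN n m → ℂ) (g : RN n m → ℂ) (x : RN n m) : ℂ := ∫ ξ, a x ξ * g ξ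

variable {Φ : RN n m → RN n m → ℝ} {s : RN n m → RN n m → ℂ}

theorem norm_exp_two_pi (t : ℝ) : ‖Complex.exp (2 * Real.pi * Complex.I * (t : ℂ))‖ = 1 := by
  rw [show (2 * Real.pi * Complex.I * (t : ℂ)) = ((2 * Real.pi * t : ℝ) : ℂ) * Complex.I by
    push_cast; ring]
  exact Complex.norm_exp_ofReal_mul_I _

theorem norm_osc_le (x ξ : RN n m) : ‖osc Φ s x ξ‖ ≤ ‖s x ξ‖ := by
  unfold osc
  split_ifs
  · simp
  · rw [norm_mul, norm_exp_two_pi, one_mul]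

theorem IsPhase.measurable_osc (hΦ : IsPhase Φ) (hs : Measurable (Function.uncurry s)) :
    Measurable (Function.uncurry (osc Φ s)) := by
  classical
  have hset : MeasurableSet {q : RN n m × RN n m | q.2 ≠ 0} := isOpen_snd_ne_zero.measurableSet
  have h1 : Measurable ({q : RN n m × RN n m | q.2 ≠ 0}.piecewise (Function.uncurry Φ) 0) :=
    hΦ.smooth.continuousOn.measurable_piecewise continuousOn_const hset
  have h2 : Measurable fun q : RN n m × RN n m =>
      Complex.exp (2 * Real.pi * Complex.I *
        (({q : RN n m × RN n m | q.2 ≠ 0}.piecewise (Function.uncurry Φ) 0 q : ℝ) : ℂ)) *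
        Function.uncurry s q :=
    ((Complex.measurable_ofReal.comp h1).const_mul _).cexp.mul hs
  have h3 : Function.uncurry (osc Φ s) = {q : RN n m × RN n m | q.2 ≠ 0}.indicator fun q =>
      Complex.exp (2 * Real.pi * Complex.I *
        (({q : RN n m × RN n m | q.2 ≠ 0}.piecewise (Function.uncurry Φ) 0 q : ℝ) : ℂ)) *
        Function.uncurry s q := by
    funext ⟨x, ξ⟩
    by_cases h : ξ = 0 <;> simp [osc, h, Set.indicator, Set.piecewise]
  rw [h3]
  exact h2.indicator hset

theorem sq_eLpNorm_two {α E : Type*} [MeasurableSpace α] {μ : Measure α} [NormedAddCommGroup E]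
    (f : α → E) : eLpNorm f 2 μ ^ 2 = ∫⁻ x, ‖f x‖ₑ ^ 2 ∂μ := by
  have := eLpNorm_nnreal_pow_eq_lintegral (f := f) (p := 2) (μ := μ) two_ne_zero
  simpa using this

theorem measurable_oscOp {a : RN n m → RN n m → ℂ} (ha : Measurable (Function.uncurry a))
    {g : RN n m → ℂ} (hg : AEStronglyMeasurable g volume) :
    AEStronglyMeasurable (oscOp a g) volume := by
  refine AEStronglyMeasurable.integral_prod_right' (f := fun q => a q.1 q.2 * g q.2) ?_
  exact ha.aestronglyMeasurable.mul hg.comp_snd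

/-- The `T*T` argument with Schur's test. -/
theorem lintegral_sq_oscOp_le {a : RN n m → RN n m → ℂ} (ha : Measurable (Function.uncurry a))
    {B : ℝ} (hB : ∀ x ξ, ‖a x ξ‖ ≤ B) {K : Set (RN n m)} (hK : IsCompact K)
    (haK : ∀ x ∉ K, ∀ ξ, a x ξ = 0) {k : RN n m → ℝ≥0∞} (hk : Measurable k) {g : RN n m → ℂ}
    (hg : Integrable g) (hak : ∀ ξ η, g ξ ≠ 0 → g η ≠ 0 →
      ‖∫ x, a x ξ * (starRingEnd ℂ) (a x η)‖ₑ ≤ k (ξ - η)) :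
    ∫⁻ x, ‖oscOp a g x‖ₑ ^ 2 ≤ 2 * (∫⁻ z, k z) * ∫⁻ ξ, ‖g ξ‖ₑ ^ 2 := by
  have hag : ∀ x, Integrable (fun ξ => a x ξ * g ξ) := fun x =>
    hg.bdd_mul (ha.comp measurable_prodMk_left).aestronglyMeasurable
      (Eventually.of_forall (hB x))
  set Ψ : RN n m → RN n m × RN n m → ℂ := fun x q =>
    (a x q.1 * g q.1) * (starRingEnd ℂ) (a x q.2 * g q.2) with hΨ
  have e1 : ∀ x, oscOp a g x * (starRingEnd ℂ) (oscOp a g x) = ∫ q, Ψ x q := by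
    intro x
    rw [oscOp, ← integral_conj]
    exact (integral_prod_mul (fun ξ => a x ξ * g ξ) fun ξ => (starRingEnd ℂ) (a x ξ * g ξ)).symm
  have hB0 : 0 ≤ B := (norm_nonneg _).trans (hB 0 0)
  have hint : Integrable (Function.uncurry Ψ) (volume.prod volume) := by
    have hdom : Integrable (fun p : RN n m × (RN n m × RN n m) =>
        (K.indicator (fun _ => B ^ 2) p.1) * (‖g p.2.1‖ * ‖g p.2.2‖)) (volume.prod volume) := by
      refine Integrable.mul_prod (f := K.indicator fun _ => B ^ 2)
        (g := fun q : RN n m × RN n m => ‖g q.1‖ * ‖g q.2‖) ?_ ?_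
      · exact (integrable_indicator_iff hK.measurableSet).2
          (integrableOn_const hK.measure_lt_top.ne)
      · exact Integrable.mul_prod hg.norm hg.norm
    refine hdom.mono' ?_ (Eventually.of_forall ?_)
    · have h1 : Measurable fun p : RN n m × (RN n m × RN n m) => a p.1 p.2.1 :=
        ha.comp (measurable_fst.prodMk (measurable_fst.comp measurable_snd))
      have h2 : Measurable fun p : RN n m × (RN n m × RN n m) => a p.1 p.2.2 :=
        ha.comp (measurable_fst.prodMk (measurable_snd.comp measurable_snd))
      have g1 : AEStronglyMeasurable (fun p : RN n m × (RN n m × RN n m) => g p.2.1)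
          (volume.prod volume) := (hg.1.comp_fst (ν := volume)).comp_snd
      have g2 : AEStronglyMeasurable (fun p : RN n m × (RN n m × RN n m) => g p.2.2)
          (volume.prod volume) := (hg.1.comp_snd (μ := volume)).comp_snd
      exact (h1.aestronglyMeasurable.mul g1).mul
        (Complex.continuous_conj.comp_aestronglyMeasurable (h2.aestronglyMeasurable.mul g2))
    · rintro ⟨x, ξ, η⟩
      simp only [Function.uncurry_apply_pair, hΨ]
      by_cases hx : x ∈ K
      · rw [Set.indicator_of_mem hx, norm_mul, RCLike.norm_conj, norm_mul, norm_mul]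
        calc _ ≤ (B * ‖g ξ‖) * (B * ‖g η‖) := by
              gcongr
              exacts [hB _ _, hB _ _]
          _ = _ := by ring
      · simp [haK x hx, Set.indicator_of_notMem hx]
  have hint2 : Integrable fun x => oscOp a g x * (starRingEnd ℂ) (oscOp a g x) := by
    simp only [e1]
    exact hint.integral_prod_left
  have e2 : ∫⁻ x, ‖oscOp a g x‖ₑ ^ 2 = ‖∫ x, oscOp a g x * (starRingEnd ℂ) (oscOp a g x)‖ₑ := by
    have h1 : ∀ x, oscOp a g x * (starRingEnd ℂ) (oscOp a g x) = ((‖oscOp a g x‖ ^ 2 : ℝ) : ℂ) := by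
      intro x
      rw [Complex.mul_conj, Complex.normSq_eq_norm_sq]
    simp only [h1] at hint2 ⊢
    have h2 : Integrable fun x => ‖oscOp a g x‖ ^ 2 := by
      simpa using hint2.norm
    have h3 : ∀ x, ‖oscOp a g x‖ₑ ^ 2 = ENNReal.ofReal (‖oscOp a g x‖ ^ 2) := by
      intro x
      rw [ENNReal.ofReal_pow (norm_nonneg _), ofReal_norm]
    simp only [h3]
    have h4 : ∫ x, ((‖oscOp a g x‖ ^ 2 : ℝ) : ℂ) = ((∫ x, ‖oscOp a g x‖ ^ 2 : ℝ) : ℂ) :=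
      integral_ofReal
    rw [← ofReal_integral_eq_lintegral_ofReal h2 (Eventually.of_forall fun x => by positivity),
      h4, ← ofReal_norm, Complex.norm_real, Real.norm_of_nonneg]
    exact integral_nonneg fun x => by positivity
  rw [e2]
  simp only [e1]
  rw [integral_integral_swap hint]
  -- Bounding `|g(ξ)||g(η)|` by `|g(ξ)|² + |g(η)|²` splits the double integral into two equal
  -- contributions; this is the factor 2 of the conclusion. The kernel bound is needed only where
  -- `g` is nonzero, so `g` may be confined to a cone.
  have e3 : ∀ q : RN n m × RN n m, ‖∫ x, Ψ x q‖ₑ ≤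
      (‖g q.1‖ₑ ^ 2 + ‖g q.2‖ₑ ^ 2) * k (q.1 - q.2) := by
    rintro ⟨ξ, η⟩
    have h1 : ∫ x, Ψ x (ξ, η) = (∫ x, a x ξ * (starRingEnd ℂ) (a x η)) *
        (g ξ * (starRingEnd ℂ) (g η)) := by
      rw [← integral_mul_const]
      congr 1
      funext x
      simp only [hΨ, map_mul]
      ring
    rw [h1]
    by_cases h : g ξ = 0
    · simp [h]
    by_cases h' : g η = 0
    · simp [h']
    rw [enorm_mul, enorm_mul, mul_comm]
    refine mul_le_mul' ?_ (hak ξ η h h')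
    rw [show ‖(starRingEnd ℂ) (g η)‖ₑ = ‖g η‖ₑ by
      rw [← ofReal_norm, RCLike.norm_conj, ofReal_norm]]
    rcases le_total ‖g ξ‖ₑ ‖g η‖ₑ with h2 | h2
    · calc _ ≤ ‖g η‖ₑ * ‖g η‖ₑ := by gcongr
        _ ≤ _ := by rw [← sq]; exact le_add_self
    · calc _ ≤ ‖g ξ‖ₑ * ‖g ξ‖ₑ := by gcongr
        _ ≤ _ := by rw [← sq]; exact le_self_add
  have hgm : AEMeasurable (fun ξ => ‖g ξ‖ₑ ^ 2) := hg.1.enorm.pow_const 2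
  have hk1 : AEMeasurable (fun q : RN n m × RN n m => ‖g q.1‖ₑ ^ 2 * k (q.1 - q.2))
      (volume.prod volume) :=
    (hgm.comp_fst (ν := volume)).mul (hk.comp (measurable_fst.sub measurable_snd)).aemeasurable
  have hk2 : AEMeasurable (fun q : RN n m × RN n m => ‖g q.2‖ₑ ^ 2 * k (q.1 - q.2))
      (volume.prod volume) :=
    (hgm.comp_snd (μ := volume)).mul (hk.comp (measurable_fst.sub measurable_snd)).aemeasurable
  calc _ ≤ ∫⁻ q, ‖∫ x, Ψ x q‖ₑ := enorm_integral_le_lintegral_enorm _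
    _ ≤ ∫⁻ q : RN n m × RN n m, (‖g q.1‖ₑ ^ 2 + ‖g q.2‖ₑ ^ 2) * k (q.1 - q.2) :=
        lintegral_mono e3
    _ = (∫⁻ q : RN n m × RN n m, ‖g q.1‖ₑ ^ 2 * k (q.1 - q.2)) +
        ∫⁻ q : RN n m × RN n m, ‖g q.2‖ₑ ^ 2 * k (q.1 - q.2) := by
        simp only [add_mul]
        exact lintegral_add_left' hk1 _
    _ = (∫⁻ z, k z) * (∫⁻ ξ, ‖g ξ‖ₑ ^ 2) + (∫⁻ z, k z) * ∫⁻ ξ, ‖g ξ‖ₑ ^ 2 := by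
        congr 1
        · rw [Measure.volume_eq_prod, lintegral_prod _ hk1]
          have : ∀ ξ : RN n m, ∫⁻ η, ‖g ξ‖ₑ ^ 2 * k (ξ - η) = (∫⁻ z, k z) * ‖g ξ‖ₑ ^ 2 := fun ξ => by
            rw [lintegral_const_mul' _ _ (by simp), lintegral_sub_left_eq_self, mul_comm]
          simp only [this]
          rw [lintegral_const_mul'' _ hgm]
        · rw [Measure.volume_eq_prod, lintegral_prod_symm _ hk2]
          have : ∀ η : RN n m, ∫⁻ ξ, ‖g η‖ₑ ^ 2 * k (ξ - η) = (∫⁻ z, k z) * ‖g η‖ₑ ^ 2 := fun η => by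
            rw [lintegral_const_mul' _ _ (by simp), lintegral_sub_right_eq_self, mul_comm]
          simp only [this]
          rw [lintegral_const_mul'' _ hgm]
    _ = _ := by rw [mul_assoc, two_mul]

/-! ### Off-diagonal decay of the kernel of `T*T`. -/

variable {Φ : RN n m → RN n m → ℝ} {s : RN n m → RN n m → ℂ}

/-- Pairs of distinct frequencies lying in a common narrow cone. -/
def ConePair (n m : ℕ) (r : ℝ) : Type :=
  {p : RN n m × RN n m // p.1 ≠ p.2 ∧ ∃ ϑ : RN n m, ‖ϑ‖ = 1 ∧
    p.1 ∈ narrowCone ϑ r ∧ p.2 ∈ narrowCone ϑ r}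

/-- The normalized difference of a phase function at two frequencies. -/
def phaseQuot (H : RN n m → RN n m → ℝ) {r : ℝ} (p : ConePair n m r) (x : RN n m) : ℝ :=
  ‖p.1.1 - p.1.2‖⁻¹ * (H x p.1.1 - H x p.1.2)

theorem ConePair.ne_zero {r : ℝ} (p : ConePair n m r) : p.1.1 ≠ 0 ∧ p.1.2 ≠ 0 := by
  obtain ⟨-, ϑ, -, h1, h2⟩ := p.2
  exact ⟨ne_zero_of_mem_narrowCone h1, ne_zero_of_mem_narrowCone h2⟩

theorem ConePair.dist_pos {r : ℝ} (p : ConePair n m r) : 0 < ‖p.1.1 - p.1.2‖ :=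
  norm_pos_iff.2 (sub_ne_zero.2 p.2.1)

namespace IsPhase

variable {H : RN n m → RN n m → ℝ} {r : ℝ}

theorem smoothFam_phaseQuot (hH : IsPhase H) : SmoothFam (phaseQuot H (r := r)) := fun p =>
  contDiff_const.mul ((hH.contDiff_left p.ne_zero.1).sub (hH.contDiff_left p.ne_zero.2))

theorem fderiv_phaseQuot (hH : IsPhase H) (p : ConePair n m r) (x v : RN n m) :
    fderiv ℝ (phaseQuot H p) x v =
      phaseQuot (fun x ξ => fderiv ℝ (fun z => H z ξ) x v) p x := by
  have h1 := ((hH.contDiff_left p.ne_zero.1).differentiable (by simp) x).hasFDerivAt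
  have h2 := ((hH.contDiff_left p.ne_zero.2).differentiable (by simp) x).hasFDerivAt
  have h3 := ((h1.sub h2).const_mul ‖p.1.1 - p.1.2‖⁻¹).fderiv
  exact congrArg (fun L : RN n m →L[ℝ] ℝ => L v) h3

/-- An `x`-derivative of the quotient is the quotient of a differentiated phase, again a phase
function, so the case of order zero yields all orders by induction. That case is the Lipschitz bound
in `ξ`; the cut-off `χ` confines `x` to a compact set, where the bound is uniform over all pairs of
frequencies. -/
theorem unifBdd_phaseQuot (hr : r ≤ 1 / 2) (k : ℕ) : ∀ {H : RN n m → RN n m → ℝ}, IsPhase H →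
    ∀ {χ : RN n m → ℝ}, ContDiff ℝ ∞ χ → HasCompactSupport χ →
    UnifBdd (coordVec (n := n) (m := m)) k
      (fun (p : ConePair n m r) x => χ x * phaseQuot H p x) := by
  have key : ∀ {H : RN n m → RN n m → ℝ}, IsPhase H →
      ∀ {χ : RN n m → ℝ}, ContDiff ℝ ∞ χ → HasCompactSupport χ →
      ∃ C : ℝ, ∀ (p : ConePair n m r) x, ‖χ x * phaseQuot H p x‖ ≤ C := by
    intro H hH χ hχ hχc
    obtain ⟨C, hC0, hC⟩ := hH.exists_lipschitz hχc.isCompact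
    obtain ⟨D, hD⟩ := hχc.exists_bound_of_continuous hχ.continuous
    refine ⟨D * C, fun p x => ?_⟩
    have hD0 : 0 ≤ D := (norm_nonneg _).trans (hD 0)
    by_cases hx : x ∈ tsupport χ
    · rw [norm_mul]
      refine mul_le_mul (hD x) ?_ (norm_nonneg _) hD0
      rw [phaseQuot, norm_mul, norm_inv, norm_norm, inv_mul_le_iff₀ p.dist_pos, mul_comm]
      refine hC x hx _ _ fun ζ hζ => ?_
      obtain ⟨-, ϑ, hϑ, h1, h2⟩ := p.2
      exact ne_zero_of_mem_narrowCone (segment_subset_narrowCone hϑ hr h1 h2 hζ)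
    · rw [image_eq_zero_of_notMem_tsupport hx, zero_mul, norm_zero]
      positivity
  induction k with
  | zero => exact fun hH _ hχ hχc => key hH hχ hχc
  | succ k ih =>
    intro H hH χ hχ hχc
    refine ⟨key hH hχ hχc, fun i => ?_⟩
    have : dirDeriv coordVec i (fun (p : ConePair n m r) x => χ x * phaseQuot H p x) =
        fun p x => χ x * phaseQuot (fun x ξ => fderiv ℝ (fun z => H z ξ) x (coordVec i)) p x +
          fderiv ℝ χ x (coordVec i) * phaseQuot H p x := by
      funext p x
      simp only [dirDeriv]
      rw [fderiv_fun_mul' (hχ.differentiable (by simp) x)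
        (hH.smoothFam_phaseQuot.differentiable p x), ← hH.fderiv_phaseQuot]
      rfl
    rw [this]
    have hχ' : ContDiff ℝ ∞ (fun x => fderiv ℝ χ x (coordVec i)) :=
      (hχ.fderiv_right (m := ∞) (by simp)).clm_apply contDiff_const
    exact UnifBdd.add (fun p => hχ.mul ((hH.partial_left _).smoothFam_phaseQuot p))
      (fun p => hχ'.mul (hH.smoothFam_phaseQuot p)) (ih (hH.partial_left _) hχ hχc)
      (ih hH hχ' (hχc.fderiv_apply ℝ _))

end IsPhase

/-- A smooth compactly supported function that is one on a given compact set. -/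
theorem exists_smooth_eq_one {K : Set (RN n m)} (hK : IsCompact K) :
    ∃ χ : RN n m → ℝ, ContDiff ℝ ∞ χ ∧ HasCompactSupport χ ∧ ∀ x ∈ K, χ x = 1 := by
  obtain ⟨R, hR⟩ := hK.isBounded.subset_closedBall 0
  let f : ContDiffBump (0 : RN n m) := ⟨|R| + 1, |R| + 2, by positivity, by linarith⟩
  refine ⟨f, f.contDiff, f.hasCompactSupport, fun x hx => f.one_of_mem_closedBall ?_⟩
  exact Metric.closedBall_subset_closedBall ((le_abs_self R).trans (by simp [f])) (hR hx)

/-- Non-stationary phase with large parameter `|ξ - η|` and phase the normalized difference, whose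
`x`-gradient is bounded below on the support of the amplitude. For `|ξ - η| ≤ 1` the trivial bound
is enough. The order of decay `n + m + 1` exceeds the dimension by one, which makes the kernel
integrable. -/
theorem IsAmplitude.exists_kernel_bound (hs : IsAmplitude Φ s) (hΦ : IsPhase Φ) :
    ∃ r C : ℝ, 0 < r ∧ r ≤ 1 / 16 ∧ ∀ ϑ : RN n m, ‖ϑ‖ = 1 → ∀ ξ ∈ narrowCone ϑ r,
      ∀ η ∈ narrowCone ϑ r, ‖∫ x, osc Φ s x ξ * (starRingEnd ℂ) (osc Φ s x η)‖ ≤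
        C * (1 + ‖ξ - η‖) ^ (-((n + m + 1 : ℕ) : ℝ)) := by
  obtain ⟨K, hK, hsK⟩ := hs.support
  obtain ⟨c, hc, hdet⟩ := hs.nondeg
  obtain ⟨r, c', hr, hr16, hc', hlow⟩ := hΦ.exists_gradient_lower hK hc
  obtain ⟨χ, hχ, hχc, hχ1⟩ := exists_smooth_eq_one hK
  obtain ⟨g, hg, hg1⟩ := exists_smooth_inv hc'
  have hr2 : r ≤ 1 / 2 := by linarith
  set θ : ConePair n m r → RN n m → ℝ := phaseQuot Φ with hθ
  set D : Fin n ⊕ Fin m → ConePair n m r → RN n m → ℝ := fun i p x =>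
    χ x * phaseQuot (fun x ξ => fderiv ℝ (fun z => Φ z ξ) x (coordVec i)) p x with hD
  have sD : ∀ i, SmoothFam (D i) := fun i p =>
    hχ.mul ((hΦ.partial_left _).smoothFam_phaseQuot p)
  have uD : ∀ i k, UnifBdd coordVec k (D i) := fun i k =>
    IsPhase.unifBdd_phaseQuot hr2 k (hΦ.partial_left _) hχ hχc
  set V : ConePair n m r → RN n m → ℝ := fun p x => ∑ i, D i p x * D i p x with hV
  have sDD : ∀ i, SmoothFam (fun p x => D i p x * D i p x) := fun i p => (sD i p).mul (sD i p)
  have sV : SmoothFam V := SmoothFam.sum fun i _ => sDD i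
  have uV : ∀ k, UnifBdd coordVec k V := fun k =>
    UnifBdd.sum (fun i _ => sDD i) fun i _ => UnifBdd.mul (sD i) (sD i) (uD i k) (uD i k)
  -- The vector field is `∇θ / |∇θ|²`. The smooth substitute `g` for the reciprocal is used because
  -- the lower bound on `V` holds only on the support of the amplitude.
  set a : Fin n ⊕ Fin m → ConePair n m r → RN n m → ℝ := fun i p x => D i p x * g (V p x) with ha
  have sg : SmoothFam (fun p x => g (V p x)) := fun p => hg.comp (sV p)
  have sa : ∀ i, SmoothFam (a i) := fun i p => (sD i p).mul (sg p)
  have ua : ∀ i k, UnifBdd coordVec k (a i) := fun i k =>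
    UnifBdd.mul (sD i) sg (uD i k) (UnifBdd.smooth_comp hg sV (uV k))
  set b : ConePair n m r → RN n m → ℂ := fun p x =>
    s x p.1.1 * (starRingEnd ℂ) (s x p.1.2) with hb
  have s1 : SmoothFam (fun (p : ConePair n m r) x => s x p.1.1) := fun p => hs.smooth p.1.1
  have s2 : SmoothFam (fun (p : ConePair n m r) x => s x p.1.2) := fun p => hs.smooth p.1.2
  have s3 : SmoothFam (fun (p : ConePair n m r) x => (starRingEnd ℂ) (s x p.1.2)) :=
    SmoothFam.clm_comp Complex.conjCLE.toContinuousLinearMap s2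
  have u1 : ∀ k, UnifBdd coordVec k (fun (p : ConePair n m r) x => s x p.1.1) := fun k =>
    (hs.bdd k).reindex fun p : ConePair n m r => p.1.1
  have u2 : ∀ k, UnifBdd coordVec k (fun (p : ConePair n m r) x => s x p.1.2) := fun k =>
    (hs.bdd k).reindex fun p : ConePair n m r => p.1.2
  have u3 : ∀ k, UnifBdd coordVec k (fun (p : ConePair n m r) x => (starRingEnd ℂ) (s x p.1.2)) :=
    fun k => UnifBdd.clm_comp Complex.conjCLE.toContinuousLinearMap s2 (u2 k)
  have sb : SmoothFam b := fun p => (s1 p).mul (s3 p)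
  have ub : ∀ k, UnifBdd coordVec k b := fun k => UnifBdd.mul s1 s3 (u1 k) (u3 k)
  have hbs : ∀ p, tsupport (b p) ⊆ tsupport (fun x => s x p.1.1) := fun p =>
    closure_mono (Function.support_mul_subset_left _ _)
  have hone : ∀ p, ∀ x ∈ tsupport (b p), ∑ i, a i p x * fderiv ℝ (θ p) x (coordVec i) = 1 := by
    intro p x hx
    have hxs := hbs p hx
    have hxK : x ∈ K := hsK _ hxs
    have hDx : ∀ i, fderiv ℝ (θ p) x (coordVec i) = D i p x := fun i => by
      rw [hθ, hΦ.fderiv_phaseQuot, hD]; simp only [hχ1 x hxK, one_mul]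
    simp only [hDx, ha]
    have h1 : ∑ i, D i p x * g (V p x) * D i p x = g (V p x) * V p x := by
      rw [hV, Finset.mul_sum]
      exact Finset.sum_congr rfl fun i _ => by ring
    have h2 : c' ≤ V p x := by
      obtain ⟨-, ϑ, hϑ, h1, h2⟩ := p.2
      have h3 := hlow ϑ hϑ x hxK _ h1 _ h2 (hdet _ p.ne_zero.1 x hxs)
      have h4 : V p x = (‖p.1.1 - p.1.2‖ ^ 2)⁻¹ * ∑ i : Fin n ⊕ Fin m,
          (fderiv ℝ (fun z => Φ z p.1.1) x (coordVec i) -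
            fderiv ℝ (fun z => Φ z p.1.2) x (coordVec i)) ^ 2 := by
        rw [hV, Finset.mul_sum]
        refine Finset.sum_congr rfl fun i _ => ?_
        simp only [hD, hχ1 x hxK, phaseQuot, one_mul]
        ring
      have hp := p.dist_pos
      rw [h4, le_inv_mul_iff₀ (by positivity), mul_comm]
      exact h3
    rw [h1, hg1 _ h2, inv_mul_cancel₀ (by linarith)]
  obtain ⟨C, hC0, hC⟩ := nonstationary_phase (μ := (volume : Measure (RN n m)))
    hΦ.smoothFam_phaseQuot sa ua hK (n + m + 1) sb ub (fun p => (hbs p).trans (hsK _)) hone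
  obtain ⟨B, hB⟩ := hs.bdd 0
  have hB0 : 0 ≤ B := (norm_nonneg _).trans (hB 0 0)
  set C₀ := B ^ 2 * volume.real K with hC₀
  refine ⟨r, (C₀ + C) * 2 ^ (n + m + 1), hr, hr16, fun ϑ hϑ ξ hξ η hη => ?_⟩
  have hpos : 0 < 1 + ‖ξ - η‖ := by positivity
  rw [Real.rpow_neg hpos.le, Real.rpow_natCast]
  have bd0 : ‖∫ x, osc Φ s x ξ * (starRingEnd ℂ) (osc Φ s x η)‖ ≤ C₀ := by
    have h0 : ∀ x ∉ K, osc Φ s x ξ * (starRingEnd ℂ) (osc Φ s x η) = 0 := fun x hx => by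
      have : s x ξ = 0 := image_eq_zero_of_notMem_tsupport (f := fun x => s x ξ) fun h => hx (hsK ξ h)
      simp [osc, this]
    rw [← setIntegral_eq_integral_of_forall_compl_eq_zero h0]
    refine norm_setIntegral_le_of_norm_le_const hK.measure_lt_top fun x _ => ?_
    rw [norm_mul, RCLike.norm_conj, sq]
    exact mul_le_mul ((norm_osc_le x ξ).trans (hB ξ x)) ((norm_osc_le x η).trans (hB η x))
      (norm_nonneg _) hB0
  have hC₀0 : 0 ≤ C₀ := by positivity
  rw [mul_assoc, ← div_eq_mul_inv, ← div_pow]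
  rcases le_or_gt ‖ξ - η‖ 1 with h1 | h1
  · calc _ ≤ C₀ * 1 := by linarith
      _ ≤ (C₀ + C) * (2 / (1 + ‖ξ - η‖)) ^ (n + m + 1) := by
        refine mul_le_mul (by linarith) (one_le_pow₀ ?_) zero_le_one (by positivity)
        rw [one_le_div hpos]; linarith
  · have hne : ξ ≠ η := by rintro rfl; simp at h1; linarith
    have h2 := hC ⟨(ξ, η), hne, ϑ, hϑ, hξ, hη⟩ ‖ξ - η‖ (by linarith)
    have e : ∀ x, Complex.exp (2 * Real.pi * Complex.I *
        ((‖ξ - η‖ * phaseQuot Φ (r := r) ⟨(ξ, η), hne, ϑ, hϑ, hξ, hη⟩ x : ℝ) : ℂ)) *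
        b ⟨(ξ, η), hne, ϑ, hϑ, hξ, hη⟩ x = osc Φ s x ξ * (starRingEnd ℂ) (osc Φ s x η) := by
      intro x
      simp only [osc, if_neg (ne_zero_of_mem_narrowCone hξ),
        if_neg (ne_zero_of_mem_narrowCone hη), hb, phaseQuot, map_mul, ← Complex.exp_conj]
      rw [mul_inv_cancel_left₀ (by linarith : ‖ξ - η‖ ≠ 0)]
      rw [mul_mul_mul_comm, ← Complex.exp_add]
      congr 2
      have hc2 : (starRingEnd ℂ) 2 = 2 := Complex.conj_ofNat 2
      simp [hc2]
      ring
    simp only [e] at h2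
    refine h2.trans (mul_le_mul (by linarith) ?_ (by positivity) (by positivity))
    refine pow_le_pow_left₀ (by positivity) ?_ _
    rw [inv_eq_one_div, div_le_div_iff₀ (by linarith) hpos]
    linarith

/-- An amplitude defines a bounded operator on `L²`. -/
theorem IsAmplitude.exists_L2_bound (hs : IsAmplitude Φ s) (hΦ : IsPhase Φ) :
    ∃ C : ℝ≥0, ∀ g : RN n m → ℂ, MemLp g 2 volume → Integrable g →
      eLpNorm (oscOp (osc Φ s) g) 2 volume ≤ C * eLpNorm g 2 volume := by
  obtain ⟨r, C, hr, hr16, hker⟩ := hs.exists_kernel_bound hΦ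
  obtain ⟨K, hK, hsK⟩ := hs.support
  obtain ⟨B, hB⟩ := hs.bdd 0
  set a := osc Φ s with ha
  have ham : Measurable (Function.uncurry a) := hΦ.measurable_osc hs.measurable
  have haB : ∀ x ξ, ‖a x ξ‖ ≤ B := fun x ξ => (norm_osc_le x ξ).trans (hB ξ x)
  have haK : ∀ x ∉ K, ∀ ξ, a x ξ = 0 := fun x hx ξ => by
    have : s x ξ = 0 := image_eq_zero_of_notMem_tsupport (f := fun x => s x ξ) fun h => hx (hsK ξ h)
    simp [ha, osc, this]
  set k : RN n m → ℝ≥0∞ := fun z =>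
    ENNReal.ofReal |C| * ENNReal.ofReal ((1 + ‖z‖) ^ (-((n + m + 1 : ℕ) : ℝ))) with hk
  have hkm : Measurable k := by
    refine Measurable.const_mul ?_ _
    exact ENNReal.measurable_ofReal.comp ((measurable_norm.const_add 1).pow_const _)
  have hkfin : ∫⁻ z, k z < ⊤ := by
    rw [hk, lintegral_const_mul' _ _ ENNReal.ofReal_ne_top]
    refine ENNReal.mul_lt_top ENNReal.ofReal_lt_top (finite_integral_one_add_norm ?_)
    simp
  set C₁ : ℝ≥0 := NNReal.sqrt (2 * ∫⁻ z, k z).toNNReal with hC₁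
  have cone : ∀ ϑ : RN n m, ‖ϑ‖ = 1 → ∀ g : RN n m → ℂ, Integrable g →
      (∀ ξ, g ξ ≠ 0 → ξ ∈ narrowCone ϑ r) →
      eLpNorm (oscOp a g) 2 volume ≤ C₁ * eLpNorm g 2 volume := by
    intro ϑ hϑ g hg hgc
    have h1 := lintegral_sq_oscOp_le ham haB hK haK hkm hg fun ξ η hξ hη => by
      have := hker ϑ hϑ ξ (hgc ξ hξ) η (hgc η hη)
      rw [← ofReal_norm, hk]
      simp only
      rw [← ENNReal.ofReal_mul (abs_nonneg C)]
      refine ENNReal.ofReal_le_ofReal (this.trans ?_)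
      exact mul_le_mul_of_nonneg_right (le_abs_self C) (by positivity)
    rw [← sq_eLpNorm_two, ← sq_eLpNorm_two] at h1
    have h2 : 2 * ∫⁻ z, k z = (C₁ : ℝ≥0∞) ^ 2 := by
      rw [hC₁, ← ENNReal.coe_pow, NNReal.sq_sqrt, ENNReal.coe_toNNReal]
      exact (ENNReal.mul_lt_top (by simp) hkfin).ne
    rw [h2, ← mul_pow] at h1
    exact (ENNReal.pow_le_pow_left_iff two_ne_zero).1 h1
  have hcm : ∀ ϑ : RN n m, MeasurableSet (narrowCone ϑ r) := fun ϑ =>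
    (isOpen_lt (by fun_prop) (by fun_prop)).measurableSet
  -- The input is cut by sharp indicators of cones. This is allowed because the bound for a single
  -- cone asks no regularity of `g`.
  have fin : ∀ t : Finset (RN n m), (∀ ϑ ∈ t, ‖ϑ‖ = 1) → ∃ C : ℝ≥0, ∀ g : RN n m → ℂ,
      MemLp g 2 volume → Integrable g → (∀ ξ, g ξ ≠ 0 → ∃ ϑ ∈ t, ξ ∈ narrowCone ϑ r) →
      eLpNorm (oscOp a g) 2 volume ≤ C * eLpNorm g 2 volume := by
    classical
    intro t
    induction t using Finset.induction_on with
    | empty =>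
      intro _
      refine ⟨0, fun g _ _ hgc => ?_⟩
      have : g = 0 := by
        funext ξ
        by_contra h
        simpa using hgc ξ h
      have h0 : oscOp a g = 0 := by funext x; simp [oscOp, this]
      simp [h0]
    | insert ϑ t _ ih =>
      intro ht
      obtain ⟨C₂, hC₂⟩ := ih fun ϑ h => ht ϑ (by simp [h])
      refine ⟨C₁ + C₂, fun g hg2 hg1 hgc => ?_⟩
      set g₁ := (narrowCone ϑ r).indicator g
      set g₂ := (narrowCone ϑ r)ᶜ.indicator g
      have hg11 : Integrable g₁ := hg1.indicator (hcm ϑ)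
      have hg21 : Integrable g₂ := hg1.indicator (hcm ϑ).compl
      have e : oscOp a g = oscOp a g₁ + oscOp a g₂ := by
        funext x
        simp only [oscOp, Pi.add_apply]
        have hm : AEStronglyMeasurable (a x) volume :=
          (ham.comp measurable_prodMk_left).aestronglyMeasurable
        rw [← integral_add (hg11.bdd_mul hm (Eventually.of_forall (haB x)))
          (hg21.bdd_mul hm (Eventually.of_forall (haB x)))]
        congr 1
        funext ξ
        rw [← mul_add]
        congr 1
        exact (congrFun (Set.indicator_self_add_compl (narrowCone ϑ r) g) ξ).symm
      have b1 := cone ϑ (ht ϑ (by simp)) g₁ hg11 fun ξ hξ => Set.mem_of_indicator_ne_zero hξ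
      have b2 := hC₂ g₂ (hg2.indicator (hcm ϑ).compl) hg21 fun ξ hξ => by
        have h1 : ξ ∉ narrowCone ϑ r := Set.mem_of_indicator_ne_zero hξ
        have h2 : g ξ ≠ 0 := fun h => hξ (by simp [g₂, Set.indicator, h])
        obtain ⟨ϑ', h3, h4⟩ := hgc ξ h2
        rcases Finset.mem_insert.1 h3 with rfl | h3
        · exact absurd h4 h1
        · exact ⟨ϑ', h3, h4⟩
      rw [e]
      calc _ ≤ eLpNorm (oscOp a g₁) 2 volume + eLpNorm (oscOp a g₂) 2 volume :=
            eLpNorm_add_le (measurable_oscOp ham hg11.1) (measurable_oscOp ham hg21.1) (by simp)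
        _ ≤ C₁ * eLpNorm g 2 volume + C₂ * eLpNorm g 2 volume := by
            refine add_le_add (b1.trans ?_) (b2.trans ?_) <;>
            exact mul_le_mul_right (eLpNorm_indicator_le _) _
        _ = _ := by push_cast; rw [add_mul]
  obtain ⟨t, ht, htf, hcov⟩ := (isCompact_sphere (0 : RN n m) 1).elim_finite_subcover_image
    (b := Metric.sphere (0 : RN n m) 1) (c := fun ϑ => Metric.ball ϑ r)
    (fun _ _ => Metric.isOpen_ball)
    fun ϑ hϑ => Set.mem_biUnion hϑ (Metric.mem_ball_self hr)
  obtain ⟨C₃, hC₃⟩ := fin htf.toFinset fun ϑ hϑ => by simpa using ht (by simpa using hϑ)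
  refine ⟨C₃, fun g hg2 hg1 => ?_⟩
  set g' := ({0}ᶜ : Set (RN n m)).indicator g
  have hms : MeasurableSet ({0}ᶜ : Set (RN n m)) := (measurableSet_singleton 0).compl
  have e : oscOp a g = oscOp a g' := by
    funext x
    simp only [oscOp]
    congr 1
    funext ξ
    by_cases h : ξ = 0
    · simp [h, ha, osc]
    · simp [g', h]
  rw [e]
  refine (hC₃ g' (hg2.indicator hms) (hg1.indicator hms) fun ξ hξ => ?_).trans
    (mul_le_mul_right (eLpNorm_indicator_le _) _)
  have hξ0 : ξ ≠ 0 := Set.mem_of_indicator_ne_zero hξ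
  have hξn := norm_pos_iff.2 hξ0
  have : ‖ξ‖⁻¹ • ξ ∈ Metric.sphere (0 : RN n m) 1 := by simp [norm_smul, hξ0]
  obtain ⟨ϑ, hϑ, hd⟩ := Set.mem_iUnion₂.1 (hcov this)
  refine ⟨ϑ, by simpa using hϑ, ?_⟩
  rw [Metric.mem_ball, dist_eq_norm] at hd
  have e : ξ - ‖ξ‖ • ϑ = ‖ξ‖ • (‖ξ‖⁻¹ • ξ - ϑ) := by
    rw [smul_sub, smul_smul, mul_inv_cancel₀ hξn.ne', one_smul]
  change ‖ξ - ‖ξ‖ • ϑ‖ < r * ‖ξ‖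
  rw [e, norm_smul, norm_norm, mul_comm]
  exact mul_lt_mul_of_pos_right hd hξn

/-! ### The Fourier transform on `L²` -/

section Fourier

open FourierTransform

variable {E : Type*} [NormedAddCommGroup E] [InnerProductSpace ℝ E] [FiniteDimensional ℝ E]
  [MeasurableSpace E] [BorelSpace E]

theorem integral_mul_fourier_eq {g h : E → ℂ} (hg : Integrable g) (hh : Integrable h) :
    ∫ x, g x * 𝓕 h x = ∫ x, 𝓕 g x * h x := by
  have := VectorFourier.integral_fourierIntegral_smul_eq_flip (L := innerₗ E) (μ := volume)
    (ν := volume) (f := g) (g := h) (Real.continuous_fourierChar) continuous_inner hg hh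
  rw [flip_innerₗ] at this
  exact this.symm

/-- On `L¹ ∩ L²` the Fourier transform of `L²` is given by the Fourier integral. -/
theorem fourier_toLp_ae_eq {h : E → ℂ} (h1 : Integrable h) (h2 : MemLp h 2 volume) :
    (𝓕 (h2.toLp h) : Lp ℂ 2 (volume : Measure E)) =ᵐ[volume] 𝓕 h := by
  refine ae_eq_of_integral_contDiff_smul_eq ((Lp.memLp _).locallyIntegrable (by norm_num)) ?_ ?_
  · refine Continuous.locallyIntegrable ?_
    exact VectorFourier.fourierIntegral_continuous Real.continuous_fourierChar
      (by exact continuous_inner) h1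
  · intro g hg hgc
    have hgc' : HasCompactSupport (fun x => (g x : ℂ)) := hgc.comp_left Complex.ofReal_zero
    have hg' : ContDiff ℝ ∞ (fun x => (g x : ℂ)) := Complex.ofRealCLM.contDiff.comp hg
    let G : SchwartzMap E ℂ := hgc'.toSchwartzMap hg'
    have hG : ∀ x, G x = (g x : ℂ) := fun x => rfl
    have e1 := congrArg (fun T : TemperedDistribution E ℂ => T G)
      (Lp.fourier_toTemperedDistribution_eq (h2.toLp h))
    simp only [TemperedDistribution.fourier_apply, Lp.toTemperedDistribution_apply, hG,
      smul_eq_mul] at e1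
    have e2 : ∫ x, (𝓕 G : SchwartzMap E ℂ) x * (h2.toLp h : E → ℂ) x =
        ∫ x, (𝓕 G : SchwartzMap E ℂ) x * h x := by
      refine integral_congr_ae ?_
      filter_upwards [h2.coeFn_toLp] with x hx
      rw [hx]
    have e3 : ∫ x, (G x) * 𝓕 h x = ∫ x, (𝓕 G : SchwartzMap E ℂ) x * h x := by
      rw [SchwartzMap.fourier_coe]
      exact integral_mul_fourier_eq G.integrable h1
    simp only [Complex.real_smul]
    exact e1.symm.trans (e2.trans e3.symm)

theorem eLpNorm_fourier_eq {h : E → ℂ} (h1 : Integrable h) (h2 : MemLp h 2 volume) :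
    eLpNorm (𝓕 h) 2 volume = eLpNorm h 2 volume := by
  have e1 : ‖(𝓕 (h2.toLp h) : Lp ℂ 2 (volume : Measure E))‖ₑ = ‖h2.toLp h‖ₑ := by
    rw [← ofReal_norm, ← ofReal_norm, Lp.norm_fourier_eq]
  rw [Lp.enorm_def, Lp.enorm_def, eLpNorm_congr_ae (fourier_toLp_ae_eq h1 h2),
    eLpNorm_congr_ae h2.coeFn_toLp] at e1
  exact e1

/-- For `v` a Schwartz function this is the definition of the Fourier transform of `u` as a tempered
distribution. Written as inner products, both sides are continuous in `v`, and Schwartz functions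
are dense. -/
theorem integral_mul_Lp_fourier_eq (u v : Lp ℂ 2 (volume : Measure E)) :
    ∫ x, u x * (𝓕 v : Lp ℂ 2 (volume : Measure E)) x = ∫ x, (𝓕 u : Lp ℂ 2 (volume : Measure E)) x * v x := by
  have hin : ∀ a b : Lp ℂ 2 (volume : Measure E), inner ℂ (star a) b = ∫ x, a x * b x := by
    intro a b
    rw [L2.inner_def]
    refine integral_congr_ae ?_
    filter_upwards [Lp.coeFn_star a] with x hx
    rw [hx]
    simp [mul_comm]
  rw [← hin, ← hin]
  have hd : DenseRange (SchwartzMap.toLpCLM ℝ (E := E) ℂ 2 volume) :=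
    SchwartzMap.denseRange_toLpCLM ENNReal.ofNat_ne_top
  set p : Lp ℂ 2 (volume : Measure E) → Prop := fun v =>
    inner ℂ (star u) (𝓕 v : Lp ℂ 2 (volume : Measure E)) =
      inner ℂ (star (𝓕 u : Lp ℂ 2 (volume : Measure E))) v with hp
  change p v
  apply DenseRange.induction_on (p := p) hd v
  · have c1 : Continuous fun v => innerSL ℂ (star u) (Lp.fourierTransformₗᵢ E ℂ v) :=
      (innerSL ℂ (star u)).continuous.comp (Lp.fourierTransformₗᵢ E ℂ).continuous
    have c2 : Continuous fun v : Lp ℂ 2 (volume : Measure E) =>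
        innerSL ℂ (star (𝓕 u : Lp ℂ 2 (volume : Measure E))) v :=
      (innerSL ℂ (star (𝓕 u : Lp ℂ 2 (volume : Measure E)))).continuous
    exact isClosed_eq c1 c2
  · intro G
    have eG : SchwartzMap.toLpCLM ℝ (E := E) ℂ 2 volume G = G.toLp 2 volume := rfl
    rw [eG, hp]
    beta_reduce
    rw [SchwartzMap.toLp_fourier_eq, hin, hin]
    have e1 := congrArg (fun T : TemperedDistribution E ℂ => T G)
      (Lp.fourier_toTemperedDistribution_eq u)
    simp only [TemperedDistribution.fourier_apply, Lp.toTemperedDistribution_apply,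
      smul_eq_mul] at e1
    refine Eq.trans ?_ (e1.trans ?_)
    · refine integral_congr_ae ?_
      filter_upwards [(𝓕 G : SchwartzMap E ℂ).coeFn_toLp 2] with x hx
      rw [hx, mul_comm]
    · refine integral_congr_ae ?_
      filter_upwards [G.coeFn_toLp 2] with x hx
      rw [hx, mul_comm]

/-- The multiplication formula for the Fourier transform, with one factor in `L²`. -/
theorem exists_fourier_L2 {f : E → ℂ} (hf : MemLp f 2 volume) :
    ∃ F : E → ℂ, MemLp F 2 volume ∧ eLpNorm F 2 volume = eLpNorm f 2 volume ∧
      ∀ h : E → ℂ, Integrable h → MemLp h 2 volume →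
        ∫ y, f y * 𝓕 h y = ∫ ξ, F ξ * h ξ := by
  refine ⟨(𝓕 (hf.toLp f) : Lp ℂ 2 (volume : Measure E)), Lp.memLp _, ?_, fun h h1 h2 => ?_⟩
  · rw [← Lp.enorm_def, ← ofReal_norm, Lp.norm_fourier_eq, ofReal_norm, Lp.enorm_def,
      eLpNorm_congr_ae hf.coeFn_toLp]
  · have e := integral_mul_Lp_fourier_eq (hf.toLp f) (h2.toLp h)
    have e1 : ∫ x, (hf.toLp f : E → ℂ) x * (𝓕 (h2.toLp h) : Lp ℂ 2 (volume : Measure E)) x =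
        ∫ y, f y * 𝓕 h y := by
      refine integral_congr_ae ?_
      filter_upwards [hf.coeFn_toLp, fourier_toLp_ae_eq h1 h2] with x hx hx'
      rw [hx, hx']
    have e2 : ∫ x, (𝓕 (hf.toLp f) : Lp ℂ 2 (volume : Measure E)) x * (h2.toLp h : E → ℂ) x =
        ∫ x, (𝓕 (hf.toLp f) : Lp ℂ 2 (volume : Measure E)) x * h x := by
      refine integral_congr_ae ?_
      filter_upwards [h2.coeFn_toLp] with x hx
      rw [hx]
    rw [← e1, e, e2]

end Fourier

/-! ### Unconditional sums in `L²` -/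

theorem isL2Sum_of_hasSum {ι : Type} {u : ι → RN n m → ℂ} (hu : ∀ i, MemLp (u i) 2 volume)
    {G : Lp ℂ 2 (volume : Measure (RN n m))} (h : HasSum (fun i => (hu i).toLp (u i)) G) :
    IsL2Sum u G := by
  refine ⟨hu, Lp.memLp G, ?_⟩
  have h1 : Tendsto (fun s : Finset ι => ‖G - ∑ i ∈ s, (hu i).toLp (u i)‖ₑ) atTop (𝓝 0) := by
    have h2 : Tendsto (fun s : Finset ι => G - ∑ i ∈ s, (hu i).toLp (u i)) atTop (𝓝 0) := by
      simpa using (tendsto_const_nhds (x := G)).sub h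
    simpa using h2.enorm
  refine h1.congr fun s => ?_
  rw [Lp.enorm_def]
  refine eLpNorm_congr_ae ?_
  have h3 : ∀ i ∈ s, ∀ᵐ x, (hu i).toLp (u i) x = u i x := fun i _ => (hu i).coeFn_toLp
  filter_upwards [Lp.coeFn_sub G (∑ i ∈ s, (hu i).toLp (u i)),
    Lp.coeFn_finsetSum s (fun i => (hu i).toLp (u i)),
    (Finset.eventually_all s).2 h3] with x hx1 hx2 hx3
  rw [hx1, Pi.sub_apply, hx2, Finset.sum_apply]
  rw [Finset.sum_congr rfl hx3]

/-- The data of an oscillatory integral operator that is bounded on `L²`. -/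
structure IsL2Op (a : RN n m → RN n m → ℂ) (C : ℝ≥0) : Prop where
  measurable : Measurable (Function.uncurry a)
  bounded : ∃ B : ℝ, ∀ x ξ, ‖a x ξ‖ ≤ B
  bound : ∀ g : RN n m → ℂ, MemLp g 2 volume → Integrable g →
      eLpNorm (oscOp a g) 2 volume ≤ C * eLpNorm g 2 volume

theorem IsL2Op.integrable {a : RN n m → RN n m → ℂ} {C : ℝ≥0} (ha : IsL2Op a C) {g : RN n m → ℂ}
    (hg : Integrable g) (x : RN n m) : Integrable fun ξ => a x ξ * g ξ :=
  let ⟨_, hB⟩ := ha.bounded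
  hg.bdd_mul (ha.measurable.comp measurable_prodMk_left).aestronglyMeasurable
    (Eventually.of_forall (hB x))

theorem IsL2Op.memLp {a : RN n m → RN n m → ℂ} {C : ℝ≥0} (ha : IsL2Op a C) {g : RN n m → ℂ}
    (hg : MemLp g 2 volume) (hg' : Integrable g) : MemLp (oscOp a g) 2 volume :=
  ⟨measurable_oscOp ha.measurable hg.1,
    (ha.bound g hg hg').trans_lt (ENNReal.mul_lt_top ENNReal.coe_lt_top hg.2)⟩

/-- A bounded measurable frequency cut-off with bounded support. -/
structure IsFreqCut (ψ : RN n m → ℂ) : Prop where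
  measurable : Measurable ψ
  bounded : ∃ B : ℝ, ∀ ξ, ‖ψ ξ‖ ≤ B
  support : ∃ R : ℝ, ∀ ξ, R < ‖ξ‖ → ψ ξ = 0

theorem IsFreqCut.memLp_mul {ψ : RN n m → ℂ} (hψ : IsFreqCut ψ) {F : RN n m → ℂ}
    (hF : MemLp F 2 volume) : MemLp (fun ξ => ψ ξ * F ξ) 2 volume := by
  obtain ⟨B, hB⟩ := hψ.bounded
  refine MemLp.of_le_mul (c := B) hF (hψ.measurable.aestronglyMeasurable.mul hF.1)
    (Eventually.of_forall fun ξ => ?_)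
  rw [norm_mul]
  exact mul_le_mul_of_nonneg_right (hB ξ) (norm_nonneg _)

theorem IsFreqCut.memLp {ψ : RN n m → ℂ} (hψ : IsFreqCut ψ) (p : ℝ≥0∞) : MemLp ψ p volume := by
  obtain ⟨B, hB⟩ := hψ.bounded
  obtain ⟨R, hR⟩ := hψ.support
  have h1 : MemLp ((Metric.closedBall (0 : RN n m) R).indicator fun _ => (B : ℂ)) p volume :=
    memLp_indicator_const p measurableSet_closedBall _
      (Or.inr (isCompact_closedBall _ _).measure_lt_top.ne)
  refine h1.mono hψ.measurable.aestronglyMeasurable (Eventually.of_forall fun ξ => ?_)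
  by_cases h : ξ ∈ Metric.closedBall (0 : RN n m) R
  · rw [Set.indicator_of_mem h, Complex.norm_real]
    exact (hB ξ).trans (le_abs_self B)
  · rw [hR ξ (by simpa using h)]; simp

theorem IsFreqCut.integrable_mul {ψ : RN n m → ℂ} (hψ : IsFreqCut ψ) {F : RN n m → ℂ}
    (hF : MemLp F 2 volume) : Integrable (fun ξ => ψ ξ * F ξ) :=
  (hψ.memLp 2).integrable_mul hF

theorem IsFreqCut.zero : IsFreqCut (fun _ : RN n m => (0 : ℂ)) :=
  ⟨measurable_const, ⟨0, by simp⟩, 0, by simp⟩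

theorem IsFreqCut.add {ψ ψ' : RN n m → ℂ} (h : IsFreqCut ψ) (h' : IsFreqCut ψ') :
    IsFreqCut (fun ξ => ψ ξ + ψ' ξ) := by
  obtain ⟨B, hB⟩ := h.bounded
  obtain ⟨B', hB'⟩ := h'.bounded
  obtain ⟨R, hR⟩ := h.support
  obtain ⟨R', hR'⟩ := h'.support
  refine ⟨h.measurable.add h'.measurable, ⟨B + B', fun ξ => ?_⟩, max R R', fun ξ hξ => ?_⟩
  · exact (norm_add_le _ _).trans (add_le_add (hB ξ) (hB' ξ))
  · rw [hR ξ ((le_max_left _ _).trans_lt hξ), hR' ξ ((le_max_right _ _).trans_lt hξ), add_zero]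

theorem IsFreqCut.sum {ι : Type*} {s : Finset ι} {ψ : ι → RN n m → ℂ}
    (h : ∀ i ∈ s, IsFreqCut (ψ i)) : IsFreqCut (fun ξ => ∑ i ∈ s, ψ i ξ) := by
  classical
  induction s using Finset.induction_on with
  | empty => simpa using IsFreqCut.zero
  | insert i s hi ih =>
    simp only [Finset.sum_insert hi]
    exact (h i (by simp)).add (ih fun j hj => h j (by simp [hj]))

theorem IsL2Op.oscOp_sum {a : RN n m → RN n m → ℂ} {C : ℝ≥0} (ha : IsL2Op a C) {ι : Type*}
    {ψ : ι → RN n m → ℂ} (hψ : ∀ i, IsFreqCut (ψ i)) {F : RN n m → ℂ} (hF : MemLp F 2 volume)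
    (s : Finset ι) (x : RN n m) : ∑ i ∈ s, oscOp a (fun ξ => ψ i ξ * F ξ) x =
      oscOp a (fun ξ => (∑ i ∈ s, ψ i ξ) * F ξ) x := by
  simp only [oscOp]
  rw [← integral_finsetSum _ fun i _ => ha.integrable ((hψ i).integrable_mul hF) x]
  congr 1
  funext ξ
  rw [Finset.sum_mul, Finset.mul_sum]

/-- Frequency pieces with bounded overlap are unconditionally summable in `L²`. -/
theorem IsL2Op.summable {a : RN n m → RN n m → ℂ} {C : ℝ≥0} (ha : IsL2Op a C) {ι : Type*}
    [Countable ι] {ψ : ι → RN n m → ℂ} (hψ : ∀ i, IsFreqCut (ψ i)) {D : ℝ≥0}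
    (hD : ∀ ξ (s : Finset ι), ∑ i ∈ s, ‖ψ i ξ‖ ≤ D) {F : RN n m → ℂ} (hF : MemLp F 2 volume) :
    Summable (fun i => (ha.memLp ((hψ i).memLp_mul hF) ((hψ i).integrable_mul hF)).toLp
      (oscOp a fun ξ => ψ i ξ * F ξ)) ∧
    ‖∑' i, (ha.memLp ((hψ i).memLp_mul hF) ((hψ i).integrable_mul hF)).toLp
      (oscOp a fun ξ => ψ i ξ * F ξ)‖ₑ ≤ C * (D * eLpNorm F 2 volume) := by
  set U : ι → Lp ℂ 2 (volume : Measure (RN n m)) := fun i =>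
    (ha.memLp ((hψ i).memLp_mul hF) ((hψ i).integrable_mul hF)).toLp
      (oscOp a fun ξ => ψ i ξ * F ξ) with hU
  have hsum : ∀ ξ, Summable fun i => ‖ψ i ξ‖ := fun ξ =>
    summable_of_sum_le (fun i => norm_nonneg _) (hD ξ)
  have part : ∀ s : Finset ι, ‖∑ i ∈ s, U i‖ₑ ≤
      C * eLpNorm (fun ξ => (∑ i ∈ s, ψ i ξ) * F ξ) 2 volume := by
    intro s
    have hs : IsFreqCut (fun ξ => ∑ i ∈ s, ψ i ξ) := IsFreqCut.sum fun i _ => hψ i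
    refine le_trans (le_of_eq ?_) (ha.bound _ (hs.memLp_mul hF) (hs.integrable_mul hF))
    rw [Lp.enorm_def]
    refine eLpNorm_congr_ae ?_
    have h3 : ∀ i ∈ s, ∀ᵐ x, U i x = oscOp a (fun ξ => ψ i ξ * F ξ) x := fun i _ =>
      MemLp.coeFn_toLp _
    filter_upwards [Lp.coeFn_finsetSum s U, (Finset.eventually_all s).2 h3] with x hx2 hx3
    rw [hx2, Finset.sum_apply, Finset.sum_congr rfl hx3, ha.oscOp_sum hψ hF]
  -- The pointwise tail of the overlap. It dominates `|∑ ψ_i|` over every finite set disjoint from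
  -- `s`, so the Cauchy criterion follows once `r s * F` tends to zero in `L²`.
  set r : Finset ι → RN n m → ℝ := fun s ξ => ∑' i, ‖ψ i ξ‖ - ∑ i ∈ s, ‖ψ i ξ‖ with hr
  have htsum_le : ∀ ξ, ∑' i, ‖ψ i ξ‖ ≤ D := fun ξ => (hsum ξ).tsum_le_of_sum_le (hD ξ)
  have hr0 : ∀ s ξ, 0 ≤ r s ξ := fun s ξ =>
    sub_nonneg.2 ((hsum ξ).sum_le_tsum s fun i _ => norm_nonneg _)
  have hrD : ∀ s ξ, r s ξ ≤ D := fun s ξ =>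
    (sub_le_self _ (Finset.sum_nonneg fun i _ => norm_nonneg _)).trans (htsum_le ξ)
  have hmeas : ∀ s, AEMeasurable fun ξ => (ENNReal.ofReal (r s ξ) * ‖F ξ‖ₑ) ^ 2 := by
    intro s
    have h1 : Measurable fun ξ => ∑' i, ‖ψ i ξ‖ := Measurable.tsum fun i => (hψ i).measurable.norm
    have h2 : Measurable fun ξ => ∑ i ∈ s, ‖ψ i ξ‖ :=
      Finset.measurable_fun_sum _ fun i _ => (hψ i).measurable.norm
    exact ((h1.sub h2).ennreal_ofReal.aemeasurable.mul hF.1.enorm).pow_const 2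
  have hFsq : ∫⁻ ξ, ‖F ξ‖ₑ ^ 2 ≠ ⊤ := by
    rw [← sq_eLpNorm_two]
    exact ENNReal.pow_ne_top hF.2.ne
  have hlim : Tendsto (fun s : Finset ι => ∫⁻ ξ, (ENNReal.ofReal (r s ξ) * ‖F ξ‖ₑ) ^ 2) atTop
      (𝓝 0) := by
    -- Countability of `ι` makes the filter of finite subsets countably generated, as dominated
    -- convergence requires.
    have := tendsto_lintegral_filter_of_dominated_convergence' (l := (atTop : Filter (Finset ι)))
      (μ := (volume : Measure (RN n m)))
      (F := fun s ξ => (ENNReal.ofReal (r s ξ) * ‖F ξ‖ₑ) ^ 2) (f := fun _ => 0)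
      (bound := fun ξ => ((D : ℝ≥0∞) * ‖F ξ‖ₑ) ^ 2) (Eventually.of_forall hmeas)
      (Eventually.of_forall fun s => Eventually.of_forall fun ξ => by
        gcongr
        exact ENNReal.ofReal_le_of_le_toReal (by simpa using hrD s ξ)) (by
        simp only [mul_pow]
        rw [lintegral_const_mul' _ _ (by simp)]
        exact ENNReal.mul_ne_top (by simp) hFsq) (by
        have hFf : ∀ ξ, ‖F ξ‖ₑ ≠ ⊤ := fun ξ => enorm_ne_top
        refine Eventually.of_forall fun ξ => ?_
        have h1 : Tendsto (fun s => r s ξ) atTop (𝓝 0) := by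
          simpa [hr] using (tendsto_const_nhds (x := ∑' i, ‖ψ i ξ‖)).sub (hsum ξ).hasSum
        have h2 := ENNReal.Tendsto.mul_const (ENNReal.tendsto_ofReal h1)
          (Or.inr (hFf ξ))
        simpa using ENNReal.Tendsto.pow (n := 2) h2)
    simpa using this
  have hsummable : Summable U := by
    classical
    rw [summable_iff_vanishing_norm]
    intro ε hε
    have hε' : (0 : ℝ≥0∞) < (ENNReal.ofReal (ε / (C + 1))) ^ 2 := by positivity
    obtain ⟨s, hs⟩ := (hlim.eventually (gt_mem_nhds hε')).exists
    refine ⟨s, fun t hts => ?_⟩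
    have h1 : eLpNorm (fun ξ => (∑ i ∈ t, ψ i ξ) * F ξ) 2 volume <
        ENNReal.ofReal (ε / (C + 1)) := by
      refine (ENNReal.pow_lt_pow_left_iff two_ne_zero).1 (lt_of_le_of_lt ?_ hs)
      rw [sq_eLpNorm_two]
      refine lintegral_mono fun ξ => ?_
      simp only [enorm_mul]
      gcongr
      rw [← ofReal_norm]
      refine ENNReal.ofReal_le_ofReal ((norm_sum_le _ _).trans ?_)
      rw [hr, le_sub_iff_add_le, ← Finset.sum_union hts]
      exact (hsum ξ).sum_le_tsum _ fun i _ => norm_nonneg _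
    have h2 : ‖∑ i ∈ t, U i‖ₑ ≤ C * ENNReal.ofReal (ε / (C + 1)) :=
      (part t).trans (mul_le_mul_right h1.le _)
    have h3 : ‖∑ i ∈ t, U i‖ ≤ C * (ε / (C + 1)) := by
      rw [← ofReal_norm, ← ENNReal.ofReal_coe_nnreal,
        ← ENNReal.ofReal_mul (NNReal.coe_nonneg C)] at h2
      exact (ENNReal.ofReal_le_ofReal_iff (by positivity)).1 h2
    refine h3.trans_lt ?_
    rw [← mul_div_assoc, div_lt_iff₀ (by positivity), mul_comm]
    exact mul_lt_mul_of_pos_left (by simp) hε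
  refine ⟨hsummable, ?_⟩
  refine le_of_tendsto hsummable.hasSum.enorm (Eventually.of_forall fun s => ?_)
  refine (part s).trans (mul_le_mul_right ?_ _)
  refine (ENNReal.pow_le_pow_left_iff two_ne_zero).1 ?_
  rw [mul_pow, sq_eLpNorm_two, sq_eLpNorm_two, ← lintegral_const_mul' _ _ (by simp)]
  refine lintegral_mono fun ξ => ?_
  simp only [enorm_mul, mul_pow]
  gcongr
  rw [← ofReal_norm]
  refine ENNReal.ofReal_le_of_le_toReal ?_
  simpa using (norm_sum_le _ _).trans (hD ξ s)

/-! ### The cut-off functions -/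

theorem IsCutoff.exists_bound {φ : ℝ → ℂ} (hφ : IsCutoff φ) : ∃ B : ℝ≥0, ∀ t, ‖φ t‖ ≤ B := by
  obtain ⟨B, hB⟩ := (isCompact_Icc (a := (-2 : ℝ)) (b := 2)).exists_bound_of_continuousOn
    hφ.smooth.continuous.continuousOn
  refine ⟨B.toNNReal, fun t => ?_⟩
  by_cases h : |t| ≤ 2
  · exact (hB t (abs_le.1 h)).trans (Real.le_coe_toNNReal B)
  · rw [hφ.eq_zero t (not_le.1 h), norm_zero]; positivity

/-- For `t ≤ 2^(l-1)` both arguments are at most one and both terms equal one; for `t > 2^(l+1)`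
both arguments exceed two and both terms vanish. -/
theorem IsCutoff.dyadic_support {φ : ℝ → ℂ} (hφ : IsCutoff φ) {l : ℤ} {t : ℝ} (ht : 0 ≤ t)
    (h : φ ((2 : ℝ) ^ (-l) * t) - φ ((2 : ℝ) ^ (-l + 1) * t) ≠ 0) :
    (2 : ℝ) ^ (l - 1) < t ∧ t ≤ (2 : ℝ) ^ (l + 1) := by
  have h2 : (0 : ℝ) < 2 := two_pos
  have e1 : (2 : ℝ) ^ (-l + 1) = 2 * 2 ^ (-l) := by rw [zpow_add₀ h2.ne', zpow_one, mul_comm]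
  have hp : (0 : ℝ) < 2 ^ (-l) := by positivity
  have hpl : (0 : ℝ) < 2 ^ l := by positivity
  have e2 : (2 : ℝ) ^ (-l) = (2 ^ l)⁻¹ := zpow_neg _ _
  constructor
  · by_contra hc
    apply h
    have h1 : (2 : ℝ) ^ (-l + 1) * t ≤ 1 := by
      rw [not_lt, zpow_sub_one₀ h2.ne'] at hc
      rw [e1, e2]
      calc 2 * (2 ^ l)⁻¹ * t ≤ 2 * (2 ^ l)⁻¹ * (2 ^ l * 2⁻¹) := by gcongr
        _ = 1 := by field_simp
    have h0 : (2 : ℝ) ^ (-l) * t ≤ 1 := by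
      refine le_trans ?_ h1
      rw [e1]; nlinarith [mul_nonneg hp.le ht]
    rw [hφ.eq_one _ (by rw [abs_of_nonneg (by positivity)]; exact h0),
      hφ.eq_one _ (by rw [abs_of_nonneg (by positivity)]; exact h1), sub_self]
  · by_contra hc
    apply h
    have h0 : 2 < (2 : ℝ) ^ (-l) * t := by
      rw [not_le, zpow_add_one₀ h2.ne'] at hc
      rw [e2, lt_inv_mul_iff₀ hpl]
      exact hc
    have h1 : 2 < (2 : ℝ) ^ (-l + 1) * t := by rw [e1]; nlinarith
    rw [hφ.eq_zero _ (h0.trans_le (le_abs_self _)), hφ.eq_zero _ (h1.trans_le (le_abs_self _)),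
      sub_self]

/-- With `L` the integer part of `log₂ t`, only the indices `L - 1`, `L` and `L + 1` can contribute.
-/
theorem sum_norm_le_of_dyadic {x : ℤ → ℂ} {t : ℝ} {B : ℝ}
    (hx : ∀ l, x l ≠ 0 → (2 : ℝ) ^ (l - 1) < t ∧ t ≤ (2 : ℝ) ^ (l + 1)) (hB : ∀ l, ‖x l‖ ≤ B)
    (s : Finset ℤ) : ∑ l ∈ s, ‖x l‖ ≤ 3 * B := by
  have hB0 : 0 ≤ B := (norm_nonneg _).trans (hB 0)
  by_cases ht : 0 < t
  · set L := Int.log 2 t with hL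
    have hlow : (2 : ℝ) ^ L ≤ t := by exact_mod_cast Int.zpow_log_le_self (b := 2) (by norm_num) ht
    have hup : t < (2 : ℝ) ^ (L + 1) := by
      exact_mod_cast Int.lt_zpow_succ_log_self (b := 2) (by norm_num) t
    have hsub : ∀ l ∈ s, l ∉ Finset.Icc (L - 1) (L + 1) → ‖x l‖ = 0 := by
      intro l _ hl
      by_contra h
      obtain ⟨h1, h2⟩ := hx l (norm_ne_zero_iff.1 h)
      have h3 := (zpow_lt_zpow_iff_right₀ (one_lt_two (α := ℝ))).1 (h1.trans hup)
      have h4 := (zpow_le_zpow_iff_right₀ (one_lt_two (α := ℝ))).1 (hlow.trans h2)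
      exact hl (Finset.mem_Icc.2 ⟨by omega, by omega⟩)
    calc ∑ l ∈ s, ‖x l‖ = ∑ l ∈ s with l ∈ Finset.Icc (L - 1) (L + 1), ‖x l‖ := by
          rw [Finset.sum_filter_of_ne]
          intro l hl h
          by_contra h'
          exact h (hsub l hl h')
      _ ≤ ∑ l ∈ Finset.Icc (L - 1) (L + 1), ‖x l‖ :=
          Finset.sum_le_sum_of_subset_of_nonneg (fun l hl => (Finset.mem_filter.1 hl).2)
            fun _ _ _ => norm_nonneg _
      _ ≤ (Finset.Icc (L - 1) (L + 1)).card • B := Finset.sum_le_card_nsmul _ _ _ fun l _ => hB l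
      _ = 3 * B := by
          rw [Int.card_Icc, show L + 1 + 1 - (L - 1) = 3 by ring]
          simp
  · have : ∀ l, ‖x l‖ = 0 := by
      intro l
      by_contra h
      exact ht (lt_trans (by positivity) (hx l (norm_ne_zero_iff.1 h)).1)
    simp [this, hB0]

theorem IsCutoff.coneCut_support {φ : ℝ → ℂ} (hφ : IsCutoff φ) {l : ℤ} {ξ : RN n m}
    (h : coneCut φ l ξ ≠ 0) : (2 : ℝ) ^ (l - 1) < ‖fstPart ξ‖ / ‖sndPart ξ‖ ∧
      ‖fstPart ξ‖ / ‖sndPart ξ‖ ≤ (2 : ℝ) ^ (l + 1) :=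
  hφ.dyadic_support (by positivity) h

theorem IsCutoff.shellCut_support {φ : ℝ → ℂ} (hφ : IsCutoff φ) {j : ℤ} {ξ : RN n m}
    (h : shellCut φ j ξ ≠ 0) : (2 : ℝ) ^ (j - 1) < ‖ξ‖ ∧ ‖ξ‖ ≤ (2 : ℝ) ^ (j + 1) :=
  hφ.dyadic_support (norm_nonneg _) h

theorem measurable_fstPart : Measurable (fstPart : RN n m → _) := by
  refine Continuous.measurable ?_
  unfold fstPart
  fun_prop

theorem measurable_sndPart : Measurable (sndPart : RN n m → _) := by
  refine Continuous.measurable ?_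
  unfold sndPart
  fun_prop

section Cuts

variable {φ : ℝ → ℂ}

theorem IsCutoff.measurable_coneCut (hφ : IsCutoff φ) (l : ℤ) :
    Measurable (coneCut φ l : RN n m → ℂ) := by
  have h1 : Measurable fun ξ : RN n m => ‖fstPart ξ‖ / ‖sndPart ξ‖ :=
    measurable_fstPart.norm.div measurable_sndPart.norm
  exact (hφ.smooth.continuous.measurable.comp (h1.const_mul _)).sub
    (hφ.smooth.continuous.measurable.comp (h1.const_mul _))

theorem IsCutoff.measurable_upperCut (hφ : IsCutoff φ) (l : ℤ) :
    Measurable (upperCut φ l : RN n m → ℂ) := by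
  have h1 : Measurable fun ξ : RN n m => ‖fstPart ξ‖ / ‖sndPart ξ‖ :=
    measurable_fstPart.norm.div measurable_sndPart.norm
  exact measurable_const.sub (hφ.smooth.continuous.measurable.comp (h1.const_mul _))

theorem IsCutoff.measurable_lowerCut (hφ : IsCutoff φ) (l : ℤ) :
    Measurable (lowerCut φ l : RN n m → ℂ) := by
  have h1 : Measurable fun ξ : RN n m => ‖fstPart ξ‖ / ‖sndPart ξ‖ :=
    measurable_fstPart.norm.div measurable_sndPart.norm
  exact hφ.smooth.continuous.measurable.comp (h1.const_mul _)

theorem IsCutoff.measurable_shellCut (hφ : IsCutoff φ) (j : ℤ) :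
    Measurable (shellCut φ j : RN n m → ℂ) :=
  (hφ.smooth.continuous.measurable.comp (measurable_norm.const_mul _)).sub
    (hφ.smooth.continuous.measurable.comp (measurable_norm.const_mul _))

theorem norm_coneCut_le {B : ℝ≥0} (hB : ∀ t, ‖φ t‖ ≤ B) (l : ℤ) (ξ : RN n m) :
    ‖coneCut φ l ξ‖ ≤ 2 * B :=
  (norm_sub_le _ _).trans ((add_le_add (hB _) (hB _)).trans_eq (two_mul _).symm)

theorem norm_shellCut_le {B : ℝ≥0} (hB : ∀ t, ‖φ t‖ ≤ B) (j : ℤ) (ξ : RN n m) :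
    ‖shellCut φ j ξ‖ ≤ 2 * B :=
  (norm_sub_le _ _).trans ((add_le_add (hB _) (hB _)).trans_eq (two_mul _).symm)

/-- A bounded cut-off times a shell cut-off is a frequency cut-off. -/
theorem IsCutoff.isFreqCut_mul_shellCut (hφ : IsCutoff φ) {ψ : RN n m → ℂ} (hψ : Measurable ψ)
    (hψb : ∃ B : ℝ, ∀ ξ, ‖ψ ξ‖ ≤ B) (j : ℤ) : IsFreqCut fun ξ => ψ ξ * shellCut φ j ξ := by
  obtain ⟨B, hB⟩ := hφ.exists_bound
  obtain ⟨D, hD⟩ := hψb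
  refine ⟨hψ.mul (hφ.measurable_shellCut j), ⟨D * (2 * B), fun ξ => ?_⟩, 2 ^ (j + 1),
    fun ξ hξ => ?_⟩
  · rw [norm_mul]
    exact mul_le_mul (hD ξ) (norm_shellCut_le hB j ξ) (norm_nonneg _)
      ((norm_nonneg _).trans (hD ξ))
  · by_contra h
    exact absurd (hφ.shellCut_support (right_ne_zero_of_mul h)).2 (not_le.2 hξ)

theorem IsCutoff.isFreqCut_coneCut_mul (hφ : IsCutoff φ) (l j : ℤ) :
    IsFreqCut fun ξ : RN n m => coneCut φ l ξ * shellCut φ j ξ :=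
  let ⟨_, hB⟩ := hφ.exists_bound
  hφ.isFreqCut_mul_shellCut (hφ.measurable_coneCut l) ⟨_, norm_coneCut_le hB l⟩ j

theorem IsCutoff.isFreqCut_upperCut_mul (hφ : IsCutoff φ) (j : ℤ) :
    IsFreqCut fun ξ : RN n m => upperCut φ j ξ * shellCut φ j ξ := by
  obtain ⟨B, hB⟩ := hφ.exists_bound
  refine hφ.isFreqCut_mul_shellCut (hφ.measurable_upperCut j) ⟨1 + B, fun ξ => ?_⟩ j
  exact (norm_sub_le _ _).trans (by rw [norm_one]; exact add_le_add le_rfl (hB _))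

theorem IsCutoff.isFreqCut_lowerCut_mul (hφ : IsCutoff φ) (j : ℤ) :
    IsFreqCut fun ξ : RN n m => lowerCut φ j ξ * shellCut φ j ξ := by
  obtain ⟨B, hB⟩ := hφ.exists_bound
  exact hφ.isFreqCut_mul_shellCut (hφ.measurable_lowerCut j) ⟨B, fun ξ => hB _⟩ j

theorem IsCutoff.isFreqCut_ball (hφ : IsCutoff φ) : IsFreqCut fun ξ : RN n m => φ ‖ξ‖ := by
  obtain ⟨B, hB⟩ := hφ.exists_bound
  refine ⟨hφ.smooth.continuous.measurable.comp measurable_norm, ⟨B, fun ξ => hB _⟩, 2,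
    fun ξ hξ => hφ.eq_zero _ ?_⟩
  rwa [abs_of_nonneg (norm_nonneg _)]

theorem IsCutoff.sum_norm_coneCut_le (hφ : IsCutoff φ) {B : ℝ≥0} (hB : ∀ t, ‖φ t‖ ≤ B)
    (ξ : RN n m) (s : Finset ℤ) : ∑ l ∈ s, ‖coneCut φ l ξ‖ ≤ 6 * B :=
  (sum_norm_le_of_dyadic (fun _ h => hφ.coneCut_support h) (fun l => norm_coneCut_le hB l ξ) s).trans
    (by linarith)

theorem IsCutoff.sum_norm_shellCut_le (hφ : IsCutoff φ) {B : ℝ≥0} (hB : ∀ t, ‖φ t‖ ≤ B)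
    (ξ : RN n m) (s : Finset ℤ) : ∑ j ∈ s, ‖shellCut φ j ξ‖ ≤ 6 * B :=
  (sum_norm_le_of_dyadic (fun _ h => hφ.shellCut_support h) (fun j => norm_shellCut_le hB j ξ) s).trans
    (by linarith)

/-- Overlap of pieces `ψ_j φ_j` with uniformly bounded `ψ_j`. -/
theorem IsCutoff.sum_norm_mul_shellCut_le (hφ : IsCutoff φ) {B : ℝ≥0} (hB : ∀ t, ‖φ t‖ ≤ B)
    {ψ : ℤ → RN n m → ℂ} {D : ℝ} (hD : ∀ j ξ, ‖ψ j ξ‖ ≤ D) {p : ℤ → Prop} (ξ : RN n m)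
    (s : Finset {j : ℤ // p j}) : ∑ j ∈ s, ‖ψ j ξ * shellCut φ j ξ‖ ≤ D * (6 * B) := by
  have hD0 : 0 ≤ D := (norm_nonneg _).trans (hD 0 ξ)
  have h1 : ∑ j ∈ s, ‖ψ j ξ * shellCut φ j ξ‖ =
      ∑ j ∈ s.map (Function.Embedding.subtype _), ‖ψ j ξ * shellCut φ j ξ‖ := by
    rw [Finset.sum_map]; rfl
  rw [h1]
  calc _ ≤ ∑ j ∈ s.map (Function.Embedding.subtype _), D * ‖shellCut φ j ξ‖ := by
        refine Finset.sum_le_sum fun j _ => ?_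
        rw [norm_mul]
        exact mul_le_mul_of_nonneg_right (hD j ξ) (norm_nonneg _)
    _ ≤ _ := by
        rw [← Finset.mul_sum]
        exact mul_le_mul_of_nonneg_left (hφ.sum_norm_shellCut_le hB ξ _) hD0

theorem IsCutoff.sum_norm_coneCut_mul_shellCut_le (hφ : IsCutoff φ) {B : ℝ≥0}
    (hB : ∀ t, ‖φ t‖ ≤ B) (ξ : RN n m) (s : Finset (ℤ × ℤ)) :
    ∑ q ∈ s, ‖coneCut φ q.1 ξ * shellCut φ q.2 ξ‖ ≤ 6 * B * (6 * B) := by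
  classical
  calc _ ≤ ∑ q ∈ (s.image Prod.fst) ×ˢ (s.image Prod.snd),
        ‖coneCut φ q.1 ξ * shellCut φ q.2 ξ‖ :=
        Finset.sum_le_sum_of_subset_of_nonneg Finset.subset_product fun _ _ _ => norm_nonneg _
    _ = (∑ l ∈ s.image Prod.fst, ‖coneCut φ l ξ‖) * ∑ j ∈ s.image Prod.snd, ‖shellCut φ j ξ‖ := by
        rw [Finset.sum_mul_sum, Finset.sum_product]
        simp only [norm_mul]
    _ ≤ _ := mul_le_mul (hφ.sum_norm_coneCut_le hB ξ _) (hφ.sum_norm_shellCut_le hB ξ _)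
        (Finset.sum_nonneg fun _ _ => norm_nonneg _) (by positivity)

end Cuts

/-! ### The operators of the cone decomposition as oscillatory operators -/

open FourierTransform in
-- This puts all dependence on `y` into one Fourier transform. The kernel and `osc` can differ only
-- at `ξ = 0`, a null set because the space is non-trivial.
theorem kern_eq_fourier (hn : 0 < n) (Φ : RN n m → RN n m → ℝ) (σ : RN n m → RN n m → ℂ)
    (ψ : RN n m → ℂ) (x y : RN n m) :
    kern Φ σ ψ x y = 𝓕 (fun ξ => osc Φ σ x ξ * ψ ξ) y := by
  have : Nontrivial (RN n m) := by
    refine ⟨coordVec (Sum.inl ⟨0, hn⟩), 0, fun h => ?_⟩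
    have := congrArg (fun v : RN n m => v (Sum.inl ⟨0, hn⟩)) h
    simp [coordVec] at this
  rw [Real.fourier_eq', kern]
  refine integral_congr_ae ?_
  have h0 : ∀ᵐ ξ : RN n m, ξ ≠ 0 := by
    rw [ae_iff]
    simp
  filter_upwards [h0] with ξ hξ
  rw [osc, if_neg hξ, smul_eq_mul, show (2 * Real.pi * Complex.I * ((Φ x ξ - inner ℝ y ξ : ℝ) : ℂ)) =
    ((-2 * Real.pi * inner ℝ ξ y : ℝ) : ℂ) * Complex.I + 2 * Real.pi * Complex.I * (Φ x ξ : ℂ) by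
      rw [real_inner_comm]; push_cast; ring, Complex.exp_add]
  ring

/-- A measurable bounded multiple of a frequency cut-off. -/
theorem IsFreqCut.bdd_mul {ψ : RN n m → ℂ} (hψ : IsFreqCut ψ) {h : RN n m → ℂ}
    (hm : Measurable h) {B : ℝ} (hB : ∀ ξ, ‖h ξ‖ ≤ B) : IsFreqCut fun ξ => h ξ * ψ ξ := by
  obtain ⟨D, hD⟩ := hψ.bounded
  obtain ⟨R, hR⟩ := hψ.support
  refine ⟨hm.mul hψ.measurable, ⟨B * D, fun ξ => ?_⟩, R, fun ξ hξ => by rw [hR ξ hξ, mul_zero]⟩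
  rw [norm_mul]
  exact mul_le_mul (hB ξ) (hD ξ) (norm_nonneg _) ((norm_nonneg _).trans (hB ξ))

theorem IsL2Op.isFreqCut {a : RN n m → RN n m → ℂ} {C : ℝ≥0} (ha : IsL2Op a C) {ψ : RN n m → ℂ}
    (hψ : IsFreqCut ψ) (x : RN n m) : IsFreqCut fun ξ => a x ξ * ψ ξ :=
  let ⟨_, hB⟩ := ha.bounded
  hψ.bdd_mul (ha.measurable.comp measurable_prodMk_left) (hB x)

open FourierTransform in
theorem IsL2Op.kern_sum (hn : 0 < n) {Φ : RN n m → RN n m → ℝ} {σ : RN n m → RN n m → ℂ} {C : ℝ≥0}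
    (ha : IsL2Op (osc Φ σ) C) {ι : Type*} {ψ : ι → RN n m → ℂ} {s : Finset ι}
    (hψ : ∀ i ∈ s, IsFreqCut (ψ i)) (x y : RN n m) :
    kern Φ σ (fun ξ => ∑ i ∈ s, ψ i ξ) x y = ∑ i ∈ s, kern Φ σ (ψ i) x y := by
  simp only [kern_eq_fourier hn, Real.fourier_eq']
  rw [← integral_finsetSum]
  · congr 1
    funext ξ
    rw [Finset.mul_sum, Finset.smul_sum]
  · intro i hi
    have h1 : Integrable fun ξ => osc Φ σ x ξ * ψ i ξ :=
      memLp_one_iff_integrable.1 ((ha.isFreqCut (hψ i hi) x).memLp 1)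
    refine h1.bdd_mul (c := 1) ?_ (Eventually.of_forall fun ξ => ?_)
    · exact Continuous.aestronglyMeasurable (by fun_prop)
    · rw [Complex.norm_exp_ofReal_mul_I]

/-- The operators with phase `Φ` and amplitude `σ`, localized in frequency and applied to `f`, are
the oscillatory operators with amplitude `s` applied to the localizations of `F`. -/
def Represents (Φ : RN n m → RN n m → ℝ) (σ s : RN n m → RN n m → ℂ) (f F : RN n m → ℂ) : Prop :=
  ∀ ψ : RN n m → ℂ, IsFreqCut ψ → ∀ x,
    kernelOp (kern Φ σ ψ) f x = oscOp (osc Φ s) (fun ξ => ψ ξ * F ξ) x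

/-- The function `F` is the `L²` Fourier transform of `f`, and the multiplication formula takes the
transform off the kernel. One `F` serves all cut-offs and all `x`. -/
theorem IsL2Op.exists_represents (hn : 0 < n) {Φ : RN n m → RN n m → ℝ} {σ : RN n m → RN n m → ℂ}
    {C : ℝ≥0} (ha : IsL2Op (osc Φ σ) C) {f : RN n m → ℂ} (hf : MemLp f 2 volume) :
    ∃ F : RN n m → ℂ, MemLp F 2 volume ∧ eLpNorm F 2 volume = eLpNorm f 2 volume ∧
      Represents Φ σ σ f F := by
  obtain ⟨F, hF, hF', hrep⟩ := exists_fourier_L2 hf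
  refine ⟨F, hF, hF', fun ψ hψ x => ?_⟩
  have hc := ha.isFreqCut hψ x
  have := hrep _ (memLp_one_iff_integrable.1 (hc.memLp 1)) (hc.memLp 2)
  simp only [kernelOp, kern_eq_fourier hn, this, oscOp]
  congr 1
  funext ξ
  ring

theorem IsL2Op.exists_isL2Sum {a : RN n m → RN n m → ℂ} {C : ℝ≥0} (ha : IsL2Op a C) {ι : Type}
    [Countable ι] {ψ : ι → RN n m → ℂ} (hψ : ∀ i, IsFreqCut (ψ i)) {D : ℝ≥0}
    (hD : ∀ ξ (s : Finset ι), ∑ i ∈ s, ‖ψ i ξ‖ ≤ D) {F : RN n m → ℂ} (hF : MemLp F 2 volume)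
    {u : ι → RN n m → ℂ} (hu : ∀ i x, u i x = oscOp a (fun ξ => ψ i ξ * F ξ) x) :
    ∃ g, IsL2Sum u g ∧ eLpNorm g 2 volume ≤ C * (D * eLpNorm F 2 volume) := by
  obtain ⟨h1, h2⟩ := ha.summable hψ hD hF
  rw [Lp.enorm_def] at h2
  refine ⟨_, ?_, h2⟩
  have : u = fun i => oscOp a (fun ξ => ψ i ξ * F ξ) := by
    funext i x; exact hu i x
  rw [this]
  exact isL2Sum_of_hasSum _ h1.hasSum

section Represented

variable {φ : ℝ → ℂ} {Φ : RN n m → RN n m → ℝ} {σ s : RN n m → RN n m → ℂ} {C C' : ℝ≥0} {B : ℝ≥0}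
  {f F : RN n m → ℂ}

theorem Represents.exists_isNaturalL (hr : Represents Φ σ s f F) (hφ : IsCutoff φ)
    (hB : ∀ t, ‖φ t‖ ≤ B) (ha : IsL2Op (osc Φ s) C) (hF : MemLp F 2 volume) (l : ℤ) :
    ∃ g, IsNaturalL φ Φ σ l f g ∧
      eLpNorm g 2 volume ≤ C * ((2 * B * (6 * B) : ℝ≥0) * eLpNorm F 2 volume) :=
  ha.exists_isL2Sum (ψ := fun (j : {j : ℤ // 2 * |l| < j}) ξ => coneCut φ l ξ * shellCut φ j ξ)
    (fun j => hφ.isFreqCut_coneCut_mul l j)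
    (fun ξ t => by
      push_cast
      exact hφ.sum_norm_mul_shellCut_le hB (ψ := fun _ => coneCut φ l)
        (fun _ => norm_coneCut_le hB l) ξ t) hF
    fun j x => hr _ (hφ.isFreqCut_coneCut_mul l j) x

/-- The frequency cut-off of `♯𝔉_j`. -/
def sharpCut (φ : ℝ → ℂ) (j : ℤ) (ξ : RN n m) : ℂ :=
  (∑ l ∈ (Finset.Ico 0 j).filter (fun l => j ≤ 2 * l), coneCut φ l ξ) + upperCut φ j ξ

/-- The frequency cut-off of `♭𝔉_j`. -/
def flatCut (φ : ℝ → ℂ) (j : ℤ) (ξ : RN n m) : ℂ :=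
  (∑ l ∈ (Finset.Ioc (-j) 0).filter (fun l => 2 * l ≤ -j), coneCut φ l ξ) + lowerCut φ j ξ

theorem IsCutoff.norm_sharpCut_le (hφ : IsCutoff φ) (hB : ∀ t, ‖φ t‖ ≤ B) (j : ℤ) (ξ : RN n m) :
    ‖sharpCut φ j ξ‖ ≤ 7 * B + 1 := by
  refine (norm_add_le _ _).trans ?_
  have h1 := (norm_sum_le ((Finset.Ico 0 j).filter (fun l => j ≤ 2 * l))
    (fun l => coneCut φ l ξ)).trans (hφ.sum_norm_coneCut_le hB ξ _)
  have h2 : ‖upperCut φ j ξ‖ ≤ 1 + B :=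
    (norm_sub_le _ _).trans (by rw [norm_one]; exact add_le_add le_rfl (hB _))
  linarith

theorem IsCutoff.norm_flatCut_le (hφ : IsCutoff φ) (hB : ∀ t, ‖φ t‖ ≤ B) (j : ℤ) (ξ : RN n m) :
    ‖flatCut φ j ξ‖ ≤ 7 * B + 1 := by
  refine (norm_add_le _ _).trans ?_
  have h1 := (norm_sum_le ((Finset.Ioc (-j) 0).filter (fun l => 2 * l ≤ -j))
    (fun l => coneCut φ l ξ)).trans (hφ.sum_norm_coneCut_le hB ξ _)
  have h2 : ‖lowerCut φ j ξ‖ ≤ B := hB _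
  linarith

theorem IsCutoff.measurable_sharpCut (hφ : IsCutoff φ) (j : ℤ) :
    Measurable (sharpCut φ j : RN n m → ℂ) :=
  (Finset.measurable_fun_sum _ fun l _ => hφ.measurable_coneCut l).add (hφ.measurable_upperCut j)

theorem IsCutoff.measurable_flatCut (hφ : IsCutoff φ) (j : ℤ) :
    Measurable (flatCut φ j : RN n m → ℂ) :=
  (Finset.measurable_fun_sum _ fun l _ => hφ.measurable_coneCut l).add (hφ.measurable_lowerCut j)

/-- The sharp and flat kernels are defined as sums of kernels; merging them into one kernel with a
single cut-off lets the representation apply. The sum over `Bool` is additivity for two terms. -/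
theorem IsL2Op.kern_sum_add (hn : 0 < n) (hσ : IsL2Op (osc Φ σ) C') (hφ : IsCutoff φ) (j : ℤ)
    (t : Finset ℤ) {ψ : RN n m → ℂ} (hψ : IsFreqCut fun ξ => ψ ξ * shellCut φ j ξ) (x y : RN n m) :
    (∑ l ∈ t, kernLJ φ Φ σ l j x y) + kern Φ σ (fun ξ => ψ ξ * shellCut φ j ξ) x y =
      kern Φ σ (fun ξ => ((∑ l ∈ t, coneCut φ l ξ) + ψ ξ) * shellCut φ j ξ) x y := by
  have h1 : IsFreqCut fun ξ : RN n m => ∑ l ∈ t, coneCut φ l ξ * shellCut φ j ξ :=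
    IsFreqCut.sum fun l _ => hφ.isFreqCut_coneCut_mul l j
  have h2 := hσ.kern_sum hn (ι := Bool) (s := Finset.univ)
    (ψ := fun b => cond b (fun ξ : RN n m => ∑ l ∈ t, coneCut φ l ξ * shellCut φ j ξ)
      fun ξ => ψ ξ * shellCut φ j ξ) (fun b _ => by cases b; exacts [hψ, h1]) x y
  simp only [Fintype.sum_bool, cond_true, cond_false] at h2
  rw [hσ.kern_sum hn fun l _ => hφ.isFreqCut_coneCut_mul l j] at h2
  simp only [add_mul, Finset.sum_mul]
  exact h2.symm

theorem Represents.exists_isSharp (hn : 0 < n) (hr : Represents Φ σ s f F) (hφ : IsCutoff φ)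
    (hB : ∀ t, ‖φ t‖ ≤ B) (ha : IsL2Op (osc Φ s) C) (hσ : IsL2Op (osc Φ σ) C')
    (hF : MemLp F 2 volume) :
    ∃ g, IsSharp φ Φ σ f g ∧
      eLpNorm g 2 volume ≤ C * (((7 * B + 1) * (6 * B) : ℝ≥0) * eLpNorm F 2 volume) := by
  have hcut : ∀ j, IsFreqCut fun ξ : RN n m => sharpCut φ j ξ * shellCut φ j ξ := fun j =>
    hφ.isFreqCut_mul_shellCut (hφ.measurable_sharpCut j) ⟨_, hφ.norm_sharpCut_le hB j⟩ j
  refine ha.exists_isL2Sum (ψ := fun (j : {j : ℤ // 0 < j}) ξ => sharpCut φ j ξ * shellCut φ j ξ)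
    (fun j => hcut j)
    (fun ξ t => by
      push_cast
      exact hφ.sum_norm_mul_shellCut_le hB (ψ := fun j => sharpCut φ j)
        (hφ.norm_sharpCut_le hB) ξ t) hF fun j x => ?_
  rw [← hr _ (hcut j) x]
  simp only [opSharpJ]
  congr 1
  funext x y
  exact hσ.kern_sum_add hn hφ j _ (hφ.isFreqCut_upperCut_mul j) x y

theorem Represents.exists_isFlat (hn : 0 < n) (hr : Represents Φ σ s f F) (hφ : IsCutoff φ)
    (hB : ∀ t, ‖φ t‖ ≤ B) (ha : IsL2Op (osc Φ s) C) (hσ : IsL2Op (osc Φ σ) C')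
    (hF : MemLp F 2 volume) :
    ∃ g, IsFlat φ Φ σ f g ∧
      eLpNorm g 2 volume ≤ C * (((7 * B + 1) * (6 * B) : ℝ≥0) * eLpNorm F 2 volume) := by
  have hcut : ∀ j, IsFreqCut fun ξ : RN n m => flatCut φ j ξ * shellCut φ j ξ := fun j =>
    hφ.isFreqCut_mul_shellCut (hφ.measurable_flatCut j) ⟨_, hφ.norm_flatCut_le hB j⟩ j
  refine ha.exists_isL2Sum (ψ := fun (j : {j : ℤ // 0 < j}) ξ => flatCut φ j ξ * shellCut φ j ξ)
    (fun j => hcut j)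
    (fun ξ t => by
      push_cast
      exact hφ.sum_norm_mul_shellCut_le hB (ψ := fun j => flatCut φ j)
        (hφ.norm_flatCut_le hB) ξ t) hF fun j x => ?_
  rw [← hr _ (hcut j) x]
  simp only [opFlatJ]
  congr 1
  funext x y
  exact hσ.kern_sum_add hn hφ j _ (hφ.isFreqCut_lowerCut_mul j) x y

/-- Both expressions for the sum are fibrewise summations of one summable family over all pairs `(l,
j)`, with the cut-off replaced by zero outside `2|l| < j`. Summing first over `l` or first over `j`
gives the same total. -/
theorem Represents.exists_isNatural (hr : Represents Φ σ s f F) (hφ : IsCutoff φ)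
    (hB : ∀ t, ‖φ t‖ ≤ B) (ha : IsL2Op (osc Φ s) C) (hF : MemLp F 2 volume) :
    ∃ g, IsNatural φ Φ σ f g ∧
      eLpNorm g 2 volume ≤ C * ((6 * B * (6 * B) : ℝ≥0) * eLpNorm F 2 volume) := by
  classical
  set ψ : ℤ × ℤ → RN n m → ℂ := fun q ξ =>
    if 2 * |q.1| < q.2 then coneCut φ q.1 ξ * shellCut φ q.2 ξ else 0 with hψdef
  have hψ : ∀ q, IsFreqCut (ψ q) := fun q => by
    by_cases h : 2 * |q.1| < q.2
    · simp only [hψdef, h, if_true]; exact hφ.isFreqCut_coneCut_mul _ _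
    · simp only [hψdef, h, if_false]; exact IsFreqCut.zero
  have hD : ∀ ξ (t : Finset (ℤ × ℤ)), ∑ q ∈ t, ‖ψ q ξ‖ ≤ (6 * B * (6 * B) : ℝ≥0) := fun ξ t => by
    push_cast
    refine (Finset.sum_le_sum fun q _ => ?_).trans (hφ.sum_norm_coneCut_mul_shellCut_le hB ξ t)
    by_cases h : 2 * |q.1| < q.2
    · simp only [hψdef, h, if_true]; exact le_rfl
    · simp only [hψdef, h, if_false, norm_zero]; exact norm_nonneg _
  obtain ⟨hsum, hbd⟩ := ha.summable hψ hD hF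
  have hmem : ∀ q, MemLp (oscOp (osc Φ s) fun ξ => ψ q ξ * F ξ) 2 volume := fun q =>
    ha.memLp ((hψ q).memLp_mul hF) ((hψ q).integrable_mul hF)
  set V : ℤ × ℤ → Lp ℂ 2 (volume : Measure (RN n m)) := fun q => (hmem q).toLp _ with hV
  have hV0 : ∀ q : ℤ × ℤ, ¬ 2 * |q.1| < q.2 → V q = 0 := by
    intro q h
    have h0 : (oscOp (osc Φ s) fun ξ => ψ q ξ * F ξ) = 0 := by
      funext x
      simp [oscOp, hψdef, h]
    simp only [hV, h0]
    exact MemLp.toLp_zero _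
  have hVae : ∀ q : ℤ × ℤ, 2 * |q.1| < q.2 → V q =ᵐ[volume] opLJ φ Φ σ q.1 q.2 f := by
    intro q h
    refine (MemLp.coeFn_toLp _).trans (Eventually.of_forall fun x => ?_)
    have := hr _ (hφ.isFreqCut_coneCut_mul q.1 q.2) x
    simp only [hψdef, h, if_true]
    exact this.symm
  have hLJ : ∀ q : ℤ × ℤ, 2 * |q.1| < q.2 → MemLp (opLJ φ Φ σ q.1 q.2 f) 2 volume := fun q h =>
    (memLp_congr_ae (hVae q h)).1 (Lp.memLp _)
  change Summable V at hsum
  change ‖∑' q, V q‖ₑ ≤ _ at hbd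
  rw [Lp.enorm_def] at hbd
  refine ⟨(∑' q, V q : Lp ℂ 2 (volume : Measure (RN n m))), ⟨?_, ?_⟩, hbd⟩
  · set W : ℤ → Finset ℤ := fun j =>
      (Finset.Ioo (-j) j).filter (fun l => -j < 2 * l ∧ 2 * l < j) with hW
    have hWmem : ∀ l j : ℤ, l ∈ W j ↔ 2 * |l| < j := by
      intro l j
      simp only [hW, Finset.mem_filter, Finset.mem_Ioo]
      constructor
      · rintro ⟨-, h1, h2⟩
        rcases abs_cases l with ⟨h, h'⟩ | ⟨h, h'⟩ <;> omega
      · intro h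
        rcases abs_cases l with ⟨h', h''⟩ | ⟨h', h''⟩ <;> omega
    have h1 : HasSum (fun q : ℤ × ℤ => V q.swap) (∑' q, V q) :=
      (Equiv.prodComm ℤ ℤ).hasSum_iff.2 hsum.hasSum
    have h2 : ∀ j, HasSum (fun l => V (l, j)) (∑ l ∈ W j, V (l, j)) := fun j =>
      hasSum_sum_of_ne_finset_zero fun l hl => hV0 _ fun h => hl ((hWmem l j).2 h)
    have h3 : HasSum (fun j => ∑ l ∈ W j, V (l, j)) (∑' q, V q) := h1.prod_fiberwise h2
    have hae : ∀ j, ⇑(∑ l ∈ W j, V (l, j)) =ᵐ[volume] opNaturalJ φ Φ σ j f := by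
      intro j
      have h4 : ∀ l ∈ W j, ∀ᵐ x, V (l, j) x = opLJ φ Φ σ l j f x := fun l hl =>
        hVae (l, j) ((hWmem l j).1 hl)
      filter_upwards [Lp.coeFn_finsetSum (W j) fun l => V (l, j),
        (Finset.eventually_all (W j)).2 h4] with x hx1 hx2
      rw [hx1, Finset.sum_apply, Finset.sum_congr rfl hx2]
      rfl
    have hmemJ : ∀ j, MemLp (opNaturalJ φ Φ σ j f) 2 volume := fun j =>
      (memLp_congr_ae (hae j)).1 (Lp.memLp _)
    refine isL2Sum_of_hasSum (fun j : {j : ℤ // 0 < j} => hmemJ j) ?_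
    have h5 : ∀ j, (hmemJ j).toLp _ = ∑ l ∈ W j, V (l, j) := fun j =>
      Lp.ext ((MemLp.coeFn_toLp _).trans (hae j).symm)
    rw [show (fun j : {j : ℤ // 0 < j} => (hmemJ j).toLp _) =
      fun j : {j : ℤ // 0 < j} => ∑ l ∈ W j, V (l, j) from funext fun j => h5 j]
    refine (hasSum_subtype_iff_of_support_subset (s := {j : ℤ | 0 < j})
      (f := fun j => ∑ l ∈ W j, V (l, j)) fun j hj => ?_).2 h3
    by_contra hj0
    refine hj (Finset.sum_eq_zero fun l hl => ?_)
    have := (hWmem l j).1 hl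
    have h6 := abs_nonneg l
    simp only [Set.mem_ofPred_eq, not_lt] at hj0
    omega
  · have h2 : ∀ l, HasSum (fun j => V (l, j)) (∑' j, V (l, j)) := fun l =>
      (hsum.prod_factor l).hasSum
    have h3 : HasSum (fun l => ∑' j, V (l, j)) (∑' q, V q) := hsum.hasSum.prod_fiberwise h2
    refine ⟨fun l => (∑' j, V (l, j) : Lp ℂ 2 (volume : Measure (RN n m))), fun l => ?_, ?_⟩
    · refine isL2Sum_of_hasSum (fun j : {j : ℤ // 2 * |l| < j} => hLJ (l, j) j.2) ?_
      have h5 : ∀ j : {j : ℤ // 2 * |l| < j}, (hLJ (l, j) j.2).toLp _ = V (l, j) := fun j =>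
        Lp.ext ((MemLp.coeFn_toLp _).trans (hVae (l, j) j.2).symm)
      rw [show (fun j : {j : ℤ // 2 * |l| < j} => (hLJ (l, j) j.2).toLp _) =
        fun j : {j : ℤ // 2 * |l| < j} => V (l, j) from funext h5]
      refine (hasSum_subtype_iff_of_support_subset (s := {j : ℤ | 2 * |l| < j})
        (f := fun j => V (l, j)) fun j hj => ?_).2 (h2 l)
      by_contra hj0
      exact hj (hV0 _ hj0)
    · refine isL2Sum_of_hasSum (fun l => Lp.memLp _) ?_
      simpa only [Lp.toLp_coeFn] using h3

end Represented

/-! ### Symbols -/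

/-- The size `(1+|τ|)^{-ρ₁} (1+|λ|)^{-ρ₂}` of a symbol. -/
def symbolWeight (ρ₁ ρ₂ : ℝ) (ξ : RN n m) : ℝ :=
  (1 / (1 + ‖fstPart ξ‖)) ^ ρ₁ * (1 / (1 + ‖sndPart ξ‖)) ^ ρ₂

theorem symbolWeight_pos (ρ₁ ρ₂ : ℝ) (ξ : RN n m) : 0 < symbolWeight ρ₁ ρ₂ ξ := by
  unfold symbolWeight
  positivity

theorem symbolWeight_le_one {ρ₁ ρ₂ : ℝ} (h₁ : 0 ≤ ρ₁) (h₂ : 0 ≤ ρ₂) (ξ : RN n m) :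
    symbolWeight ρ₁ ρ₂ ξ ≤ 1 := by
  have key : ∀ {t ρ : ℝ}, 0 ≤ t → 0 ≤ ρ → (1 / (1 + t)) ^ ρ ≤ 1 := fun ht hρ =>
    Real.rpow_le_one (by positivity) (by rw [div_le_one (by positivity)]; linarith) hρ
  exact mul_le_one₀ (key (norm_nonneg _) h₁) (by positivity) (key (norm_nonneg _) h₂)

theorem measurable_symbolWeight (ρ₁ ρ₂ : ℝ) : Measurable (symbolWeight ρ₁ ρ₂ : RN n m → ℝ) :=
  (((measurable_fstPart.norm.const_add 1).const_div 1).pow_const _).mul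
    (((measurable_sndPart.norm.const_add 1).const_div 1).pow_const _)

/-- Absorbs the mismatch between the orders `0 + 0 + c` and `c` when the symbol bounds are
specialized to pure `x`-derivatives. -/
theorem iteratedFDeriv_apply_congr {E F : Type*} [NormedAddCommGroup E] [NormedSpace ℝ E]
    [NormedAddCommGroup F] [NormedSpace ℝ F] (f : E → F) (q : E) {N M : ℕ} (h : N = M)
    {v : Fin N → E} {w : Fin M → E} (hv : ∀ i, v (Fin.cast h.symm i) = w i) :
    iteratedFDeriv ℝ N f q v = iteratedFDeriv ℝ M f q w := by
  subst h
  exact congrArg _ (funext hv)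

variable {ρ₁ ρ₂ : ℝ} {σ : RN n m → RN n m → ℂ} {Φ : RN n m → RN n m → ℝ}

theorem IsSymbol.bound_left (hσ : IsSymbol ρ₁ ρ₂ σ) (c : ℕ) (γ : Fin c → Fin n ⊕ Fin m) :
    ∃ B : ℝ, ∀ x ξ : RN n m, ‖iteratedFDeriv ℝ c (Function.uncurry σ) (x, ξ)
      (fun i => ((coordVec (γ i) : RN n m), (0 : RN n m)))‖ ≤ B * symbolWeight ρ₁ ρ₂ ξ := by
  obtain ⟨B, hB⟩ := hσ.bound 0 0 c Fin.elim0 Fin.elim0 γ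
  refine ⟨B, fun x ξ => ?_⟩
  have h := hB x ξ
  rw [iteratedFDeriv_apply_congr (Function.uncurry σ) (x, ξ) (show 0 + 0 + c = c by omega)
    (w := fun i => ((coordVec (γ i) : RN n m), (0 : RN n m)))] at h
  · simpa [symbolWeight, mul_assoc] using h
  · intro i
    have : Fin.cast (show c = 0 + 0 + c by omega) i = Fin.natAdd (0 + 0) i := by
      ext; simp
    rw [this, Fin.append_right]

/-- The weight depends on `ξ` alone, so `x`-derivatives commute with the division. Any measurable
positive `W` that dominates the size of the symbol will do; the choices made are the constant one,
`symbolWeight` and `mixedWeight`. -/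
theorem IsSymbol.isAmplitude (hσ : IsSymbol ρ₁ ρ₂ σ) (hΦσ : IsNondegenerateOn Φ σ)
    {W : RN n m → ℝ} (hW : Measurable W) (hW0 : ∀ ξ, 0 < W ξ) {D : ℝ}
    (hWD : ∀ ξ, symbolWeight ρ₁ ρ₂ ξ ≤ D * W ξ) :
    IsAmplitude Φ (fun x ξ => σ x ξ / (W ξ : ℂ)) where
  measurable := hσ.smooth.continuous.measurable.div
    (Complex.measurable_ofReal.comp (hW.comp measurable_snd))
  smooth ξ := (hσ.smooth.comp (contDiff_id.prodMk contDiff_const)).div_const _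
  bdd k := by
    -- Differentiation raises `c` by one, so the induction has to treat all iterated `x`-derivatives
    -- of the symbol together.
    have key : ∀ k c (γ : Fin c → Fin n ⊕ Fin m), UnifBdd (coordVec (n := n) (m := m)) k
        (fun (ξ x : RN n m) => iteratedFDeriv ℝ c (Function.uncurry σ) (x, ξ)
          (fun i => ((coordVec (γ i) : RN n m), (0 : RN n m))) / (W ξ : ℂ)) := by
      have base : ∀ c (γ : Fin c → Fin n ⊕ Fin m), ∃ C : ℝ, ∀ ξ x : RN n m,
          ‖iteratedFDeriv ℝ c (Function.uncurry σ) (x, ξ)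
            (fun i => ((coordVec (γ i) : RN n m), (0 : RN n m))) / (W ξ : ℂ)‖ ≤ C := by
        intro c γ
        obtain ⟨B, hB⟩ := hσ.bound_left c γ
        refine ⟨|B| * D, fun ξ x => ?_⟩
        rw [norm_div, Complex.norm_real, Real.norm_of_nonneg (hW0 ξ).le, div_le_iff₀ (hW0 ξ)]
        calc _ ≤ B * symbolWeight ρ₁ ρ₂ ξ := hB x ξ
          _ ≤ |B| * (D * W ξ) := mul_le_mul (le_abs_self B) (hWD ξ) (symbolWeight_pos _ _ _).le
              (abs_nonneg B)
          _ = _ := by ring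
      intro k
      induction k with
      | zero => exact base
      | succ k ih =>
        intro c γ
        refine ⟨base c γ, fun i => ?_⟩
        have : dirDeriv coordVec i (fun (ξ x : RN n m) =>
            iteratedFDeriv ℝ c (Function.uncurry σ) (x, ξ)
              (fun i => ((coordVec (γ i) : RN n m), (0 : RN n m))) / (W ξ : ℂ)) =
            fun ξ x => iteratedFDeriv ℝ (c + 1) (Function.uncurry σ) (x, ξ)
              (fun l => ((coordVec ((Fin.cons i γ : Fin (c + 1) → Fin n ⊕ Fin m) l) : RN n m),
                (0 : RN n m))) / (W ξ : ℂ) := by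
          funext ξ x
          have hd : DifferentiableAt ℝ (iteratedFDeriv ℝ c (Function.uncurry σ)) (x, ξ) :=
            (hσ.smooth.differentiable_iteratedFDeriv (by exact_mod_cast ENat.natCast_lt_top c)) _
          have h1 : HasFDerivAt (fun z => iteratedFDeriv ℝ c (Function.uncurry σ) (z, ξ))
              ((fderiv ℝ (iteratedFDeriv ℝ c (Function.uncurry σ)) (x, ξ)).comp
                (ContinuousLinearMap.inl ℝ (RN n m) (RN n m))) x :=
            HasFDerivAt.comp (g := iteratedFDeriv ℝ c (Function.uncurry σ))
              (f := fun z => (z, ξ)) x hd.hasFDerivAt (hasFDerivAt_prodMk_left x ξ)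
          have h2 := (ContinuousMultilinearMap.apply ℝ (fun _ : Fin c => RN n m × RN n m) ℂ
            (fun i => ((coordVec (γ i) : RN n m), (0 : RN n m)))).hasFDerivAt.comp x h1
          have h3 := (h2.mul_const ((W ξ : ℂ)⁻¹)).fderiv
          have h4 := congrArg (fun L : RN n m →L[ℝ] ℂ => L (coordVec i)) h3
          simp only [dirDeriv, div_eq_mul_inv]
          refine Eq.trans h4 ?_
          rw [iteratedFDeriv_succ_apply_left]
          simp only [Fin.cons_zero, Fin.tail_def, Fin.cons_succ]
          simp [mul_comm]
        rw [this]
        exact ih (c + 1) (Fin.cons i γ)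
    have := key k 0 Fin.elim0
    simpa using this
  support := by
    obtain ⟨K, hK, h⟩ := hσ.compact_support
    refine ⟨K, hK, fun ξ => closure_minimal (fun x hx => ?_) hK.isClosed⟩
    by_contra hxK
    exact hx (by simp [h x hxK ξ])
  nondeg := by
    obtain ⟨c, hc, h⟩ := hΦσ
    refine ⟨c, hc, fun ξ hξ x hx => h x ξ ?_ hξ⟩
    have hcl : IsClosed ((fun z : RN n m => (z, ξ)) ⁻¹' tsupport (Function.uncurry σ)) :=
      (isClosed_tsupport _).preimage (by fun_prop)
    refine closure_minimal (fun z hz => ?_) hcl hx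
    refine subset_tsupport _ (?_ : σ z ξ ≠ 0)
    intro h0
    exact hz (by simp [h0])

theorem IsAmplitude.exists_isL2Op {s : RN n m → RN n m → ℂ} (hs : IsAmplitude Φ s)
    (hΦ : IsPhase Φ) : ∃ C : ℝ≥0, IsL2Op (osc Φ s) C := by
  obtain ⟨C, hC⟩ := hs.exists_L2_bound hΦ
  obtain ⟨B, hB⟩ := hs.bdd 0
  exact ⟨C, hΦ.measurable_osc hs.measurable, ⟨B, fun x ξ => (norm_osc_le x ξ).trans (hB ξ x)⟩, hC⟩

theorem IsSymbol.isAmplitude_self (hσ : IsSymbol ρ₁ ρ₂ σ) (h₁ : 0 ≤ ρ₁) (h₂ : 0 ≤ ρ₂)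
    (hΦσ : IsNondegenerateOn Φ σ) : IsAmplitude Φ σ := by
  have := hσ.isAmplitude hΦσ (W := fun _ => 1) measurable_const (fun _ => one_pos) (D := 1)
    (fun ξ => by simpa using symbolWeight_le_one h₁ h₂ ξ)
  simpa using this

/-- The `L²` estimates for symbols of order zero. -/
theorem exists_L2_estimate (hn : 0 < n) {φ : ℝ → ℂ} (hφ : IsCutoff φ) (hΦ : IsPhase Φ)
    (hσ : IsSymbol 0 0 σ) (hΦσ : IsNondegenerateOn Φ σ) :
    ∃ C : ℝ≥0, ∀ f : RN n m → ℂ, MemLp f 2 volume → ∃ gN gS gF : RN n m → ℂ,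
      MemLp (opO φ Φ σ f) 2 volume ∧ IsNatural φ Φ σ f gN ∧ IsSharp φ Φ σ f gS ∧
      IsFlat φ Φ σ f gF ∧
      eLpNorm (opO φ Φ σ f) 2 volume + eLpNorm gN 2 volume + eLpNorm gS 2 volume +
        eLpNorm gF 2 volume ≤ C * eLpNorm f 2 volume := by
  obtain ⟨B, hB⟩ := hφ.exists_bound
  obtain ⟨C, hC⟩ := (hσ.isAmplitude_self le_rfl le_rfl hΦσ).exists_isL2Op hΦ
  refine ⟨C * B + C * (6 * B * (6 * B)) + C * ((7 * B + 1) * (6 * B)) +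
    C * ((7 * B + 1) * (6 * B)), fun f hf => ?_⟩
  obtain ⟨F, hF, hFf, hr⟩ := hC.exists_represents hn hf
  obtain ⟨gN, hN, hN'⟩ := hr.exists_isNatural hφ hB hC hF
  obtain ⟨gS, hS, hS'⟩ := hr.exists_isSharp hn hφ hB hC hC hF
  obtain ⟨gF, hFl, hFl'⟩ := hr.exists_isFlat hn hφ hB hC hC hF
  have hcut : IsFreqCut fun ξ : RN n m => φ ‖ξ‖ := hφ.isFreqCut_ball
  have hO : opO φ Φ σ f = oscOp (osc Φ σ) (fun ξ => φ ‖ξ‖ * F ξ) := funext fun x => hr _ hcut x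
  have hO' : eLpNorm (opO φ Φ σ f) 2 volume ≤ C * (B * eLpNorm F 2 volume) := by
    rw [hO]
    refine (hC.bound _ (hcut.memLp_mul hF) (hcut.integrable_mul hF)).trans
      (mul_le_mul_right ?_ _)
    refine eLpNorm_le_nnreal_smul_eLpNorm_of_ae_le_mul (Eventually.of_forall fun ξ => ?_) 2
    rw [nnnorm_mul]
    exact mul_le_mul' (by exact_mod_cast hB ‖ξ‖) le_rfl
  refine ⟨gN, gS, gF, ?_, hN, hS, hFl, ?_⟩
  · rw [hO]; exact hC.memLp (hcut.memLp_mul hF) (hcut.integrable_mul hF)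
  · rw [hFf] at hO' hN' hS' hFl'
    refine (add_le_add (add_le_add (add_le_add hO' hN') hS') hFl').trans (le_of_eq ?_)
    push_cast
    ring

/-! ### Sums over dyadic levels -/

/-- The constant is `1 / (1 - D)`; the inequality is the induction step that bounds partial sums of
a geometric series. -/
theorem exists_geometric_bound {D : ℝ≥0} (hD : D < 1) : ∃ C : ℝ≥0, 0 < C ∧ 1 + D * C ≤ C := by
  have h : 0 < 1 - D := tsub_pos_of_lt hD
  refine ⟨(1 - D)⁻¹, inv_pos.2 h, ?_⟩
  have h1 : (1 - D) + D = 1 := tsub_add_cancel_of_le hD.le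
  have h2 : 1 = (1 - D) * (1 - D)⁻¹ := (mul_inv_cancel₀ h.ne').symm
  calc 1 + D * (1 - D)⁻¹ = (1 - D) * (1 - D)⁻¹ + D * (1 - D)⁻¹ := by rw [← h2]
    _ = (1 - D)⁻¹ := by rw [← add_mul, h1, one_mul]
    _ ≤ _ := le_rfl

theorem rpow_pow_comm (A : ℝ≥0) (s : ℝ) (i : ℕ) : (A ^ s) ^ i = (A ^ i) ^ s := by
  rw [← NNReal.rpow_natCast, ← NNReal.rpow_mul, mul_comm, NNReal.rpow_mul, NNReal.rpow_natCast]

/-- A growing geometric sum is comparable to its last term, and that term satisfies `A ^ i < t`. -/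
theorem exists_sum_ite_lt_le {A : ℝ≥0} (hA : 1 < A) {s : ℝ} (hs : 0 < s) :
    ∃ C : ℝ≥0, 0 < C ∧ ∀ (t : ℝ≥0) (k : ℕ),
      ∑ i ∈ Finset.range k, (if A ^ i < t then (A ^ s) ^ i else 0) ≤ C * t ^ s := by
  have hB : 1 < A ^ s := NNReal.one_lt_rpow hA hs
  have hB0 : A ^ s ≠ 0 := (zero_lt_one.trans hB).ne'
  obtain ⟨C, hC0, hC⟩ := exists_geometric_bound (inv_lt_one_of_one_lt₀ hB)
  have hgeom : ∀ k, ∑ i ∈ Finset.range (k + 1), (A ^ s) ^ i ≤ C * (A ^ s) ^ k := by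
    intro k
    induction k with
    | zero => simpa using le_self_add.trans hC
    | succ k ih =>
      rw [Finset.sum_range_succ]
      calc _ ≤ C * (A ^ s) ^ k + (A ^ s) ^ (k + 1) := by gcongr
        _ = (1 + (A ^ s)⁻¹ * C) * (A ^ s) ^ (k + 1) := by rw [pow_succ]; field_simp; ring
        _ ≤ _ := by gcongr
  refine ⟨C, hC0, fun t k => ?_⟩
  induction k with
  | zero => simp
  | succ k ih =>
    by_cases h : A ^ k < t
    · calc _ ≤ ∑ i ∈ Finset.range (k + 1), (A ^ s) ^ i :=
            Finset.sum_le_sum fun i _ => by split_ifs <;> simp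
        _ ≤ C * (A ^ s) ^ k := hgeom k
        _ ≤ C * t ^ s := by rw [rpow_pow_comm]; gcongr
    · rw [Finset.sum_range_succ, if_neg h, add_zero]
      exact ih

/-- A decaying geometric sum is comparable to its first term. The induction peels off `i = 0` and
rescales `t` to `t / A`. -/
theorem exists_sum_ite_le_le {A : ℝ≥0} (hA : 1 < A) {r : ℝ} (hr : 0 < r) :
    ∃ C : ℝ≥0, 0 < C ∧ ∀ (k : ℕ) (t : ℝ≥0), t ≠ 0 →
      ∑ i ∈ Finset.range k, (if t ≤ A ^ i then (A ^ (-r)) ^ i else 0) ≤ C * t ^ (-r) := by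
  have hD : A ^ (-r) < 1 := NNReal.rpow_lt_one_of_one_lt_of_neg hA (by linarith)
  have hA0 : A ≠ 0 := (zero_lt_one.trans hA).ne'
  obtain ⟨C, hC0, hC⟩ := exists_geometric_bound hD
  have hgeom : ∀ k, ∑ i ∈ Finset.range k, (A ^ (-r)) ^ i ≤ C := by
    intro k
    induction k with
    | zero => simp
    | succ k ih =>
      rw [Finset.sum_range_succ']
      simp only [pow_succ, pow_zero, ← Finset.sum_mul]
      calc _ ≤ C * A ^ (-r) + 1 := by gcongr
        _ = 1 + A ^ (-r) * C := by ring
        _ ≤ C := hC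
  refine ⟨C, hC0, fun k => ?_⟩
  induction k with
  | zero => simp
  | succ k ih =>
    intro t ht
    rcases le_or_gt t 1 with h | h
    · calc _ ≤ ∑ i ∈ Finset.range (k + 1), (A ^ (-r)) ^ i :=
            Finset.sum_le_sum fun i _ => by split_ifs <;> simp
        _ ≤ C * 1 := by rw [mul_one]; exact hgeom _
        _ ≤ C * t ^ (-r) := by
            gcongr
            exact NNReal.one_le_rpow_of_pos_of_le_one_of_nonpos (pos_iff_ne_zero.2 ht) h
              (by linarith)
    · rw [Finset.sum_range_succ', pow_zero, if_neg h.not_ge, add_zero]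
      have h1 : ∀ i, (if t ≤ A ^ (i + 1) then (A ^ (-r)) ^ (i + 1) else 0) =
          (if t / A ≤ A ^ i then (A ^ (-r)) ^ i else 0) * A ^ (-r) := fun i => by
        rw [pow_succ, pow_succ, ite_mul, zero_mul]
        congr 1
        rw [div_le_iff₀ (pos_iff_ne_zero.2 hA0)]
      simp only [h1, ← Finset.sum_mul]
      calc _ ≤ C * (t / A) ^ (-r) * A ^ (-r) := by
            gcongr
            exact ih _ (div_ne_zero ht hA0)
        _ = C * t ^ (-r) := by
            rw [mul_assoc, ← NNReal.mul_rpow, div_mul_cancel₀ _ hA0]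

section Levels

variable {X : Type*} [MeasurableSpace X]

/-- After exchanging sum and integral, the levels below `g x` contribute a multiple of `g x ^ s` at
the point `x`. -/
theorem exists_tsum_setLIntegral_lt_le {A : ℝ≥0} (hA : 1 < A) {s : ℝ} (hs : 0 < s) :
    ∃ C : ℝ≥0, ∀ (μ : Measure X) (g : X → ℝ≥0∞), Measurable g →
      ∑' i : ℕ, (((A ^ s) ^ i : ℝ≥0) : ℝ≥0∞) * ∫⁻ x in {x | ((A ^ i : ℝ≥0) : ℝ≥0∞) < g x}, g x ∂μ ≤
        C * ∫⁻ x, g x ^ (1 + s) ∂μ := by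
  obtain ⟨C, hC0, hC⟩ := exists_sum_ite_lt_le hA hs
  refine ⟨C, fun μ g hg => ?_⟩
  have hmeas : ∀ i : ℕ, MeasurableSet {x | ((A ^ i : ℝ≥0) : ℝ≥0∞) < g x} := fun i =>
    measurableSet_lt measurable_const hg
  simp only [← lintegral_indicator (hmeas _)]
  simp_rw [← lintegral_const_mul _ (hg.indicator (hmeas _))]
  rw [← lintegral_tsum fun i => ((hg.indicator (hmeas i)).const_mul _).aemeasurable,
    ← lintegral_const_mul _ (hg.pow_const _)]
  refine lintegral_mono fun x => ?_
  refine ENNReal.tsum_le_of_sum_range_le fun k => ?_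
  simp only [Set.indicator_apply, Set.mem_ofPred_eq]
  rcases eq_or_ne (g x) ⊤ with h | h
  · have h' : (C : ℝ≥0∞) * g x ^ (1 + s) = ⊤ := by
      rw [h, ENNReal.top_rpow_of_pos (by linarith), ENNReal.mul_top (by simpa using hC0.ne')]
    rw [h']
    exact le_top
  · lift g x to ℝ≥0 using h with t
    rw [← ENNReal.coe_rpow_of_nonneg _ (by linarith)]
    norm_cast
    rcases eq_or_ne t 0 with h0 | h0
    · simp [h0]
    have h1 : ∀ i, (A ^ s) ^ i * (if A ^ i < t then t else 0) =
        (if A ^ i < t then (A ^ s) ^ i else 0) * t := fun i => by split_ifs <;> simp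
    calc _ = ((∑ i ∈ Finset.range k, (if A ^ i < t then (A ^ s) ^ i else 0) * t : ℝ≥0) : ℝ≥0∞) := by
          push_cast
          refine Finset.sum_congr rfl fun i _ => ?_
          split_ifs <;> simp
      _ ≤ ((C * t ^ (1 + s) : ℝ≥0) : ℝ≥0∞) := by
          rw [← Finset.sum_mul, NNReal.rpow_add h0, NNReal.rpow_one, mul_comm t, ← mul_assoc]
          exact ENNReal.coe_le_coe.2 (mul_le_mul' (hC t k) le_rfl)

/-- The counterpart for the levels above `g x`: their weights sum to a multiple of `g x ^ (s - 1)`,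
which turns the square into the power `1 + s`. -/
theorem exists_tsum_setLIntegral_le_le {A : ℝ≥0} (hA : 1 < A) {s : ℝ} (hs : 0 < s) (hs1 : s < 1) :
    ∃ C : ℝ≥0, ∀ (μ : Measure X) (g : X → ℝ≥0∞), Measurable g →
      ∑' i : ℕ, (((A ^ (-(1 - s))) ^ i : ℝ≥0) : ℝ≥0∞) *
          ∫⁻ x in {x | g x ≤ ((A ^ i : ℝ≥0) : ℝ≥0∞)}, g x ^ 2 ∂μ ≤
        C * ∫⁻ x, g x ^ (1 + s) ∂μ := by
  obtain ⟨C, hC0, hC⟩ := exists_sum_ite_le_le hA (r := 1 - s) (by linarith)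
  refine ⟨C, fun μ g hg => ?_⟩
  have hmeas : ∀ i : ℕ, MeasurableSet {x | g x ≤ ((A ^ i : ℝ≥0) : ℝ≥0∞)} := fun i =>
    measurableSet_le hg measurable_const
  simp only [← lintegral_indicator (hmeas _)]
  simp_rw [← lintegral_const_mul _ ((hg.pow_const 2).indicator (hmeas _))]
  rw [← lintegral_tsum fun i => (((hg.pow_const 2).indicator (hmeas i)).const_mul _).aemeasurable,
    ← lintegral_const_mul _ (hg.pow_const _)]
  refine lintegral_mono fun x => ?_
  refine ENNReal.tsum_le_of_sum_range_le fun k => ?_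
  simp only [Set.indicator_apply, Set.mem_ofPred_eq]
  rcases eq_or_ne (g x) ⊤ with h | h
  · have h' : (C : ℝ≥0∞) * g x ^ (1 + s) = ⊤ := by
      rw [h, ENNReal.top_rpow_of_pos (by linarith), ENNReal.mul_top (by simpa using hC0.ne')]
    rw [h']
    exact le_top
  · lift g x to ℝ≥0 using h with t
    rw [← ENNReal.coe_rpow_of_nonneg _ (by linarith)]
    norm_cast
    rcases eq_or_ne t 0 with h0 | h0
    · simp [h0]
    calc _ = ((∑ i ∈ Finset.range k, (if t ≤ A ^ i then (A ^ (-(1 - s))) ^ i else 0) * t ^ 2 : ℝ≥0)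
            : ℝ≥0∞) := by
          push_cast
          refine Finset.sum_congr rfl fun i _ => ?_
          split_ifs <;> simp
      _ ≤ ((C * t ^ (1 + s) : ℝ≥0) : ℝ≥0∞) := by
          rw [← Finset.sum_mul, show 1 + s = -(1 - s) + (2 : ℕ) by push_cast; ring,
            NNReal.rpow_add h0, NNReal.rpow_natCast, ← mul_assoc]
          exact ENNReal.coe_le_coe.2 (mul_le_mul' (hC k t h0) le_rfl)

end Levels

/-! ### Fractional integration -/

section Potential

variable {X : Type*} [MeasurableSpace X] {μ : Measure X}

/-- A sub-Markovian kernel, in both variables. -/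
structure IsDoublyMarkov (μ : Measure X) (K : X → X → ℝ≥0∞) : Prop where
  measurable : Measurable (Function.uncurry K)
  left : ∀ x, ∫⁻ y, K x y ∂μ ≤ 1
  right : ∀ y, ∫⁻ x, K x y ∂μ ≤ 1

/-- The positive integral operator with kernel `K`. -/
def posOp (μ : Measure X) (K : X → X → ℝ≥0∞) (g : X → ℝ≥0∞) (x : X) : ℝ≥0∞ := ∫⁻ y, K x y * g y ∂μ

namespace IsDoublyMarkov

variable {K L : X → X → ℝ≥0∞} {g f : X → ℝ≥0∞}

theorem measurable_right (hK : IsDoublyMarkov μ K) (x : X) : Measurable (K x) :=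
  hK.measurable.comp measurable_prodMk_left

theorem measurable_left (hK : IsDoublyMarkov μ K) (y : X) : Measurable fun x => K x y :=
  hK.measurable.comp measurable_prodMk_right

theorem measurable_mul (hK : IsDoublyMarkov μ K) (hg : Measurable g) (x : X) :
    Measurable fun y => K x y * g y :=
  (hK.measurable_right x).mul hg

theorem measurable_posOp [SFinite μ] (hK : IsDoublyMarkov μ K) (hg : Measurable g) :
    Measurable (posOp μ K g) :=
  Measurable.lintegral_prod_right' (f := fun q : X × X => K q.1 q.2 * g q.2)
    (hK.measurable.mul (hg.comp measurable_snd))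

theorem lintegral_posOp_le [SFinite μ] (hK : IsDoublyMarkov μ K) (hg : Measurable g) :
    ∫⁻ x, posOp μ K g x ∂μ ≤ ∫⁻ x, g x ∂μ := by
  unfold posOp
  rw [lintegral_lintegral_swap (hK.measurable.mul (hg.comp measurable_snd)).aemeasurable]
  refine lintegral_mono fun y => ?_
  rw [lintegral_mul_const _ (hK.measurable_left y)]
  exact mul_le_of_le_one_left' (hK.right y)

theorem posOp_le_of_le (hK : IsDoublyMarkov μ K) {h : ℝ≥0∞} (hg : ∀ x, g x ≤ h) (x : X) :
    posOp μ K g x ≤ h := by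
  calc posOp μ K g x ≤ ∫⁻ y, K x y * h ∂μ := lintegral_mono fun y => by gcongr; exact hg y
    _ = (∫⁻ y, K x y ∂μ) * h := lintegral_mul_const _ (hK.measurable_right x)
    _ ≤ h := mul_le_of_le_one_left' (hK.left x)

theorem posOp_le_of_kernel_le (hg : Measurable g) {D : ℝ≥0∞} (hD : ∀ x y, K x y ≤ D) (x : X) :
    posOp μ K g x ≤ D * ∫⁻ y, g y ∂μ := by
  rw [← lintegral_const_mul _ hg]
  exact lintegral_mono fun y => by gcongr; exact hD x y

theorem posOp_add (hK : IsDoublyMarkov μ K) (hg : Measurable g) (x : X) :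
    posOp μ K (fun y => g y + f y) x = posOp μ K g x + posOp μ K f x := by
  unfold posOp
  rw [← lintegral_add_left (hK.measurable_mul hg x)]
  simp only [mul_add]

theorem posOp_const_mul (hK : IsDoublyMarkov μ K) (hg : Measurable g) (c : ℝ≥0∞) (x : X) :
    posOp μ K (fun y => c * g y) x = c * posOp μ K g x := by
  unfold posOp
  rw [← lintegral_const_mul _ (hK.measurable_mul hg x)]
  simp only [mul_left_comm]

/-- Under the two integrals, `g(y) g(z) ≤ g(y)² + g(z)²`, and the kernel whose variable is absent
integrates to at most one. -/
theorem posOp_mul_posOp_le (hK : IsDoublyMarkov μ K) (hL : IsDoublyMarkov μ L) (hg : Measurable g)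
    (x : X) : posOp μ K g x * posOp μ L g x ≤
      posOp μ K (fun y => g y ^ 2) x + posOp μ L (fun y => g y ^ 2) x := by
  have key : ∀ y, g y * posOp μ L g x ≤ g y ^ 2 + posOp μ L (fun y => g y ^ 2) x := by
    intro y
    unfold posOp
    rw [← lintegral_const_mul _ (hL.measurable_mul hg x)]
    calc _ ≤ ∫⁻ z, (L x z * g y ^ 2 + L x z * g z ^ 2) ∂μ := by
          refine lintegral_mono fun z => ?_
          rw [← mul_add, mul_left_comm]
          gcongr
          rcases le_total (g y) (g z) with h | h
          · calc g y * g z ≤ g z * g z := by gcongr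
              _ ≤ _ := by rw [← sq]; exact le_add_self
          · calc g y * g z ≤ g y * g y := by gcongr
              _ ≤ _ := by rw [← sq]; exact le_self_add
      _ = (∫⁻ z, L x z ∂μ) * g y ^ 2 + ∫⁻ z, L x z * g z ^ 2 ∂μ := by
          rw [lintegral_add_left (hL.measurable_mul measurable_const x),
            lintegral_mul_const _ (hL.measurable_right x)]
      _ ≤ _ := by gcongr; exact mul_le_of_le_one_left' (hL.left x)
  calc posOp μ K g x * posOp μ L g x = ∫⁻ y, K x y * (g y * posOp μ L g x) ∂μ := by
        rw [posOp, ← lintegral_mul_const _ (hK.measurable_mul hg x)]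
        simp only [mul_assoc]
    _ ≤ ∫⁻ y, (K x y * g y ^ 2 + K x y * posOp μ L (fun y => g y ^ 2) x) ∂μ :=
        lintegral_mono fun y => by rw [← mul_add]; gcongr; exact key y
    _ = posOp μ K (fun y => g y ^ 2) x +
          (∫⁻ y, K x y ∂μ) * posOp μ L (fun y => g y ^ 2) x := by
        rw [lintegral_add_left (hK.measurable_mul (hg.pow_const 2) x),
          lintegral_mul_const _ (hK.measurable_right x)]
        rfl
    _ ≤ _ := by gcongr; exact mul_le_of_le_one_left' (hK.left x)

/-- The bilinear form of two kernels, by splitting the function at height `h`. -/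
theorem lintegral_posOp_mul_posOp_le [SFinite μ] (hK : IsDoublyMarkov μ K)
    (hL : IsDoublyMarkov μ L) (hg : Measurable g) {D : ℝ≥0∞} (hD : ∀ x y, K x y ≤ D) (h : ℝ≥0∞) :
    ∫⁻ x, posOp μ K g x * posOp μ L g x ∂μ ≤
      D * (∫⁻ x in {x | h < g x}, g x ∂μ) ^ 2 + 2 * h * (∫⁻ x in {x | h < g x}, g x ∂μ) +
        2 * ∫⁻ x in {x | g x ≤ h}, g x ^ 2 ∂μ := by
  have m1 : MeasurableSet {x | h < g x} := measurableSet_lt measurable_const hg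
  have m2 : MeasurableSet {x | g x ≤ h} := measurableSet_le hg measurable_const
  set u := {x | h < g x}.indicator g with hu
  set v := {x | g x ≤ h}.indicator g with hv
  have mu : Measurable u := hg.indicator m1
  have mv : Measurable v := hg.indicator m2
  have huv : g = fun x => u x + v x := by
    funext x
    rcases lt_or_ge h (g x) with hx | hx
    · simp [hu, hv, hx, hx.not_ge]
    · simp [hu, hv, hx, hx.not_gt]
  have hvh : ∀ x, v x ≤ h := fun x => by
    rw [hv, Set.indicator_apply]
    split_ifs with hx
    exacts [hx, zero_le]
  have hU : ∫⁻ x, u x ∂μ = ∫⁻ x in {x | h < g x}, g x ∂μ := lintegral_indicator m1 _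
  have hV : ∫⁻ x, v x ^ 2 ∂μ = ∫⁻ x in {x | g x ≤ h}, g x ^ 2 ∂μ := by
    rw [← lintegral_indicator m2]
    refine lintegral_congr fun x => ?_
    rw [hv, Set.indicator_apply, Set.indicator_apply]
    split_ifs <;> simp
  rw [← hU, ← hV]
  have mv2 : Measurable fun x => v x ^ 2 := mv.pow_const 2
  -- The high part meets itself through the supremum `D` of `K` and its `L¹` norm. In the cross
  -- terms the low part is at most `h`, and the product of low parts is controlled in `L²`.
  calc ∫⁻ x, posOp μ K g x * posOp μ L g x ∂μ
      ≤ ∫⁻ x, (D * (∫⁻ x, u x ∂μ) * posOp μ L u x + h * posOp μ L u x + h * posOp μ K u x +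
          (posOp μ K (fun y => v y ^ 2) x + posOp μ L (fun y => v y ^ 2) x)) ∂μ := by
        refine lintegral_mono fun x => ?_
        rw [huv, hK.posOp_add mu, hL.posOp_add mu]
        calc _ = posOp μ K u x * posOp μ L u x + posOp μ K v x * posOp μ L u x +
              posOp μ L v x * posOp μ K u x + posOp μ K v x * posOp μ L v x := by ring
          _ ≤ _ := by
            gcongr
            · exact posOp_le_of_kernel_le mu hD x
            · exact hK.posOp_le_of_le hvh x
            · exact hL.posOp_le_of_le hvh x
            · exact hK.posOp_mul_posOp_le hL mv x
    _ = D * (∫⁻ x, u x ∂μ) * (∫⁻ x, posOp μ L u x ∂μ) + h * (∫⁻ x, posOp μ L u x ∂μ) +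
          h * (∫⁻ x, posOp μ K u x ∂μ) + (∫⁻ x, posOp μ K (fun y => v y ^ 2) x ∂μ +
            ∫⁻ x, posOp μ L (fun y => v y ^ 2) x ∂μ) := by
        have a1 := hK.measurable_posOp mu
        have a2 := hL.measurable_posOp mu
        have a3 := hK.measurable_posOp mv2
        have b1 : Measurable fun x => D * (∫⁻ x, u x ∂μ) * posOp μ L u x := a2.const_mul _
        have b2 : Measurable fun x => h * posOp μ L u x := a2.const_mul _
        have b3 : Measurable fun x => h * posOp μ K u x := a1.const_mul _
        have b4 : Measurable fun x => D * (∫⁻ x, u x ∂μ) * posOp μ L u x + h * posOp μ L u x :=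
          b1.add b2
        have b5 : Measurable fun x => D * (∫⁻ x, u x ∂μ) * posOp μ L u x + h * posOp μ L u x +
          h * posOp μ K u x := b4.add b3
        rw [lintegral_add_left b5, lintegral_add_left b4, lintegral_add_left b1,
          lintegral_add_left a3, lintegral_const_mul _ a2, lintegral_const_mul _ a2,
          lintegral_const_mul _ a1]
    _ ≤ D * (∫⁻ x, u x ∂μ) * (∫⁻ x, u x ∂μ) + h * (∫⁻ x, u x ∂μ) +
          h * (∫⁻ x, u x ∂μ) + (∫⁻ x, v x ^ 2 ∂μ + ∫⁻ x, v x ^ 2 ∂μ) := by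
        have b1 := hL.lintegral_posOp_le mu
        have b2 := hK.lintegral_posOp_le mu
        have b3 := hK.lintegral_posOp_le mv2
        have b4 := hL.lintegral_posOp_le mv2
        exact add_le_add (add_le_add (add_le_add (mul_le_mul_right b1 _) (mul_le_mul_right b1 _))
          (mul_le_mul_right b2 _)) (add_le_add b3 b4)
    _ = _ := by ring

end IsDoublyMarkov

theorem tsum_sq_le_sq_tsum (x : ℕ → ℝ≥0∞) : ∑' i, x i ^ 2 ≤ (∑' i, x i) ^ 2 := by
  rw [sq (∑' i, x i), ← ENNReal.tsum_mul_right]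
  exact ENNReal.tsum_le_tsum fun i => by rw [sq]; gcongr; exact ENNReal.le_tsum i

/-- The square is expanded over pairs of scales, and each pair is split at the height `A^i` of its
smaller index `i`. The geometric factor sums over the larger index to a multiple of its value at
`i`, leaving single sums over levels of `f`. The right side is not homogeneous in `f`; scaling
repairs this afterwards. -/
theorem exists_lintegral_sq_potential_le {A : ℝ≥0} (hA : 1 < A) {s : ℝ} (hs : 0 < s)
    (hs1 : s < 1) :
    ∃ C : ℝ≥0, ∀ (μ : Measure X) [SFinite μ] (K : ℕ → X → X → ℝ≥0∞),
      (∀ j, IsDoublyMarkov μ (K j)) → (∀ j x y, K j x y ≤ (((A ^ (1 + s)) ^ j : ℝ≥0) : ℝ≥0∞)) →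
      ∀ f : X → ℝ≥0∞, Measurable f →
        ∫⁻ x, (∑' j, (((A ^ (-((1 - s) / 2))) ^ j : ℝ≥0) : ℝ≥0∞) * posOp μ (K j) f x) ^ 2 ∂μ ≤
          C * ((∫⁻ x, f x ^ (1 + s) ∂μ) ^ 2 + ∫⁻ x, f x ^ (1 + s) ∂μ) := by
  obtain ⟨C₁, -, h₁⟩ := exists_sum_ite_le_le hA (r := (1 - s) / 2) (by linarith)
  obtain ⟨C₂, h₂⟩ := exists_tsum_setLIntegral_lt_le (X := X) hA hs
  obtain ⟨C₃, h₃⟩ := exists_tsum_setLIntegral_le_le (X := X) hA hs hs1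
  refine ⟨2 * C₁ * (C₂ ^ 2 + 2 * C₂ + 2 * C₃), fun μ _ K hK hKA f hf => ?_⟩
  have hA0 : A ≠ 0 := (zero_lt_one.trans hA).ne'
  set c : ℝ≥0 := A ^ (-((1 - s) / 2)) with hc
  set M := ∫⁻ x, f x ^ (1 + s) ∂μ with hM
  set U : ℕ → ℝ≥0∞ := fun i => ∫⁻ x in {x | ((A ^ i : ℝ≥0) : ℝ≥0∞) < f x}, f x ∂μ with hU
  set V : ℕ → ℝ≥0∞ := fun i => ∫⁻ x in {x | f x ≤ ((A ^ i : ℝ≥0) : ℝ≥0∞)}, f x ^ 2 ∂μ with hV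
  set b : ℕ → ℝ≥0∞ := fun i => (((A ^ (1 + s)) ^ i : ℝ≥0) : ℝ≥0∞) * U i ^ 2 +
    2 * ((A ^ i : ℝ≥0) : ℝ≥0∞) * U i + 2 * V i with hb
  set B : ℕ → ℕ → ℝ≥0∞ := fun i j => ∫⁻ x, posOp μ (K i) f x * posOp μ (K j) f x ∂μ with hB
  -- The bilinear bound uses a supremum bound for one kernel only; the kernel of smaller index has
  -- the better one.
  have hBb : ∀ i j, B i j ≤ (if i ≤ j then b i else 0) + (if j ≤ i then b j else 0) := by
    have h : ∀ i j, B i j ≤ b i := fun i j =>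
      (hK i).lintegral_posOp_mul_posOp_le (hK j) hf (hKA i) _
    intro i j
    rcases le_total i j with hij | hij
    · rw [if_pos hij]; exact (h i j).trans le_self_add
    · rw [if_pos hij]
      refine le_trans ?_ le_add_self
      rw [show B i j = B j i by simp only [hB, mul_comm]]
      exact h j i
  have hmeas : ∀ j, Measurable (posOp μ (K j) f) := fun j => (hK j).measurable_posOp hf
  have hgeom : ∀ i, ∑' j, (if i ≤ j then ((c ^ j : ℝ≥0) : ℝ≥0∞) else 0) ≤
      C₁ * ((c ^ i : ℝ≥0) : ℝ≥0∞) := by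
    intro i
    refine ENNReal.tsum_le_of_sum_range_le fun k => ?_
    have := h₁ k (A ^ i) (pow_ne_zero _ hA0)
    rw [← rpow_pow_comm] at this
    simp only [pow_le_pow_iff_right₀ hA] at this
    calc _ = ((∑ j ∈ Finset.range k, if i ≤ j then c ^ j else 0 : ℝ≥0) : ℝ≥0∞) := by
          push_cast
          refine Finset.sum_congr rfl fun j _ => ?_
          split_ifs <;> simp
      _ ≤ ((C₁ * c ^ i : ℝ≥0) : ℝ≥0∞) := ENNReal.coe_le_coe.2 this
      _ = _ := ENNReal.coe_mul _ _
  have e1 : ∀ i : ℕ, (c ^ i * c ^ i) * (A ^ (1 + s)) ^ i = ((A ^ s) ^ i) ^ 2 := by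
    intro i
    rw [← mul_pow, ← mul_pow, ← pow_mul, mul_comm i 2, pow_mul]
    congr 1
    rw [hc, ← NNReal.rpow_add hA0, ← NNReal.rpow_add hA0, ← NNReal.rpow_natCast, ← NNReal.rpow_mul]
    congr 1
    push_cast
    ring
  have e2 : ∀ i : ℕ, (c ^ i * c ^ i) * A ^ i = (A ^ s) ^ i := by
    intro i
    rw [← mul_pow, ← mul_pow]
    congr 1
    calc c * c * A = c * c * A ^ (1 : ℝ) := by rw [NNReal.rpow_one]
      _ = A ^ s := by
        rw [hc, ← NNReal.rpow_add hA0, ← NNReal.rpow_add hA0]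
        congr 1
        ring
  have e3 : ∀ i : ℕ, (c ^ i * c ^ i) = (A ^ (-(1 - s))) ^ i := by
    intro i
    rw [← mul_pow, hc, ← NNReal.rpow_add hA0]
    congr 2
    ring
  calc ∫⁻ x, (∑' j, ((c ^ j : ℝ≥0) : ℝ≥0∞) * posOp μ (K j) f x) ^ 2 ∂μ
      = ∑' i, ∑' j, (((c ^ i : ℝ≥0) : ℝ≥0∞) * ((c ^ j : ℝ≥0) : ℝ≥0∞)) * B i j := by
        have : ∀ x, (∑' j, ((c ^ j : ℝ≥0) : ℝ≥0∞) * posOp μ (K j) f x) ^ 2 =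
            ∑' i, ∑' j, (((c ^ i : ℝ≥0) : ℝ≥0∞) * ((c ^ j : ℝ≥0) : ℝ≥0∞)) *
              (posOp μ (K i) f x * posOp μ (K j) f x) := fun x => by
          rw [sq, ← ENNReal.tsum_mul_right]
          refine tsum_congr fun i => ?_
          rw [← ENNReal.tsum_mul_left]
          exact tsum_congr fun j => by ring
        simp only [this]
        have hm : ∀ i j, Measurable fun x => (((c ^ i : ℝ≥0) : ℝ≥0∞) * ((c ^ j : ℝ≥0) : ℝ≥0∞)) *
            (posOp μ (K i) f x * posOp μ (K j) f x) := fun i j =>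
          ((hmeas i).mul (hmeas j)).const_mul _
        rw [lintegral_tsum fun i => (Measurable.tsum (hm i)).aemeasurable]
        refine tsum_congr fun i => ?_
        rw [lintegral_tsum fun j => (hm i j).aemeasurable]
        exact tsum_congr fun j => lintegral_const_mul _ ((hmeas i).mul (hmeas j))
    _ ≤ ∑' i, ∑' j, (((c ^ i : ℝ≥0) : ℝ≥0∞) * ((c ^ j : ℝ≥0) : ℝ≥0∞)) *
          ((if i ≤ j then b i else 0) + (if j ≤ i then b j else 0)) :=
        ENNReal.tsum_le_tsum fun i => ENNReal.tsum_le_tsum fun j => by gcongr; exact hBb i j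
    _ = 2 * ∑' i, ((c ^ i : ℝ≥0) : ℝ≥0∞) * b i *
          ∑' j, (if i ≤ j then ((c ^ j : ℝ≥0) : ℝ≥0∞) else 0) := by
        simp only [mul_add, ENNReal.tsum_add]
        rw [ENNReal.tsum_comm (f := fun i j => ((c ^ i : ℝ≥0) : ℝ≥0∞) * ((c ^ j : ℝ≥0) : ℝ≥0∞) *
          (if j ≤ i then b j else 0)), two_mul]
        congr 1 <;> refine tsum_congr fun i => ?_ <;> rw [← ENNReal.tsum_mul_left] <;>
          refine tsum_congr fun j => ?_ <;> split_ifs <;> ring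
    _ ≤ 2 * ∑' i, ((c ^ i : ℝ≥0) : ℝ≥0∞) * b i * (C₁ * ((c ^ i : ℝ≥0) : ℝ≥0∞)) := by
        gcongr with i
        exact hgeom i
    _ = 2 * C₁ * (∑' i, ((((A ^ s) ^ i : ℝ≥0) : ℝ≥0∞) * U i) ^ 2 +
          2 * ∑' i, (((A ^ s) ^ i : ℝ≥0) : ℝ≥0∞) * U i +
          2 * ∑' i, (((A ^ (-(1 - s))) ^ i : ℝ≥0) : ℝ≥0∞) * V i) := by
        simp only [← ENNReal.tsum_mul_left, ← ENNReal.tsum_add]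
        refine tsum_congr fun i => ?_
        rw [mul_pow, ← ENNReal.coe_pow, ← e1, ← e2, ← e3]
        simp only [hb, ENNReal.coe_mul]
        ring
    _ ≤ 2 * C₁ * ((C₂ * M) ^ 2 + 2 * (C₂ * M) + 2 * (C₃ * M)) := by
        have h4 := h₂ μ f hf
        gcongr
        · exact (tsum_sq_le_sq_tsum _).trans (by gcongr)
        · exact h₃ μ f hf
    _ ≤ _ := by
        push_cast
        calc _ = 2 * (C₁ : ℝ≥0∞) * (C₂ ^ 2 * M ^ 2 + (2 * C₂ + 2 * C₃) * M) := by ring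
          _ ≤ 2 * (C₁ : ℝ≥0∞) * ((C₂ ^ 2 + 2 * C₂ + 2 * C₃) * M ^ 2 +
                (C₂ ^ 2 + 2 * C₂ + 2 * C₃) * M) := by
              gcongr
              · rw [add_assoc]; exact le_self_add
              · exact le_add_self
          _ = _ := by ring

/-- Fractional integration, on the diagonal line of the Hardy–Littlewood–Sobolev inequality that
ends in `L²`. -/
theorem exists_lintegral_sq_potential_le_rpow {A : ℝ≥0} (hA : 1 < A) {s : ℝ} (hs : 0 < s)
    (hs1 : s < 1) :
    ∃ C : ℝ≥0, ∀ (μ : Measure X) [SFinite μ] (K : ℕ → X → X → ℝ≥0∞),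
      (∀ j, IsDoublyMarkov μ (K j)) → (∀ j x y, K j x y ≤ (((A ^ (1 + s)) ^ j : ℝ≥0) : ℝ≥0∞)) →
      ∀ f : X → ℝ≥0∞, Measurable f →
        ∫⁻ x, (∑' j, (((A ^ (-((1 - s) / 2))) ^ j : ℝ≥0) : ℝ≥0∞) * posOp μ (K j) f x) ^ 2 ∂μ ≤
          C * (∫⁻ x, f x ^ (1 + s) ∂μ) ^ (2 / (1 + s)) := by
  obtain ⟨C, hC⟩ := exists_lintegral_sq_potential_le (X := X) hA hs hs1
  refine ⟨2 * (C + 1), fun μ _ K hK hKA f hf => ?_⟩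
  have hp : 0 < 1 + s := by linarith
  have main := hC μ K hK hKA
  set M := ∫⁻ x, f x ^ (1 + s) ∂μ with hM
  rcases eq_or_ne M 0 with h0 | h0
  · refine (main f hf).trans ?_
    rw [← hM, h0]
    simp
  rcases eq_or_ne M ⊤ with ht | ht
  · rw [ht, ENNReal.top_rpow_of_pos (by positivity), ENNReal.mul_top (by simp)]
    exact le_top
  -- Division by `κ`, the `L^(1+s)` norm of `f`, normalizes the integral to one, where both terms of
  -- the inhomogeneous bound are constants.
  set κ := M ^ (1 / (1 + s)) with hκ
  have hκ0 : κ ≠ 0 := by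
    rw [hκ, Ne, ENNReal.rpow_eq_zero_iff]
    simp [h0, ht]
  have hκt : κ ≠ ⊤ := ENNReal.rpow_ne_top_of_nonneg (by positivity) ht
  have hκM : κ ^ (1 + s) = M := by
    rw [hκ, ← ENNReal.rpow_mul, one_div, inv_mul_cancel₀ hp.ne', ENNReal.rpow_one]
  have hg : Measurable fun x => κ⁻¹ * f x := hf.const_mul _
  have hfg : f = fun x => κ * (κ⁻¹ * f x) := by
    funext x
    rw [← mul_assoc, ENNReal.mul_inv_cancel hκ0 hκt, one_mul]
  have h1 : ∫⁻ x, (κ⁻¹ * f x) ^ (1 + s) ∂μ = 1 := by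
    simp only [ENNReal.mul_rpow_of_nonneg _ _ hp.le]
    rw [lintegral_const_mul _ (hf.pow_const _), ENNReal.inv_rpow, hκM, ← hM,
      ENNReal.inv_mul_cancel h0 ht]
  have h2 := main _ hg
  rw [h1] at h2
  have hmeas : ∀ j, Measurable (posOp μ (K j) fun x => κ⁻¹ * f x) := fun j =>
    (hK j).measurable_posOp hg
  calc ∫⁻ x, (∑' j, (((A ^ (-((1 - s) / 2))) ^ j : ℝ≥0) : ℝ≥0∞) * posOp μ (K j) f x) ^ 2 ∂μ
      = κ ^ 2 * ∫⁻ x, (∑' j, (((A ^ (-((1 - s) / 2))) ^ j : ℝ≥0) : ℝ≥0∞) *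
          posOp μ (K j) (fun x => κ⁻¹ * f x) x) ^ 2 ∂μ := by
        rw [← lintegral_const_mul _
          ((Measurable.tsum fun j => (hmeas j).const_mul _).pow_const 2)]
        refine lintegral_congr fun x => ?_
        rw [← mul_pow, ← ENNReal.tsum_mul_left]
        congr 1
        refine tsum_congr fun j => ?_
        conv_lhs => rw [hfg]
        rw [(hK j).posOp_const_mul hg]
        ring
    _ ≤ κ ^ 2 * (C * (1 ^ 2 + 1)) := by gcongr
    _ = C * 2 * M ^ (2 / (1 + s)) := by
        rw [hκ, ← ENNReal.rpow_natCast, ← ENNReal.rpow_mul,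
          show 1 / (1 + s) * ((2 : ℕ) : ℝ) = 2 / (1 + s) by push_cast; ring]
        norm_num
        ring
    _ ≤ _ := by
        gcongr
        push_cast
        rw [mul_comm]
        gcongr
        exact le_self_add

end Potential

/-! ### A kernel with positive Fourier transform of prescribed decay -/

section Kernel

variable {d : ℕ}

/-- The Gaussian of integral one at scale `2^{-j}`. -/
def gaussKer (j : ℕ) (u : EuclideanSpace ℝ (Fin d)) : ℝ :=
  ((2 : ℝ) ^ j) ^ d * Real.exp (-(Real.pi * ((2 : ℝ) ^ j) ^ 2) * ‖u‖ ^ 2)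

theorem gaussKer_nonneg (j : ℕ) (u : EuclideanSpace ℝ (Fin d)) : 0 ≤ gaussKer j u := by
  unfold gaussKer
  positivity

theorem gaussKer_le (j : ℕ) (u : EuclideanSpace ℝ (Fin d)) : gaussKer j u ≤ ((2 : ℝ) ^ j) ^ d := by
  unfold gaussKer
  refine mul_le_of_le_one_right (by positivity) (Real.exp_le_one_iff.2 ?_)
  rw [neg_mul]
  exact neg_nonpos.2 (by positivity)

theorem continuous_gaussKer (j : ℕ) : Continuous (gaussKer j : EuclideanSpace ℝ (Fin d) → ℝ) := by
  unfold gaussKer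
  fun_prop

open FourierTransform in
theorem fourier_gaussKer (j : ℕ) (τ : EuclideanSpace ℝ (Fin d)) :
    𝓕 (fun u : EuclideanSpace ℝ (Fin d) => (gaussKer j u : ℂ)) τ =
      (Real.exp (-(Real.pi * ‖τ‖ ^ 2 / ((2 : ℝ) ^ j) ^ 2)) : ℂ) := by
  have hb : 0 < ((Real.pi * ((2 : ℝ) ^ j) ^ 2 : ℝ) : ℂ).re := by
    rw [Complex.ofReal_re]; positivity
  have h := fourier_gaussian_innerProductSpace (V := EuclideanSpace ℝ (Fin d)) hb τ
  have e1 : (fun u : EuclideanSpace ℝ (Fin d) => (gaussKer j u : ℂ)) =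
      (((2 : ℂ) ^ j) ^ d) • fun v : EuclideanSpace ℝ (Fin d) =>
        Complex.exp (-((Real.pi * ((2 : ℝ) ^ j) ^ 2 : ℝ) : ℂ) * ‖v‖ ^ 2) := by
    funext u
    simp [gaussKer]
  rw [e1, Real.fourier_eq']
  simp only [Pi.smul_apply, smul_comm _ (((2 : ℂ) ^ j) ^ d)]
  rw [integral_smul, ← Real.fourier_eq', h]
  have hj : (0 : ℝ) < 2 ^ j := by positivity
  have e2 : ((Real.pi : ℂ) / ((Real.pi * ((2 : ℝ) ^ j) ^ 2 : ℝ) : ℂ)) ^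
      ((Module.finrank ℝ (EuclideanSpace ℝ (Fin d)) : ℂ) / 2) = (((((2 : ℝ) ^ j) ^ d)⁻¹ : ℝ) : ℂ) := by
    rw [finrank_euclideanSpace, Fintype.card_fin, ← Complex.ofReal_div,
      show ((d : ℂ) / 2) = (((d : ℝ) / 2 : ℝ) : ℂ) by push_cast; rfl,
      ← Complex.ofReal_cpow (by positivity)]
    congr 1
    rw [div_mul_eq_div_div, div_self Real.pi_ne_zero, one_div, Real.inv_rpow (by positivity),
      ← Real.rpow_natCast (2 ^ j) 2, ← Real.rpow_mul hj.le, ← Real.rpow_natCast (2 ^ j) d]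
    congr 2
    push_cast
    ring
  rw [e2, smul_eq_mul, ← mul_assoc]
  have e3 : ((2 : ℂ) ^ j) ^ d * (((((2 : ℝ) ^ j) ^ d)⁻¹ : ℝ) : ℂ) = 1 := by
    push_cast
    exact mul_inv_cancel₀ (pow_ne_zero _ (pow_ne_zero _ two_ne_zero))
  rw [e3, one_mul]
  push_cast
  congr 1
  have : (Real.pi : ℂ) ≠ 0 := by exact_mod_cast Real.pi_ne_zero
  field_simp

theorem integrable_gaussKer (j : ℕ) :
    Integrable (gaussKer j : EuclideanSpace ℝ (Fin d) → ℝ) := by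
  have := (GaussianFourier.integrable_cexp_neg_mul_sq_norm_add (V := EuclideanSpace ℝ (Fin d))
    (b := ((Real.pi * ((2 : ℝ) ^ j) ^ 2 : ℝ) : ℂ)) (by rw [Complex.ofReal_re]; positivity) 0 0).re
  refine (this.const_mul (((2 : ℝ) ^ j) ^ d)).congr (Eventually.of_forall fun u => ?_)
  simp only [gaussKer, zero_mul, add_zero]
  congr 1
  rw [← Complex.ofReal_pow, ← Complex.ofReal_neg, ← Complex.ofReal_mul, ← Complex.ofReal_exp]
  exact Complex.ofReal_re _

theorem integral_gaussKer (j : ℕ) : ∫ u : EuclideanSpace ℝ (Fin d), gaussKer j u = 1 := by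
  have h := fourier_gaussKer (d := d) j 0
  rw [Real.fourier_eq'] at h
  simp only [inner_zero_right, mul_zero, Complex.ofReal_zero, zero_mul, Complex.exp_zero, one_smul,
    norm_zero, zero_pow two_ne_zero, zero_div, neg_zero, Real.exp_zero, Complex.ofReal_one] at h
  rw [integral_complex_ofReal] at h
  exact_mod_cast h

theorem lintegral_gaussKer (j : ℕ) :
    ∫⁻ u : EuclideanSpace ℝ (Fin d), ENNReal.ofReal (gaussKer j u) = 1 := by
  rw [← ofReal_integral_eq_lintegral_ofReal (integrable_gaussKer j)
    (Eventually.of_forall (gaussKer_nonneg j)), integral_gaussKer, ENNReal.ofReal_one]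

theorem two_rpow_neg_lt_one {ρ : ℝ} (hρ : 0 < ρ) : (2 : ℝ) ^ (-ρ) < 1 :=
  Real.rpow_lt_one_of_one_lt_of_neg one_lt_two (by linarith)

/-- A kernel with the singularity of `|u|^{ρ-d}` at the origin. -/
def potKer (ρ : ℝ) (u : EuclideanSpace ℝ (Fin d)) : ℝ := ∑' j : ℕ, ((2 : ℝ) ^ (-ρ)) ^ j * gaussKer j u

/-- The radial profile of the Fourier transform of `potKer`. -/
def potWeight (ρ t : ℝ) : ℝ :=
  ∑' j : ℕ, ((2 : ℝ) ^ (-ρ)) ^ j * Real.exp (-(Real.pi * t ^ 2 / ((2 : ℝ) ^ j) ^ 2))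

theorem potKer_nonneg (ρ : ℝ) (u : EuclideanSpace ℝ (Fin d)) : 0 ≤ potKer ρ u :=
  tsum_nonneg fun j => mul_nonneg (by positivity) (gaussKer_nonneg j u)

theorem measurable_potKer (ρ : ℝ) : Measurable (potKer ρ : EuclideanSpace ℝ (Fin d) → ℝ) :=
  Measurable.tsum fun j => (continuous_gaussKer j).measurable.const_mul _

theorem ofReal_potKer_le (ρ : ℝ) (u : EuclideanSpace ℝ (Fin d)) :
    ENNReal.ofReal (potKer ρ u) ≤
      ∑' j : ℕ, ENNReal.ofReal (((2 : ℝ) ^ (-ρ)) ^ j) * ENNReal.ofReal (gaussKer j u) := by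
  rw [← Real.enorm_of_nonneg (potKer_nonneg ρ u)]
  refine enorm_tsum_le_tsum_enorm.trans (ENNReal.tsum_le_tsum fun j => ?_)
  rw [Real.enorm_of_nonneg (mul_nonneg (by positivity) (gaussKer_nonneg j u)),
    ENNReal.ofReal_mul (by positivity)]

theorem integrable_potKer {ρ : ℝ} (hρ : 0 < ρ) :
    Integrable (potKer ρ : EuclideanSpace ℝ (Fin d) → ℝ) := by
  refine ⟨(measurable_potKer ρ).aestronglyMeasurable, ?_⟩
  rw [hasFiniteIntegral_iff_enorm]
  simp only [Real.enorm_of_nonneg (potKer_nonneg ρ _)]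
  refine (lintegral_mono (ofReal_potKer_le ρ)).trans_lt ?_
  have hm : ∀ j, Measurable fun u : EuclideanSpace ℝ (Fin d) => ENNReal.ofReal (gaussKer j u) :=
    fun j => (continuous_gaussKer j).measurable.ennreal_ofReal
  rw [lintegral_tsum fun j => ((hm j).const_mul _).aemeasurable]
  simp_rw [lintegral_const_mul _ (hm _), lintegral_gaussKer, mul_one]
  rw [← ENNReal.ofReal_tsum_of_nonneg (fun j => by positivity)
    (summable_geometric_of_lt_one (by positivity) (two_rpow_neg_lt_one hρ))]
  exact ENNReal.ofReal_lt_top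

open FourierTransform in
-- The transform is taken term by term, the `L¹` norms forming a geometric series. Gaussians are
-- chosen because the kernel and its transform are then both positive and explicit.
theorem fourier_potKer {ρ : ℝ} (hρ : 0 < ρ) (τ : EuclideanSpace ℝ (Fin d)) :
    𝓕 (fun u : EuclideanSpace ℝ (Fin d) => (potKer ρ u : ℂ)) τ = (potWeight ρ ‖τ‖ : ℂ) := by
  have hc : ∀ u : EuclideanSpace ℝ (Fin d), ‖Complex.exp (((-2 * Real.pi * inner ℝ u τ : ℝ) : ℂ) * Complex.I)‖ = 1 :=
    fun u => Complex.norm_exp_ofReal_mul_I _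
  set F : ℕ → EuclideanSpace ℝ (Fin d) → ℂ := fun j u =>
    Complex.exp (((-2 * Real.pi * inner ℝ u τ : ℝ) : ℂ) * Complex.I) •
      ((((2 : ℝ) ^ (-ρ)) ^ j * gaussKer j u : ℝ) : ℂ) with hF
  have hnorm : ∀ j u, ‖F j u‖ = ((2 : ℝ) ^ (-ρ)) ^ j * gaussKer j u := fun j u => by
    rw [hF, norm_smul, hc, one_mul, Complex.norm_real, Real.norm_of_nonneg
      (mul_nonneg (by positivity) (gaussKer_nonneg j u))]
  have hFi : ∀ j, Integrable (F j) := fun j => by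
    refine Integrable.mono' ((integrable_gaussKer j).const_mul _) ?_
      (Eventually.of_forall fun u => (hnorm j u).le)
    refine Continuous.aestronglyMeasurable ?_
    have := continuous_gaussKer (d := d) j
    fun_prop
  have hsum : Summable fun j => ∫ u, ‖F j u‖ := by
    simp only [hnorm, integral_const_mul, integral_gaussKer, mul_one]
    exact summable_geometric_of_lt_one (by positivity) (two_rpow_neg_lt_one hρ)
  have key := hasSum_integral_of_summable_integral_norm hFi hsum
  have h1 : ∀ j, ∫ u, F j u = ((((2 : ℝ) ^ (-ρ)) ^ j *
      Real.exp (-(Real.pi * ‖τ‖ ^ 2 / ((2 : ℝ) ^ j) ^ 2)) : ℝ) : ℂ) := fun j => by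
    rw [Complex.ofReal_mul, ← fourier_gaussKer j τ, Real.fourier_eq', ← integral_const_mul]
    refine integral_congr_ae (Eventually.of_forall fun u => ?_)
    simp only [hF, smul_eq_mul, Complex.ofReal_mul]
    ring
  have h2 : (𝓕 (fun u : EuclideanSpace ℝ (Fin d) => (potKer ρ u : ℂ)) τ) = ∫ u, ∑' j, F j u := by
    rw [Real.fourier_eq']
    refine integral_congr_ae (Eventually.of_forall fun u => ?_)
    simp only [hF, smul_eq_mul, tsum_mul_left, potKer, Complex.ofReal_tsum]
  rw [h2, ← key.tsum_eq, potWeight, Complex.ofReal_tsum]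
  exact tsum_congr h1

theorem summable_potWeight {ρ : ℝ} (hρ : 0 < ρ) (t : ℝ) : Summable fun j : ℕ =>
    ((2 : ℝ) ^ (-ρ)) ^ j * Real.exp (-(Real.pi * t ^ 2 / ((2 : ℝ) ^ j) ^ 2)) := by
  refine Summable.of_nonneg_of_le (fun j => by positivity) (fun j => ?_)
    (summable_geometric_of_lt_one (r := (2 : ℝ) ^ (-ρ)) (by positivity) (two_rpow_neg_lt_one hρ))
  exact mul_le_of_le_one_right (by positivity)
    (Real.exp_le_one_iff.2 (neg_nonpos.2 (by positivity)))

theorem measurable_potWeight (ρ : ℝ) : Measurable (potWeight ρ) := by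
  refine Measurable.tsum fun j => ?_
  exact Continuous.measurable (by fun_prop)

theorem potWeight_pos {ρ : ℝ} (hρ : 0 < ρ) (t : ℝ) : 0 < potWeight ρ t :=
  (summable_potWeight hρ t).tsum_pos (fun j => by positivity) 0 (by positivity)

/-- One term of the series suffices. With `2^j ≤ 1 + t < 2^(j+1)`, the term of index `j + 1` has
Gaussian factor at least `e^{-π}` and coefficient at least `2^{-ρ} (1+t)^{-ρ}`. -/
theorem exists_rpow_le_potWeight {ρ : ℝ} (hρ : 0 < ρ) :
    ∃ D : ℝ, 0 < D ∧ ∀ t, 0 ≤ t → (1 / (1 + t)) ^ ρ ≤ D * potWeight ρ t := by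
  refine ⟨(2 : ℝ) ^ ρ * Real.exp Real.pi, by positivity, fun t ht => ?_⟩
  obtain ⟨j, hj1, hj2⟩ := exists_nat_pow_near (show 1 ≤ 1 + t by linarith) one_lt_two
  have h := (summable_potWeight hρ t).le_tsum (j + 1) fun i _ => by positivity
  have h2 : ((2 : ℝ) ^ (-ρ)) * (1 / (1 + t)) ^ ρ ≤ ((2 : ℝ) ^ (-ρ)) ^ (j + 1) := by
    have e : ((2 : ℝ) ^ (-ρ)) ^ j = (1 / (2 : ℝ) ^ j) ^ ρ := by
      rw [one_div, Real.inv_rpow (by positivity), ← Real.rpow_natCast, ← Real.rpow_natCast,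
        ← Real.rpow_mul zero_le_two, ← Real.rpow_mul zero_le_two,
        ← Real.rpow_neg zero_le_two]
      congr 1
      ring
    rw [pow_succ', e]
    gcongr
  have h3 : Real.exp (-Real.pi) ≤
      Real.exp (-(Real.pi * t ^ 2 / ((2 : ℝ) ^ (j + 1)) ^ 2)) := by
    rw [Real.exp_le_exp, neg_le_neg_iff, mul_div_assoc]
    refine mul_le_of_le_one_right Real.pi_pos.le ((div_le_one (by positivity)).2 ?_)
    gcongr
    linarith
  calc (1 / (1 + t)) ^ ρ = (2 : ℝ) ^ ρ * Real.exp Real.pi *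
        (((2 : ℝ) ^ (-ρ)) * (1 / (1 + t)) ^ ρ * Real.exp (-Real.pi)) := by
        rw [Real.exp_neg, Real.rpow_neg zero_le_two]
        field_simp
    _ ≤ (2 : ℝ) ^ ρ * Real.exp Real.pi * (((2 : ℝ) ^ (-ρ)) ^ (j + 1) *
          Real.exp (-(Real.pi * t ^ 2 / ((2 : ℝ) ^ (j + 1)) ^ 2))) := by gcongr
    _ ≤ _ := by gcongr; exact h

/-- Each Gaussian of the superposition is a doubly Markov kernel with supremum at most `2^(jd)`, so
the abstract potential estimate applies to the series. -/
theorem exists_lintegral_sq_potKer_le {ρ p : ℝ} (hρ : 0 < ρ) (hρd : 2 * ρ < d)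
    (hp : ρ / d = 1 / p - 1 / 2) :
    ∃ C : ℝ≥0, ∀ f : EuclideanSpace ℝ (Fin d) → ℝ≥0∞, Measurable f →
      ∫⁻ x, (∫⁻ y, ENNReal.ofReal (potKer ρ (x - y)) * f y) ^ 2 ≤
        C * (∫⁻ y, f y ^ p) ^ (2 / p) := by
  have hd : (0 : ℝ) < d := by linarith
  have ha : 0 < (d : ℝ) / 2 + ρ := by positivity
  set s : ℝ := ((d : ℝ) / 2 - ρ) / (d / 2 + ρ) with hs
  have hs0 : 0 < s := div_pos (by linarith) ha
  have hs1 : s < 1 := (div_lt_one ha).2 (by linarith)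
  -- `A` and `s` solve `A^(1+s) = 2^d`, the growth of the suprema, and `A^(-(1-s)/2) = 2^(-ρ)`, the
  -- coefficients. The resulting exponent `1 + s` is `p`.
  set A : ℝ≥0 := 2 ^ ((d : ℝ) / 2 + ρ) with hA
  have hA1 : 1 < A := NNReal.one_lt_rpow one_lt_two ha
  have hps : p = 1 + s := by
    have h1 : 1 / p = ((d : ℝ) / 2 + ρ) / d := by
      rw [eq_sub_iff_add_eq] at hp
      rw [← hp]
      field_simp
      ring
    have h2 : p = d / ((d : ℝ) / 2 + ρ) := by
      rw [← one_div_one_div p, h1, one_div_div]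
    rw [h2, hs]
    field_simp
    ring
  have e1 : A ^ (1 + s) = 2 ^ d := by
    rw [hA, ← NNReal.rpow_mul, ← NNReal.rpow_natCast]
    congr 1
    rw [hs]
    field_simp
    ring
  have e2 : A ^ (-((1 - s) / 2)) = 2 ^ (-ρ) := by
    rw [hA, ← NNReal.rpow_mul]
    congr 1
    rw [hs]
    field_simp
    ring
  obtain ⟨C, hC⟩ := exists_lintegral_sq_potential_le_rpow
    (X := EuclideanSpace ℝ (Fin d)) hA1 hs0 hs1
  refine ⟨C, fun f hf => ?_⟩
  have hm : ∀ j, Measurable fun u : EuclideanSpace ℝ (Fin d) => ENNReal.ofReal (gaussKer j u) :=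
    fun j => (continuous_gaussKer j).measurable.ennreal_ofReal
  have hK : ∀ j, IsDoublyMarkov (volume : Measure (EuclideanSpace ℝ (Fin d)))
      fun x y => ENNReal.ofReal (gaussKer j (x - y)) := fun j => by
    refine ⟨(hm j).comp (measurable_fst.sub measurable_snd), fun x => ?_, fun y => ?_⟩
    · rw [lintegral_sub_left_eq_self (fun u => ENNReal.ofReal (gaussKer j u)) x]
      exact (lintegral_gaussKer j).le
    · rw [lintegral_sub_right_eq_self (fun u => ENNReal.ofReal (gaussKer j u)) y]
      exact (lintegral_gaussKer j).le
  have := hC volume _ hK (fun j x y => by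
    rw [e1, ENNReal.ofReal_le_iff_le_toReal ENNReal.coe_ne_top]
    refine (gaussKer_le j _).trans (le_of_eq ?_)
    rw [ENNReal.coe_toReal]
    push_cast
    rw [← pow_mul, ← pow_mul, mul_comm]) f hf
  rw [hps]
  refine le_trans (lintegral_mono fun x => ?_) this
  gcongr
  calc ∫⁻ y, ENNReal.ofReal (potKer ρ (x - y)) * f y
      ≤ ∫⁻ y, ∑' j : ℕ, ENNReal.ofReal (((2 : ℝ) ^ (-ρ)) ^ j) *
          (ENNReal.ofReal (gaussKer j (x - y)) * f y) := by
        refine lintegral_mono fun y => ?_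
        simp only [← mul_assoc]
        rw [ENNReal.tsum_mul_right]
        gcongr
        exact ofReal_potKer_le ρ _
    _ = ∑' j : ℕ, ENNReal.ofReal (((2 : ℝ) ^ (-ρ)) ^ j) *
          posOp volume (fun x y => ENNReal.ofReal (gaussKer j (x - y))) f x := by
        rw [lintegral_tsum fun j => (((hK j).measurable_mul hf x).const_mul _).aemeasurable]
        exact tsum_congr fun j => lintegral_const_mul _ ((hK j).measurable_mul hf x)
    _ = _ := by
        refine tsum_congr fun j => ?_
        rw [e2]
        congr 1
        rw [← ENNReal.ofReal_coe_nnreal]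
        push_cast
        rfl

end Kernel

/-! ### Mixed norms -/

theorem lintegral_mul_sq_le {X : Type*} [MeasurableSpace X] (μ : Measure X) {f g : X → ℝ≥0∞}
    (hf : AEMeasurable f μ) (hg : AEMeasurable g μ) :
    ∫⁻ x, f x * g x ∂μ ≤
      (∫⁻ x, f x ^ 2 ∂μ) ^ (1 / 2 : ℝ) * (∫⁻ x, g x ^ 2 ∂μ) ^ (1 / 2 : ℝ) := by
  have := ENNReal.lintegral_mul_le_Lp_mul_Lq μ Real.HolderConjugate.two_two hf hg
  simpa only [ENNReal.rpow_two, Pi.mul_apply] using this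

/-- Minkowski's integral inequality in `L²`. -/
theorem lintegral_sq_lintegral_le {X Y : Type*} [MeasurableSpace X] [MeasurableSpace Y]
    {μ : Measure X} {ν : Measure Y} [SFinite μ] [SFinite ν] {H : X → Y → ℝ≥0∞}
    (hH : Measurable (Function.uncurry H)) :
    ∫⁻ y, (∫⁻ x, H x y ∂μ) ^ 2 ∂ν ≤ (∫⁻ x, (∫⁻ y, H x y ^ 2 ∂ν) ^ (1 / 2 : ℝ) ∂μ) ^ 2 := by
  have hl : ∀ x, Measurable (H x) := fun x => hH.comp measurable_prodMk_left
  have hr : ∀ y, Measurable fun x => H x y := fun y => hH.comp measurable_prodMk_right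
  have hN : Measurable fun x => (∫⁻ y, H x y ^ 2 ∂ν) ^ (1 / 2 : ℝ) :=
    (Measurable.lintegral_prod_right' (f := fun q : X × Y => H q.1 q.2 ^ 2)
      (hH.pow_const 2)).pow_const _
  have hI : Measurable fun y => ∫⁻ x, H x y ∂μ :=
    Measurable.lintegral_prod_left' (f := Function.uncurry H) hH
  calc ∫⁻ y, (∫⁻ x, H x y ∂μ) ^ 2 ∂ν = ∫⁻ y, ∫⁻ x, H x y * (∫⁻ x', H x' y ∂μ) ∂μ ∂ν := by
        refine lintegral_congr fun y => ?_
        rw [lintegral_mul_const _ (hr y), sq]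
    _ = ∫⁻ x, ∫⁻ y, H x y * (∫⁻ x', H x' y ∂μ) ∂ν ∂μ := by
        rw [lintegral_lintegral_swap]
        exact ((hH.comp measurable_swap).mul (hI.comp measurable_fst)).aemeasurable
    _ = ∫⁻ x, ∫⁻ x', ∫⁻ y, H x y * H x' y ∂ν ∂μ ∂μ := by
        refine lintegral_congr fun x => ?_
        rw [← lintegral_lintegral_swap]
        · exact lintegral_congr fun y => (lintegral_const_mul _ (hr y)).symm
        · exact (((hl x).comp measurable_fst).mul (hH.comp measurable_swap)).aemeasurable
    _ ≤ ∫⁻ x, ∫⁻ x', (∫⁻ y, H x y ^ 2 ∂ν) ^ (1 / 2 : ℝ) *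
          (∫⁻ y, H x' y ^ 2 ∂ν) ^ (1 / 2 : ℝ) ∂μ ∂μ :=
        lintegral_mono fun x => lintegral_mono fun x' =>
          lintegral_mul_sq_le ν (hl x).aemeasurable (hl x').aemeasurable
    _ = _ := by
        simp_rw [lintegral_const_mul _ hN]
        rw [lintegral_mul_const _ hN, sq]

/-- Minkowski's inequality brings the `L²` norm in `v` inside the `u'` integral. The one-group
estimate in `v` bounds it by the inner `L^{p₂}` norm, and the one-group estimate in `u` is applied
to that norm as a function of `u'`. -/
theorem exists_lintegral_sq_mixed_le {ρ₁ ρ₂ p₁ p₂ : ℝ} (h₁ : 0 < ρ₁) (h₁n : 2 * ρ₁ < n)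
    (h₂ : 0 < ρ₂) (h₂m : 2 * ρ₂ < m) (hp₁ : ρ₁ / n = 1 / p₁ - 1 / 2)
    (hp₂ : ρ₂ / m = 1 / p₂ - 1 / 2) :
    ∃ C : ℝ≥0, ∀ G : EuclideanSpace ℝ (Fin n) → EuclideanSpace ℝ (Fin m) → ℝ≥0∞,
      Measurable (Function.uncurry G) →
      ∫⁻ u, ∫⁻ v, (∫⁻ u', ∫⁻ v', ENNReal.ofReal (potKer ρ₁ (u - u')) *
          (ENNReal.ofReal (potKer ρ₂ (v - v')) * G u' v')) ^ 2 ≤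
        C * (∫⁻ u, (∫⁻ v, G u v ^ p₂) ^ (p₁ / p₂)) ^ (2 / p₁) := by
  have pos : ∀ {ρ p : ℝ} {d : ℕ}, 0 < ρ → ρ / d = 1 / p - 1 / 2 → 0 < p := fun {ρ p d} h e => by
    have h0 : 0 ≤ ρ / d := by positivity
    exact one_div_pos.1 (by linarith)
  have hp₁0 : 0 < p₁ := pos h₁ hp₁
  have hp₂0 : 0 < p₂ := pos h₂ hp₂
  obtain ⟨C₁, hC₁⟩ := exists_lintegral_sq_potKer_le h₁ h₁n hp₁
  obtain ⟨C₂, hC₂⟩ := exists_lintegral_sq_potKer_le h₂ h₂m hp₂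
  refine ⟨C₁ * C₂, fun G hG => ?_⟩
  have k₁ : Measurable fun u : EuclideanSpace ℝ (Fin n) => ENNReal.ofReal (potKer ρ₁ u) :=
    (measurable_potKer ρ₁).ennreal_ofReal
  have k₂ : Measurable fun v : EuclideanSpace ℝ (Fin m) => ENNReal.ofReal (potKer ρ₂ v) :=
    (measurable_potKer ρ₂).ennreal_ofReal
  set H : EuclideanSpace ℝ (Fin n) → EuclideanSpace ℝ (Fin m) → ℝ≥0∞ := fun u v =>
    ∫⁻ v', ENNReal.ofReal (potKer ρ₂ (v - v')) * G u v' with hH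
  have mH : Measurable (Function.uncurry H) := by
    refine Measurable.lintegral_prod_right' (f := fun q : (EuclideanSpace ℝ (Fin n) ×
      EuclideanSpace ℝ (Fin m)) × EuclideanSpace ℝ (Fin m) =>
      ENNReal.ofReal (potKer ρ₂ (q.1.2 - q.2)) * G q.1.1 q.2) ?_
    refine (k₂.comp ((measurable_snd.comp measurable_fst).sub measurable_snd)).mul ?_
    exact hG.comp ((measurable_fst.comp measurable_fst).prodMk measurable_snd)
  set g : EuclideanSpace ℝ (Fin n) → ℝ≥0∞ := fun u => (∫⁻ v, G u v ^ p₂) ^ (1 / p₂) with hg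
  have mg : Measurable g :=
    (Measurable.lintegral_prod_right' (f := fun q : EuclideanSpace ℝ (Fin n) ×
      EuclideanSpace ℝ (Fin m) => G q.1 q.2 ^ p₂) (hG.pow_const p₂)).pow_const _
  have hHg : ∀ u, (∫⁻ v, H u v ^ 2) ^ (1 / 2 : ℝ) ≤ (C₂ : ℝ≥0∞) ^ (1 / 2 : ℝ) * g u := by
    intro u
    calc (∫⁻ v, H u v ^ 2) ^ (1 / 2 : ℝ)
        ≤ (C₂ * (∫⁻ v, G u v ^ p₂) ^ (2 / p₂)) ^ (1 / 2 : ℝ) := by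
          gcongr
          exact hC₂ _ (hG.comp measurable_prodMk_left)
      _ = _ := by
          rw [ENNReal.mul_rpow_of_nonneg _ _ (by norm_num), ← ENNReal.rpow_mul]
          congr 2
          ring
  calc _ = ∫⁻ u, ∫⁻ v, (∫⁻ u', ENNReal.ofReal (potKer ρ₁ (u - u')) * H u' v) ^ 2 := by
        refine lintegral_congr fun u => lintegral_congr fun v => ?_
        congr 1
        refine lintegral_congr fun u' => ?_
        rw [lintegral_const_mul]
        exact (k₂.comp (measurable_const.sub measurable_id)).mul (hG.comp measurable_prodMk_left)
    _ ≤ ∫⁻ u, (∫⁻ u', (∫⁻ v, (ENNReal.ofReal (potKer ρ₁ (u - u')) * H u' v) ^ 2) ^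
          (1 / 2 : ℝ)) ^ 2 :=
        lintegral_mono fun u => lintegral_sq_lintegral_le
          (((k₁.comp (measurable_const.sub measurable_id)).comp measurable_fst).mul mH)
    _ ≤ ∫⁻ u, (∫⁻ u', ENNReal.ofReal (potKer ρ₁ (u - u')) *
          ((C₂ : ℝ≥0∞) ^ (1 / 2 : ℝ) * g u')) ^ 2 := by
        refine lintegral_mono fun u => pow_le_pow_left₀ zero_le (lintegral_mono fun u' => ?_) 2
        simp only [mul_pow]
        have mv : Measurable fun v => H u' v ^ 2 := (mH.comp measurable_prodMk_left).pow_const 2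
        rw [lintegral_const_mul _ mv,
          ENNReal.mul_rpow_of_nonneg _ _ (by norm_num), ← ENNReal.rpow_natCast, ← ENNReal.rpow_mul]
        norm_num
        gcongr
        have := hHg u'
        norm_num at this
        exact this
    _ ≤ C₁ * (∫⁻ u, ((C₂ : ℝ≥0∞) ^ (1 / 2 : ℝ) * g u) ^ p₁) ^ (2 / p₁) := hC₁ _ (mg.const_mul _)
    _ = _ := by
        simp only [ENNReal.mul_rpow_of_nonneg _ _ hp₁0.le]
        rw [lintegral_const_mul _ (mg.pow_const _), ENNReal.mul_rpow_of_nonneg _ _ (by positivity),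
          ← ENNReal.rpow_mul, ← ENNReal.rpow_mul, ENNReal.coe_mul, mul_assoc]
        congr 2
        · rw [show (1 / 2 * (p₁ * (2 / p₁)) : ℝ) = 1 by field_simp, ENNReal.rpow_one]
        · congr 1
          refine lintegral_congr fun u => ?_
          rw [hg, ← ENNReal.rpow_mul]
          congr 1
          ring

/-! ### The product structure of `ℝᴺ` -/

/-- The identification of `ℝⁿ × ℝᵐ` with `ℝᴺ`. -/
def joinEquiv : EuclideanSpace ℝ (Fin n) × EuclideanSpace ℝ (Fin m) ≃ᵐ RN n m where
  toFun q := join q.1 q.2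
  invFun ξ := (fstPart ξ, sndPart ξ)
  left_inv q := rfl
  right_inv ξ := by
    ext i
    cases i <;> rfl
  measurable_toFun := by
    refine (WithLp.measurable_toLp 2 _).comp (measurable_pi_iff.2 fun i => ?_)
    cases i with
    | inl i => exact (measurable_pi_apply i).comp ((WithLp.measurable_ofLp 2 _).comp measurable_fst)
    | inr i => exact (measurable_pi_apply i).comp ((WithLp.measurable_ofLp 2 _).comp measurable_snd)
  measurable_invFun := measurable_fstPart.prodMk measurable_sndPart

theorem joinEquiv_apply (q : EuclideanSpace ℝ (Fin n) × EuclideanSpace ℝ (Fin m)) :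
    joinEquiv q = join q.1 q.2 := rfl

theorem measurePreserving_joinEquiv :
    MeasurePreserving (joinEquiv : EuclideanSpace ℝ (Fin n) × EuclideanSpace ℝ (Fin m) ≃ᵐ RN n m)
      volume volume := by
  have h1 := ((PiLp.volume_preserving_ofLp (Fin n)).prod
    (PiLp.volume_preserving_ofLp (Fin m)))
  have h2 := volume_measurePreserving_sumPiEquivProdPi_symm (fun _ : Fin n ⊕ Fin m => ℝ)
  have h3 := PiLp.volume_preserving_toLp (Fin n ⊕ Fin m)
  have h := h3.comp (h2.comp h1)
  have e : ⇑(joinEquiv : EuclideanSpace ℝ (Fin n) × EuclideanSpace ℝ (Fin m) ≃ᵐ RN n m) =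
      WithLp.toLp 2 ∘ (MeasurableEquiv.sumPiEquivProdPi fun _ : Fin n ⊕ Fin m => ℝ).symm ∘
        Prod.map WithLp.ofLp WithLp.ofLp := by
    funext q
    ext i
    cases i <;> rfl
  rw [e]
  exact h

theorem join_sub (u u' : EuclideanSpace ℝ (Fin n)) (v v' : EuclideanSpace ℝ (Fin m)) :
    join u v - join u' v' = join (u - u') (v - v') := by
  ext i
  cases i <;> rfl

theorem inner_join (u : EuclideanSpace ℝ (Fin n)) (v : EuclideanSpace ℝ (Fin m)) (ξ : RN n m) :
    inner ℝ (join u v) ξ = inner ℝ u (fstPart ξ) + inner ℝ v (sndPart ξ) := by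
  simp [PiLp.inner_apply, join, fstPart, sndPart]

theorem lintegral_join {f : RN n m → ℝ≥0∞} (hf : Measurable f) :
    ∫⁻ z, f z = ∫⁻ u : EuclideanSpace ℝ (Fin n), ∫⁻ v : EuclideanSpace ℝ (Fin m), f (join u v) := by
  rw [← measurePreserving_joinEquiv.lintegral_comp hf, Measure.volume_eq_prod,
    lintegral_prod (fun q => f (joinEquiv q)) (hf.comp joinEquiv.measurable).aemeasurable]
  rfl

/-- Functions that agree almost everywhere have the same mixed norm. -/
theorem mixedNorm_congr_ae {p₁ p₂ : ℝ} {f g : RN n m → ℂ} (h : f =ᵐ[volume] g) :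
    mixedNorm p₁ p₂ f = mixedNorm p₁ p₂ g := by
  have h1 := measurePreserving_joinEquiv.quasiMeasurePreserving.ae h
  rw [Measure.volume_eq_prod] at h1
  have h2 := Measure.ae_ae_of_ae_prod h1
  unfold mixedNorm
  congr 1
  refine lintegral_congr_ae (h2.mono fun u hu => ?_)
  simp only
  congr 1
  refine lintegral_congr_ae (hu.mono fun v hv => ?_)
  simp only [joinEquiv_apply] at hv
  simp only [hv]

theorem mixedNorm_two {f : RN n m → ℂ} (hf : AEStronglyMeasurable f volume) :
    mixedNorm 2 2 f = eLpNorm f 2 volume := by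
  rw [mixedNorm_congr_ae hf.ae_eq_mk, eLpNorm_congr_ae hf.ae_eq_mk]
  set g := hf.mk f
  have hg : Measurable g := hf.stronglyMeasurable_mk.measurable
  have h := sq_eLpNorm_two (μ := (volume : Measure (RN n m))) g
  rw [lintegral_join (hg.enorm.pow_const 2)] at h
  unfold mixedNorm
  simp only [div_self (two_ne_zero' ℝ), ENNReal.rpow_one, ENNReal.rpow_two]
  rw [← h, ← ENNReal.rpow_natCast, ← ENNReal.rpow_mul]
  norm_num

/-! ### Mixed norm estimates -/

/-- The product of the kernels `potKer` in the two groups of variables. -/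
def mixedKer (ρ₁ ρ₂ : ℝ) (z : RN n m) : ℝ := potKer ρ₁ (fstPart z) * potKer ρ₂ (sndPart z)

/-- The Fourier transform of `mixedKer`. -/
def mixedWeight (ρ₁ ρ₂ : ℝ) (ξ : RN n m) : ℝ := potWeight ρ₁ ‖fstPart ξ‖ * potWeight ρ₂ ‖sndPart ξ‖

theorem measurable_mixedKer (ρ₁ ρ₂ : ℝ) : Measurable (mixedKer ρ₁ ρ₂ : RN n m → ℝ) :=
  ((measurable_potKer ρ₁).comp measurable_fstPart).mul
    ((measurable_potKer ρ₂).comp measurable_sndPart)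

theorem measurable_mixedWeight (ρ₁ ρ₂ : ℝ) : Measurable (mixedWeight ρ₁ ρ₂ : RN n m → ℝ) :=
  ((measurable_potWeight ρ₁).comp measurable_fstPart.norm).mul
    ((measurable_potWeight ρ₂).comp measurable_sndPart.norm)

section

variable {ρ₁ ρ₂ : ℝ}

theorem mixedWeight_pos (h₁ : 0 < ρ₁) (h₂ : 0 < ρ₂) (ξ : RN n m) : 0 < mixedWeight ρ₁ ρ₂ ξ :=
  mul_pos (potWeight_pos h₁ _) (potWeight_pos h₂ _)

theorem exists_symbolWeight_le_mixedWeight (h₁ : 0 < ρ₁) (h₂ : 0 < ρ₂) :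
    ∃ D : ℝ, ∀ ξ : RN n m, symbolWeight ρ₁ ρ₂ ξ ≤ D * mixedWeight ρ₁ ρ₂ ξ := by
  obtain ⟨D₁, hD₁, hD₁'⟩ := exists_rpow_le_potWeight h₁
  obtain ⟨D₂, hD₂, hD₂'⟩ := exists_rpow_le_potWeight h₂
  refine ⟨D₁ * D₂, fun ξ => ?_⟩
  rw [symbolWeight, mixedWeight, mul_mul_mul_comm]
  exact mul_le_mul (hD₁' _ (norm_nonneg _)) (hD₂' _ (norm_nonneg _)) (by positivity)
    (mul_nonneg hD₁.le (potWeight_pos h₁ _).le)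

theorem integrable_mixedKer (h₁ : 0 < ρ₁) (h₂ : 0 < ρ₂) :
    Integrable (mixedKer ρ₁ ρ₂ : RN n m → ℝ) := by
  rw [← measurePreserving_joinEquiv.integrable_comp_emb joinEquiv.measurableEmbedding]
  exact (integrable_potKer h₁).mul_prod (integrable_potKer h₂)

open FourierTransform in
theorem fourier_mixedKer (h₁ : 0 < ρ₁) (h₂ : 0 < ρ₂) (ξ : RN n m) :
    𝓕 (fun z : RN n m => (mixedKer ρ₁ ρ₂ z : ℂ)) ξ = (mixedWeight ρ₁ ρ₂ ξ : ℂ) := by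
  rw [mixedWeight, Complex.ofReal_mul, ← fourier_potKer h₁, ← fourier_potKer h₂]
  simp only [Real.fourier_eq']
  rw [← integral_prod_mul, ← Measure.volume_eq_prod,
    ← measurePreserving_joinEquiv.integral_comp joinEquiv.measurableEmbedding]
  refine integral_congr_ae (Eventually.of_forall fun q => ?_)
  simp only [joinEquiv_apply, inner_join, mixedKer, smul_eq_mul, Complex.ofReal_mul]
  rw [show fstPart (join q.1 q.2) = q.1 from rfl, show sndPart (join q.1 q.2) = q.2 from rfl,
    mul_mul_mul_comm, ← Complex.exp_add]
  congr 2
  push_cast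
  ring

open FourierTransform in
-- The weight is the transform of `mixedKer`; modulating `q` turns the dependence on `y` into a
-- translation of `𝓕 q`, and the multiplication formula does the rest.
theorem fourier_mixedWeight_mul (h₁ : 0 < ρ₁) (h₂ : 0 < ρ₂) {q : RN n m → ℂ} (hq : Integrable q)
    (y : RN n m) : 𝓕 (fun ξ => (mixedWeight ρ₁ ρ₂ ξ : ℂ) * q ξ) y =
      ∫ w, 𝓕 q w * (mixedKer ρ₁ ρ₂ (w - y) : ℂ) := by
  set e : RN n m → ℂ := fun ξ => Complex.exp (((-2 * Real.pi * inner ℝ ξ y : ℝ) : ℂ) * Complex.I)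
    with he
  have hqe : Integrable fun ξ => e ξ * q ξ := by
    refine hq.bdd_mul (c := 1) ?_ (Eventually.of_forall fun ξ => ?_)
    · exact Continuous.aestronglyMeasurable (by fun_prop)
    · rw [he, Complex.norm_exp_ofReal_mul_I]
  have h := integral_mul_fourier_eq (g := fun z : RN n m => (mixedKer ρ₁ ρ₂ z : ℂ))
    (integrable_mixedKer h₁ h₂).ofReal hqe
  have e1 : ∀ z, 𝓕 (fun ξ => e ξ * q ξ) z = 𝓕 q (z + y) := fun z => by
    simp only [Real.fourier_eq', he, smul_eq_mul, ← mul_assoc, ← Complex.exp_add]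
    refine integral_congr_ae (Eventually.of_forall fun ξ => ?_)
    simp only [inner_add_right]
    congr 2
    push_cast
    ring
  simp only [e1, fourier_mixedKer h₁ h₂] at h
  rw [← integral_add_right_eq_self (fun w => 𝓕 q w * (mixedKer ρ₁ ρ₂ (w - y) : ℂ)) y]
  simp only [add_sub_cancel_right]
  rw [Real.fourier_eq']
  simp only [mul_comm (𝓕 q _)]
  rw [h]
  refine integral_congr_ae (Eventually.of_forall fun ξ => ?_)
  simp only [he, smul_eq_mul]
  ring

/-- The convolution with `mixedKer`. -/
def mixedConv (ρ₁ ρ₂ : ℝ) (f : RN n m → ℂ) (w : RN n m) : ℂ :=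
  ∫ y, f y * (mixedKer ρ₁ ρ₂ (w - y) : ℂ)

/-- The absolute value stands inside the inner integral, so the bound serves both for the norm of
the convolution and for the integrability behind Fubini's theorem. -/
theorem exists_lintegral_sq_mixedKer_le {p₁ p₂ : ℝ} (h₁ : 0 < ρ₁) (h₁n : 2 * ρ₁ < n) (h₂ : 0 < ρ₂)
    (h₂m : 2 * ρ₂ < m) (hp₁ : ρ₁ / n = 1 / p₁ - 1 / 2) (hp₂ : ρ₂ / m = 1 / p₂ - 1 / 2) :
    ∃ C : ℝ≥0, ∀ f : RN n m → ℂ, Measurable f →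
      ∫⁻ w, (∫⁻ y, ‖f y * (mixedKer ρ₁ ρ₂ (w - y) : ℂ)‖ₑ) ^ 2 ≤ (C * mixedNorm p₁ p₂ f) ^ 2 := by
  obtain ⟨C, hC⟩ := exists_lintegral_sq_mixed_le h₁ h₁n h₂ h₂m hp₁ hp₂
  refine ⟨C ^ (1 / 2 : ℝ), fun f hf => ?_⟩
  have hG : Measurable (Function.uncurry fun (u : EuclideanSpace ℝ (Fin n))
      (v : EuclideanSpace ℝ (Fin m)) => ‖f (join u v)‖ₑ) :=
    hf.enorm.comp joinEquiv.measurable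
  have hk : Measurable fun q : RN n m × RN n m => ‖f q.2 * (mixedKer ρ₁ ρ₂ (q.1 - q.2) : ℂ)‖ₑ :=
    ((hf.comp measurable_snd).mul (Complex.measurable_ofReal.comp
      ((measurable_mixedKer ρ₁ ρ₂).comp (measurable_fst.sub measurable_snd)))).enorm
  have e1 : ∀ u v u' v', ‖f (join u' v') * (mixedKer ρ₁ ρ₂ (join u v - join u' v') : ℂ)‖ₑ =
      ENNReal.ofReal (potKer ρ₁ (u - u')) *
        (ENNReal.ofReal (potKer ρ₂ (v - v')) * ‖f (join u' v')‖ₑ) := fun u v u' v' => by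
    rw [join_sub, mixedKer, show fstPart (join (u - u') (v - v')) = u - u' from rfl,
      show sndPart (join (u - u') (v - v')) = v - v' from rfl, enorm_mul, ← ofReal_norm (_ : ℂ),
      ← ofReal_norm ((_ : ℝ) : ℂ),
      Complex.norm_real, Real.norm_of_nonneg (mul_nonneg (potKer_nonneg _ _) (potKer_nonneg _ _)),
      ENNReal.ofReal_mul (potKer_nonneg _ _)]
    ring
  rw [lintegral_join ((hk.lintegral_prod_right').pow_const 2)]
  have e2 : ∀ w : RN n m, ∫⁻ y, ‖f y * (mixedKer ρ₁ ρ₂ (w - y) : ℂ)‖ₑ =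
      ∫⁻ u : EuclideanSpace ℝ (Fin n), ∫⁻ v : EuclideanSpace ℝ (Fin m),
        ‖f (join u v) * (mixedKer ρ₁ ρ₂ (w - join u v) : ℂ)‖ₑ := fun w =>
    lintegral_join (hk.comp (measurable_prodMk_left (x := w)))
  simp only [e2, e1]
  refine (hC _ hG).trans (le_of_eq ?_)
  rw [mul_pow, mixedNorm, ENNReal.coe_rpow_of_nonneg _ (by norm_num), ← ENNReal.rpow_natCast,
    ← ENNReal.rpow_natCast, ← ENNReal.rpow_mul, ← ENNReal.rpow_mul]
  norm_num
  congr 1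
  ring_nf

theorem memLp_mixedConv {f : RN n m → ℂ} (hf : Measurable f) {M : ℝ≥0∞} (hM : M ≠ ⊤)
    (hfM : ∫⁻ w, (∫⁻ y, ‖f y * (mixedKer ρ₁ ρ₂ (w - y) : ℂ)‖ₑ) ^ 2 ≤ M ^ 2) :
    MemLp (mixedConv ρ₁ ρ₂ f) 2 volume ∧ eLpNorm (mixedConv ρ₁ ρ₂ f) 2 volume ≤ M := by
  have hk : Measurable fun q : RN n m × RN n m => f q.2 * (mixedKer ρ₁ ρ₂ (q.1 - q.2) : ℂ) :=
    (hf.comp measurable_snd).mul (Complex.measurable_ofReal.comp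
      ((measurable_mixedKer ρ₁ ρ₂).comp (measurable_fst.sub measurable_snd)))
  have h1 : AEStronglyMeasurable (mixedConv ρ₁ ρ₂ f) volume :=
    AEStronglyMeasurable.integral_prod_right' hk.aestronglyMeasurable
  have h2 : eLpNorm (mixedConv ρ₁ ρ₂ f) 2 volume ≤ M := by
    rw [← ENNReal.pow_le_pow_left_iff two_ne_zero, sq_eLpNorm_two]
    refine (lintegral_mono fun w => ?_).trans hfM
    gcongr
    exact enorm_integral_le_lintegral_enorm _
  exact ⟨⟨h1, h2.trans_lt hM.lt_top⟩, h2⟩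

open FourierTransform in
-- Moves the weight from the kernel to `f`, as a convolution. Fubini's theorem is justified by
-- Cauchy–Schwarz between `𝓕 q` and the convolution of absolute values, both in `L²`; `f` itself
-- need not be integrable.
theorem integral_mul_fourier_mixedWeight (h₁ : 0 < ρ₁) (h₂ : 0 < ρ₂) {f : RN n m → ℂ}
    (hf : Measurable f) {M : ℝ≥0∞} (hM : M ≠ ⊤)
    (hfM : ∫⁻ w, (∫⁻ y, ‖f y * (mixedKer ρ₁ ρ₂ (w - y) : ℂ)‖ₑ) ^ 2 ≤ M ^ 2) {q : RN n m → ℂ}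
    (hq : Integrable q) (hq2 : MemLp q 2 volume) :
    ∫ y, f y * 𝓕 (fun ξ => (mixedWeight ρ₁ ρ₂ ξ : ℂ) * q ξ) y =
      ∫ w, mixedConv ρ₁ ρ₂ f w * 𝓕 q w := by
  have hk : Measurable fun q : RN n m × RN n m => f q.2 * (mixedKer ρ₁ ρ₂ (q.1 - q.2) : ℂ) :=
    (hf.comp measurable_snd).mul (Complex.measurable_ofReal.comp
      ((measurable_mixedKer ρ₁ ρ₂).comp (measurable_fst.sub measurable_snd)))
  have hFq : Continuous (𝓕 q) :=
    VectorFourier.fourierIntegral_continuous Real.continuous_fourierChar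
      (by exact continuous_inner) hq
  have hmeas : Measurable fun r : RN n m × RN n m =>
      𝓕 q r.1 * (f r.2 * (mixedKer ρ₁ ρ₂ (r.1 - r.2) : ℂ)) :=
    (hFq.measurable.comp measurable_fst).mul hk
  have hint : Integrable (fun r : RN n m × RN n m =>
      𝓕 q r.1 * (f r.2 * (mixedKer ρ₁ ρ₂ (r.1 - r.2) : ℂ))) (volume.prod volume) := by
    refine ⟨hmeas.aestronglyMeasurable, ?_⟩
    rw [hasFiniteIntegral_iff_enorm, lintegral_prod _ hmeas.enorm.aemeasurable]
    have e1 : ∀ w : RN n m, ∫⁻ y, ‖𝓕 q w * (f y * (mixedKer ρ₁ ρ₂ (w - y) : ℂ))‖ₑ =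
        ‖𝓕 q w‖ₑ * ∫⁻ y, ‖f y * (mixedKer ρ₁ ρ₂ (w - y) : ℂ)‖ₑ := fun w => by
      simp_rw [enorm_mul (𝓕 q w)]
      exact lintegral_const_mul _ (hk.enorm.comp (measurable_prodMk_left (x := w)))
    simp only [e1]
    refine (lintegral_mul_sq_le volume hFq.measurable.enorm.aemeasurable
      (hk.enorm.lintegral_prod_right').aemeasurable).trans_lt ?_
    refine ENNReal.mul_lt_top ?_ ?_
    · refine ENNReal.rpow_lt_top_of_nonneg (by norm_num) ?_
      rw [← sq_eLpNorm_two, eLpNorm_fourier_eq hq hq2]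
      exact ENNReal.pow_ne_top hq2.2.ne
    · exact ENNReal.rpow_lt_top_of_nonneg (by norm_num)
        (ne_top_of_le_ne_top (ENNReal.pow_ne_top hM) hfM)
  simp_rw [fourier_mixedWeight_mul h₁ h₂ hq, mixedConv, mul_comm _ (𝓕 q _), ← integral_const_mul]
  have hint' : Integrable (Function.uncurry fun y w : RN n m =>
      f y * (𝓕 q w * (mixedKer ρ₁ ρ₂ (w - y) : ℂ))) (volume.prod volume) :=
    hint.swap.congr (Eventually.of_forall fun r => by
      simp only [Function.comp_apply, Prod.fst_swap, Prod.snd_swap, Function.uncurry]; ring)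
  rw [integral_integral_swap hint']
  refine integral_congr_ae (Eventually.of_forall fun y => ?_)
  refine integral_congr_ae (Eventually.of_forall fun w => ?_)
  simp only
  ring

end

variable {ρ ρ₁ ρ₂ : ℝ} {σ : RN n m → RN n m → ℂ} {Φ : RN n m → RN n m → ℝ}

theorem Represents.congr_ae {s : RN n m → RN n m → ℂ} {f g F : RN n m → ℂ}
    (h : Represents Φ σ s f F) (hfg : g =ᵐ[volume] f) : Represents Φ σ s g F := fun ψ hψ x => by
  rw [← h ψ hψ x]
  refine integral_congr_ae (hfg.mono fun y hy => ?_)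
  simp only [hy]

/-- The operators of a symbol of negative order on `L^{p₁}L^{p₂}` come from operators of order zero
on `L²`. -/
theorem IsSymbol.exists_represents_mixed (hn : 0 < n) {p₁ p₂ : ℝ} (h₁ : 0 < ρ₁) (h₁n : 2 * ρ₁ < n)
    (h₂ : 0 < ρ₂) (h₂m : 2 * ρ₂ < m) (hp₁ : ρ₁ / n = 1 / p₁ - 1 / 2)
    (hp₂ : ρ₂ / m = 1 / p₂ - 1 / 2) (hΦ : IsPhase Φ) (hσ : IsSymbol ρ₁ ρ₂ σ)
    (hΦσ : IsNondegenerateOn Φ σ) :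
    ∃ s : RN n m → RN n m → ℂ, ∃ C K : ℝ≥0, IsL2Op (osc Φ s) C ∧
      ∀ f, MemMixed p₁ p₂ f → ∃ F, MemLp F 2 volume ∧
        eLpNorm F 2 volume ≤ K * mixedNorm p₁ p₂ f ∧ Represents Φ σ s f F := by
  obtain ⟨D, hD⟩ := exists_symbolWeight_le_mixedWeight (n := n) (m := m) h₁ h₂
  obtain ⟨C, hC⟩ := (hσ.isAmplitude hΦσ (measurable_mixedWeight ρ₁ ρ₂)
    (mixedWeight_pos h₁ h₂) hD).exists_isL2Op hΦ
  obtain ⟨K, hK⟩ := exists_lintegral_sq_mixedKer_le h₁ h₁n h₂ h₂m hp₁ hp₂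
  refine ⟨_, C, K, hC, fun f hf => ?_⟩
  set g := hf.1.mk f with hg
  have hfg : f =ᵐ[volume] g := hf.1.ae_eq_mk
  have hgm : Measurable g := hf.1.stronglyMeasurable_mk.measurable
  have hbd := hK g hgm
  rw [← mixedNorm_congr_ae hfg] at hbd
  have hM : (K : ℝ≥0∞) * mixedNorm p₁ p₂ f ≠ ⊤ := ENNReal.mul_ne_top ENNReal.coe_ne_top hf.2.ne
  obtain ⟨hc, hc'⟩ := memLp_mixedConv hgm hM hbd
  obtain ⟨F, hF, hF', hrep⟩ := exists_fourier_L2 hc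
  refine ⟨F, hF, hF'.trans_le hc', Represents.congr_ae (fun ψ hψ x => ?_) hfg⟩
  have hcut := hC.isFreqCut hψ x
  have hcut1 := memLp_one_iff_integrable.1 (hcut.memLp 1)
  have e := hrep _ hcut1 (hcut.memLp 2)
  rw [← integral_mul_fourier_mixedWeight h₁ h₂ hgm hM hbd hcut1 (hcut.memLp 2)] at e
  simp only [kernelOp, kern_eq_fourier hn, oscOp]
  -- The weight is split off the symbol; the quotient is the order-zero amplitude on which the `L²`
  -- bound rests.
  have e2 : (fun ξ => osc Φ σ x ξ * ψ ξ) = fun ξ => (mixedWeight ρ₁ ρ₂ ξ : ℂ) *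
      (osc Φ (fun x ξ => σ x ξ / (mixedWeight ρ₁ ρ₂ ξ : ℂ)) x ξ * ψ ξ) := by
    funext ξ
    have : (mixedWeight ρ₁ ρ₂ ξ : ℂ) ≠ 0 := Complex.ofReal_ne_zero.2 (mixedWeight_pos h₁ h₂ ξ).ne'
    unfold osc
    split_ifs
    · simp
    · field_simp
  rw [e2, e]
  congr 1
  funext ξ
  ring

/-- Since `ρ₁ + ρ₂ = ρ`, the lower bound on `ρ₁` becomes `ρ₂ < mρ/(n+m-1) ≤ m/2`, and symmetrically
for `ρ₁`. These are the ranges in which fractional integration into `L²` is available. -/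
theorem IsAdmissible.bounds (hn : 0 < n) (hm : 0 < m) (h : IsAdmissible n m ρ ρ₁ ρ₂) (hρ : 0 < ρ)
    (hρN : ρ ≤ ((n : ℝ) + m - 1) / 2) :
    0 < ρ₁ ∧ 2 * ρ₁ < n ∧ 0 < ρ₂ ∧ 2 * ρ₂ < m := by
  obtain ⟨h1, h2, h3⟩ := h.2 hρ
  have hn' : (1 : ℝ) ≤ n := by exact_mod_cast hn
  have hm' : (1 : ℝ) ≤ m := by exact_mod_cast hm
  have hN : (0 : ℝ) < (n : ℝ) + m - 1 := by linarith
  rw [div_mul_eq_mul_div, div_lt_iff₀ hN] at h1 h2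
  have a1 : 0 < ρ₁ := by
    by_contra hc
    have : 0 ≤ ((n : ℝ) - 1) * ρ := mul_nonneg (by linarith) hρ.le
    nlinarith
  have a2 : 0 < ρ₂ := by
    by_contra hc
    have : 0 ≤ ((m : ℝ) - 1) * ρ := mul_nonneg (by linarith) hρ.le
    nlinarith
  refine ⟨a1, ?_, a2, ?_⟩
  · by_contra hc
    push Not at hc
    nlinarith
  · by_contra hc
    push Not at hc
    nlinarith

theorem exists_mixed_estimate (hn : 0 < n) (hm : 0 < m) (hρ : 0 ≤ ρ)
    (hρN : ρ ≤ ((n : ℝ) + m - 1) / 2) (hadm : IsAdmissible n m ρ ρ₁ ρ₂) {φ : ℝ → ℂ}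
    (hφ : IsCutoff φ) (hΦ : IsPhase Φ) (hσ : IsSymbol ρ₁ ρ₂ σ) (hΦσ : IsNondegenerateOn Φ σ)
    {p₁ p₂ : ℝ} (hp₁ : ρ₁ / n = 1 / p₁ - 1 / 2) (hp₂ : ρ₂ / m = 1 / p₂ - 1 / 2) :
    ∃ C : ℝ≥0, ∀ f : RN n m → ℂ, MemMixed p₁ p₂ f →
      (∀ l : ℤ, ∃ g, IsNaturalL φ Φ σ l f g ∧ eLpNorm g 2 volume ≤ C * mixedNorm p₁ p₂ f) ∧
      (∃ g, IsSharp φ Φ σ f g ∧ eLpNorm g 2 volume ≤ C * mixedNorm p₁ p₂ f) ∧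
      (∃ g, IsFlat φ Φ σ f g ∧ eLpNorm g 2 volume ≤ C * mixedNorm p₁ p₂ f) := by
  obtain ⟨B, hB⟩ := hφ.exists_bound
  have hρ' : 0 ≤ ρ₁ ∧ 0 ≤ ρ₂ := by
    rcases hρ.eq_or_lt with h0 | h0
    · rw [(hadm.1 h0.symm).1, (hadm.1 h0.symm).2]; exact ⟨le_rfl, le_rfl⟩
    · have := hadm.bounds hn hm h0 hρN
      exact ⟨this.1.le, this.2.2.1.le⟩
  obtain ⟨C', hC'⟩ := (hσ.isAmplitude_self hρ'.1 hρ'.2 hΦσ).exists_isL2Op hΦ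
  have key : ∃ s : RN n m → RN n m → ℂ, ∃ C K : ℝ≥0, IsL2Op (osc Φ s) C ∧
      ∀ f, MemMixed p₁ p₂ f → ∃ F, MemLp F 2 volume ∧
        eLpNorm F 2 volume ≤ K * mixedNorm p₁ p₂ f ∧ Represents Φ σ s f F := by
    -- Order zero is separate because the potential kernels need positive orders. There both
    -- exponents equal 2, and the mixed norm is the `L²` norm.
    rcases hρ.eq_or_lt with h0 | h0
    · have two : ∀ {p : ℝ}, 0 = 1 / p - 1 / 2 → p = 2 := fun {p} h => by
        rw [← one_div_one_div p, show 1 / p = 1 / 2 by linarith, one_div_one_div]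
      rw [(hadm.1 h0.symm).1, zero_div] at hp₁
      rw [(hadm.1 h0.symm).2, zero_div] at hp₂
      rw [two hp₁, two hp₂]
      refine ⟨σ, C', 1, hC', fun f hf => ?_⟩
      have hf2 : MemLp f 2 volume := ⟨hf.1, by rw [← mixedNorm_two hf.1]; exact hf.2⟩
      obtain ⟨F, hF, hF', hr⟩ := hC'.exists_represents hn hf2
      refine ⟨F, hF, ?_, hr⟩
      rw [hF', mixedNorm_two hf.1, ENNReal.coe_one, one_mul]
    · obtain ⟨a1, a2, a3, a4⟩ := hadm.bounds hn hm h0 hρN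
      exact hσ.exists_represents_mixed hn a1 a2 a3 a4 hp₁ hp₂ hΦ hΦσ
  obtain ⟨s, C, K, hC, hrep⟩ := key
  refine ⟨C * (2 * B * (6 * B) + (7 * B + 1) * (6 * B)) * K, fun f hf => ?_⟩
  obtain ⟨F, hF, hF', hr⟩ := hrep f hf
  have bound : ∀ {D : ℝ≥0} {g : RN n m → ℂ}, D ≤ 2 * B * (6 * B) + (7 * B + 1) * (6 * B) →
      eLpNorm g 2 volume ≤ C * (D * eLpNorm F 2 volume) →
      eLpNorm g 2 volume ≤
        (C * (2 * B * (6 * B) + (7 * B + 1) * (6 * B)) * K : ℝ≥0) * mixedNorm p₁ p₂ f := by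
    intro D g hD hg
    rw [ENNReal.coe_mul, ENNReal.coe_mul, mul_assoc, mul_assoc]
    refine hg.trans (mul_le_mul_right (mul_le_mul' (ENNReal.coe_le_coe.2 hD) hF') _)
  refine ⟨fun l => ?_, ?_, ?_⟩
  · obtain ⟨g, h1, h2⟩ := hr.exists_isNaturalL hφ hB hC hF l
    exact ⟨g, h1, bound le_self_add h2⟩
  · obtain ⟨g, h1, h2⟩ := hr.exists_isSharp hn hφ hB hC hC' hF
    exact ⟨g, h1, bound le_add_self h2⟩
  · obtain ⟨g, h1, h2⟩ := hr.exists_isFlat hn hφ hB hC hC' hF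
    exact ⟨g, h1, bound le_add_self h2⟩

/-! ### Adjoint operators -/

/-- The adjoint of `oscOp`. -/
def adjOsc (a : RN n m → RN n m → ℂ) (g : RN n m → ℂ) (ξ : RN n m) : ℂ :=
  ∫ y, g y * (starRingEnd ℂ) (a y ξ)

theorem aestronglyMeasurable_adjOsc {a : RN n m → RN n m → ℂ} (ha : Measurable (Function.uncurry a))
    {g : RN n m → ℂ} (hg : AEStronglyMeasurable g volume) :
    AEStronglyMeasurable (adjOsc a g) volume := by
  refine AEStronglyMeasurable.integral_prod_right'
    (f := fun q : RN n m × RN n m => g q.2 * (starRingEnd ℂ) (a q.2 q.1)) ?_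
  exact hg.comp_snd.mul (Complex.continuous_conj.measurable.comp
    (ha.comp measurable_swap)).aestronglyMeasurable

section Adjoint

variable {a : RN n m → RN n m → ℂ} {C : ℝ≥0}

theorem IsL2Op.integrable_adj (ha : IsL2Op a C) {g : RN n m → ℂ} (hg : Integrable g)
    (ξ : RN n m) : Integrable fun y => g y * (starRingEnd ℂ) (a y ξ) := by
  obtain ⟨B, hB⟩ := ha.bounded
  refine hg.mul_bdd (c := B) ?_ (Eventually.of_forall fun y => ?_)
  · exact (Complex.continuous_conj.measurable.comp
      (ha.measurable.comp measurable_prodMk_right)).aestronglyMeasurable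
  · rw [RCLike.norm_conj]; exact hB y ξ

theorem IsL2Op.adjOsc_add (ha : IsL2Op a C) {g h : RN n m → ℂ} (hg : Integrable g)
    (hh : Integrable h) (ξ : RN n m) :
    adjOsc a (fun y => g y + h y) ξ = adjOsc a g ξ + adjOsc a h ξ := by
  unfold adjOsc
  rw [← integral_add (ha.integrable_adj hg ξ) (ha.integrable_adj hh ξ)]
  simp only [add_mul]

theorem IsL2Op.exists_norm_adjOsc_le (ha : IsL2Op a C) {g : RN n m → ℂ} (hg : Integrable g) :
    ∃ D : ℝ, ∀ ξ, ‖adjOsc a g ξ‖ ≤ D := by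
  obtain ⟨B, hB⟩ := ha.bounded
  refine ⟨∫ y, ‖g y‖ * B, fun ξ => ?_⟩
  refine (norm_integral_le_integral_norm _).trans
    (integral_mono (ha.integrable_adj hg ξ).norm (hg.norm.mul_const B) fun y => ?_)
  simp only [norm_mul, RCLike.norm_conj]
  exact mul_le_mul_of_nonneg_left (hB y ξ) (norm_nonneg _)

/-- The duality between `oscOp` and `adjOsc`. -/
theorem IsL2Op.integral_mul_conj_adjOsc (ha : IsL2Op a C) {g h : RN n m → ℂ} (hg : Integrable g)
    (hh : Integrable h) :
    ∫ ξ, h ξ * (starRingEnd ℂ) (adjOsc a g ξ) = ∫ y, (starRingEnd ℂ) (g y) * oscOp a h y := by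
  obtain ⟨B, hB⟩ := ha.bounded
  have hint : Integrable (Function.uncurry fun ξ y : RN n m =>
      h ξ * ((starRingEnd ℂ) (g y) * a y ξ)) (volume.prod volume) := by
    have h1 : Integrable (fun q : RN n m × RN n m => h q.1 * (starRingEnd ℂ) (g q.2))
        (volume.prod volume) := hh.mul_prod (Complex.conjCLE.toContinuousLinearMap.integrable_comp hg)
    refine (h1.mul_bdd (c := B) (ha.measurable.comp measurable_swap).aestronglyMeasurable
      (Eventually.of_forall fun q => hB _ _)).congr (Eventually.of_forall fun q => ?_)
    simp only [Function.uncurry, Function.comp_apply, Prod.fst_swap, Prod.snd_swap]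
    ring
  simp only [adjOsc, ← integral_conj, map_mul, Complex.conj_conj, ← integral_const_mul, oscOp]
  rw [integral_integral_swap hint]
  refine integral_congr_ae (Eventually.of_forall fun y => ?_)
  refine integral_congr_ae (Eventually.of_forall fun ξ => ?_)
  simp only
  ring

/-- Duality tested on `adjOsc a g` itself: `‖h‖² ≤ C ‖g‖ ‖h‖` for its truncation `h` to a ball.
Truncation makes `‖h‖` finite, so it can be divided out, and the balls then exhaust the space. -/
theorem IsL2Op.lintegral_sq_adjOsc_le (ha : IsL2Op a C) {g : RN n m → ℂ} (hg : Integrable g) :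
    ∫⁻ ξ, ‖adjOsc a g ξ‖ₑ ^ 2 ≤ C ^ 2 * ∫⁻ y, ‖g y‖ₑ ^ 2 := by
  classical
  have hS := aestronglyMeasurable_adjOsc ha.measurable hg.1
  obtain ⟨D, hD⟩ := ha.exists_norm_adjOsc_le hg
  have key : ∀ R : ℝ, ∫⁻ ξ in Metric.closedBall 0 R, ‖adjOsc a g ξ‖ₑ ^ 2 ≤
      C ^ 2 * ∫⁻ y, ‖g y‖ₑ ^ 2 := by
    intro R
    have hb : MeasurableSet (Metric.closedBall (0 : RN n m) R) := measurableSet_closedBall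
    have hfin : volume (Metric.closedBall (0 : RN n m) R) ≠ ⊤ := measure_closedBall_lt_top.ne
    set h : RN n m → ℂ := (Metric.closedBall 0 R).indicator (adjOsc a g) with hh
    have mem : ∀ p, MemLp h p volume := fun p => by
      rw [hh, memLp_indicator_iff_restrict hb]
      have : IsFiniteMeasure (volume.restrict (Metric.closedBall (0 : RN n m) R)) :=
        ⟨by rw [Measure.restrict_apply_univ]; exact hfin.lt_top⟩
      exact MemLp.of_bound hS.restrict D (Eventually.of_forall hD)
    have h1 : Integrable h := memLp_one_iff_integrable.1 (mem 1)
    have hsq : ∀ ξ, h ξ * (starRingEnd ℂ) (adjOsc a g ξ) = ((‖h ξ‖ ^ 2 : ℝ) : ℂ) := fun ξ => by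
      rw [hh, Set.indicator_apply]
      split_ifs
      · rw [Complex.mul_conj, Complex.normSq_eq_norm_sq]
      · simp
    have e1 : ‖∫ ξ, h ξ * (starRingEnd ℂ) (adjOsc a g ξ)‖ₑ = eLpNorm h 2 volume ^ 2 := by
      have h0 : 0 ≤ ∫ ξ, ‖h ξ‖ ^ 2 := integral_nonneg fun ξ => by positivity
      simp only [hsq]
      rw [integral_complex_ofReal, ← ofReal_norm, Complex.norm_real, Real.norm_of_nonneg h0,
        ofReal_integral_eq_lintegral_ofReal ((mem (2 : ℕ)).integrable_norm_pow two_ne_zero)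
          (Eventually.of_forall fun ξ => by positivity),
        sq_eLpNorm_two]
      refine lintegral_congr fun ξ => ?_
      rw [ENNReal.ofReal_pow (norm_nonneg _), ofReal_norm]
    have e2 : eLpNorm h 2 volume ^ 2 ≤ C * eLpNorm g 2 volume * eLpNorm h 2 volume := by
      rw [← e1, ha.integral_mul_conj_adjOsc hg h1]
      calc _ ≤ ∫⁻ y, ‖g y‖ₑ * ‖oscOp a h y‖ₑ := by
            refine (enorm_integral_le_lintegral_enorm _).trans (le_of_eq ?_)
            refine lintegral_congr fun y => ?_
            rw [enorm_mul, ← ofReal_norm, RCLike.norm_conj, ofReal_norm]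
        _ ≤ (∫⁻ y, ‖g y‖ₑ ^ 2) ^ (1 / 2 : ℝ) * (∫⁻ y, ‖oscOp a h y‖ₑ ^ 2) ^ (1 / 2 : ℝ) :=
            lintegral_mul_sq_le _ hg.1.enorm (ha.memLp (mem 2) h1).1.enorm
        _ = eLpNorm g 2 volume * eLpNorm (oscOp a h) 2 volume := by
            rw [← sq_eLpNorm_two, ← sq_eLpNorm_two, ← ENNReal.rpow_natCast, ← ENNReal.rpow_natCast,
              ← ENNReal.rpow_mul, ← ENNReal.rpow_mul]
            norm_num
        _ ≤ eLpNorm g 2 volume * (C * eLpNorm h 2 volume) := by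
            gcongr
            exact ha.bound _ (mem 2) h1
        _ = _ := by ring
    have e3 : eLpNorm h 2 volume ≤ C * eLpNorm g 2 volume := by
      rcases eq_or_ne (eLpNorm h 2 volume) 0 with h0 | h0
      · rw [h0]; exact zero_le
      · rw [sq] at e2
        exact (ENNReal.mul_le_mul_iff_left h0 (mem 2).2.ne).1 e2
    rw [← lintegral_indicator hb, ← sq_eLpNorm_two, ← mul_pow]
    refine le_trans (le_of_eq ?_) (pow_le_pow_left₀ zero_le e3 2)
    rw [sq_eLpNorm_two]
    refine lintegral_congr fun ξ => ?_
    rw [hh, Set.indicator_apply, Set.indicator_apply]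
    split_ifs <;> simp
  have hcov := aecover_closedBall (μ := (volume : Measure (RN n m))) (x := 0)
    (r := fun k : ℕ => (k : ℝ)) tendsto_natCast_atTop_atTop
  exact le_of_tendsto' (hcov.lintegral_tendsto_of_countably_generated (hS.enorm.pow_const 2))
    fun k => key k

end Adjoint

/-! ### Adjoint operators as Fourier multipliers, and interpolation over dyadic levels. -/

/-- The kernel of the inverse Fourier transform. -/
def expKer (x ξ : RN n m) : ℂ := Complex.exp (((2 * Real.pi * inner ℝ ξ x : ℝ) : ℂ) * Complex.I)

theorem continuous_expKer : Continuous (Function.uncurry (expKer : RN n m → RN n m → ℂ)) := by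
  unfold expKer Function.uncurry
  fun_prop

open FourierTransform in
theorem isL2Op_expKer : IsL2Op (expKer : RN n m → RN n m → ℂ) 1 where
  measurable := continuous_expKer.measurable
  bounded := ⟨1, fun x ξ => (Complex.norm_exp_ofReal_mul_I _).le⟩
  bound g hg hg1 := by
    have e : oscOp expKer g = 𝓕 g ∘ fun x => -x := by
      funext x
      simp only [Function.comp_apply, Real.fourier_eq', oscOp, expKer, smul_eq_mul, inner_neg_right]
      refine integral_congr_ae (Eventually.of_forall fun ξ => ?_)
      simp only
      congr 3
      ring_nf
    rw [e, eLpNorm_comp_measurePreserving _ (Measure.measurePreserving_neg volume),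
      eLpNorm_fourier_eq hg1 hg, ENNReal.coe_one, one_mul]
    exact (VectorFourier.fourierIntegral_continuous Real.continuous_fourierChar
      (by exact continuous_inner) hg1).aestronglyMeasurable

open FourierTransform in
-- In the adjoint, the cut-off acts after `adjOsc` and before an inverse Fourier transform. By
-- Plancherel, only the `L²` norm of `adjOsc` on the support of the cut-offs matters.
theorem adjointOp_kern_eq (hn : 0 < n) {Φ : RN n m → RN n m → ℝ} {σ : RN n m → RN n m → ℂ}
    {C : ℝ≥0} (ha : IsL2Op (osc Φ σ) C) {f : RN n m → ℂ} (hf : Integrable f) {ψ : RN n m → ℂ}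
    (hψ : IsFreqCut ψ) (x : RN n m) :
    adjointOp (kern Φ σ ψ) f x =
      oscOp expKer (fun ξ => (starRingEnd ℂ) (ψ ξ) * adjOsc (osc Φ σ) f ξ) x := by
  obtain ⟨B, hB⟩ := ha.bounded
  have hψ1 : Integrable ψ := memLp_one_iff_integrable.1 (hψ.memLp 1)
  have hint : Integrable (Function.uncurry fun y ξ : RN n m =>
      f y * (expKer x ξ * ((starRingEnd ℂ) (osc Φ σ y ξ) * (starRingEnd ℂ) (ψ ξ))))
      (volume.prod volume) := by
    have h1 : Integrable (fun q : RN n m × RN n m => f q.1 * (starRingEnd ℂ) (ψ q.2))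
        (volume.prod volume) := hf.mul_prod (Complex.conjCLE.toContinuousLinearMap.integrable_comp hψ1)
    have h2 : Measurable fun q : RN n m × RN n m =>
        expKer x q.2 * (starRingEnd ℂ) (osc Φ σ q.1 q.2) :=
      ((continuous_expKer.comp (Continuous.prodMk_right x)).measurable.comp measurable_snd).mul
        (Complex.continuous_conj.measurable.comp ha.measurable)
    refine (h1.mul_bdd (c := B) h2.aestronglyMeasurable
      (Eventually.of_forall fun q => ?_)).congr (Eventually.of_forall fun q => ?_)
    · rw [norm_mul, RCLike.norm_conj, expKer, Complex.norm_exp_ofReal_mul_I, one_mul]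
      exact hB _ _
    · simp only [Function.uncurry]
      ring
  have e1 : ∀ y, (starRingEnd ℂ) (kern Φ σ ψ y x) =
      ∫ ξ, expKer x ξ * ((starRingEnd ℂ) (osc Φ σ y ξ) * (starRingEnd ℂ) (ψ ξ)) := fun y => by
    rw [kern_eq_fourier hn, Real.fourier_eq', ← integral_conj]
    refine integral_congr_ae (Eventually.of_forall fun ξ => ?_)
    simp only [smul_eq_mul, map_mul, ← Complex.exp_conj, Complex.conj_ofReal, Complex.conj_I, expKer]
    congr 2
    push_cast
    ring
  simp only [adjointOp, e1, oscOp, ← integral_const_mul, adjOsc]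
  rw [integral_integral_swap hint]
  refine integral_congr_ae (Eventually.of_forall fun ξ => ?_)
  refine integral_congr_ae (Eventually.of_forall fun y => ?_)
  simp only
  ring

/-- Summation over dyadic levels of quantities that are controlled both in `L¹` and in `L²`. -/
theorem exists_tsum_le_of_levels {X : Type*} [MeasurableSpace X] {A : ℝ≥0} (hA : 1 < A) {s : ℝ}
    (hs : 0 < s) (hs1 : s < 1) :
    ∃ C : ℝ≥0, ∀ (μ : Measure X) (u : X → ℝ≥0∞), Measurable u →
      ∀ (β v : ℝ≥0), v ≠ 0 → ∀ Q : ℕ → ℝ≥0∞,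
      (∀ (k : ℕ) (h : ℝ≥0), Q k ≤ β * (v * ((((A ^ s) ^ k : ℝ≥0) : ℝ≥0∞) *
        ∫⁻ x in {x | (h : ℝ≥0∞) < u x}, u x ∂μ) ^ 2 + (((A ^ (-(1 - s))) ^ k : ℝ≥0) : ℝ≥0∞) *
          ∫⁻ x in {x | u x ≤ (h : ℝ≥0∞)}, u x ^ 2 ∂μ)) →
      ∑' k, Q k ≤ C * β * (v : ℝ≥0∞) ^ (2 / (1 + s) - 1) *
        (∫⁻ x, u x ^ (1 + s) ∂μ) ^ (2 / (1 + s)) := by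
  obtain ⟨C₁, h₁⟩ := exists_tsum_setLIntegral_lt_le (X := X) hA hs
  obtain ⟨C₂, h₂⟩ := exists_tsum_setLIntegral_le_le (X := X) hA hs hs1
  refine ⟨C₁ ^ 2 + C₂ + 1, fun μ u hu β v hv Q hQ => ?_⟩
  have hp : 0 < 1 + s := by linarith
  have hvE : (v : ℝ≥0∞) ≠ 0 := ENNReal.coe_ne_zero.2 hv
  set M := ∫⁻ x, u x ^ (1 + s) ∂μ with hM
  -- the estimate at a given scale
  have main : ∀ κ : ℝ≥0, κ ≠ 0 → ∑' k, Q k ≤ κ ^ 2 * β *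
      (v * (C₁ * ((κ : ℝ≥0∞) ^ (-(1 + s)) * M)) ^ 2 + C₂ * ((κ : ℝ≥0∞) ^ (-(1 + s)) * M)) := by
    intro κ hκ
    have hκE : (κ : ℝ≥0∞) ≠ 0 := ENNReal.coe_ne_zero.2 hκ
    set g : X → ℝ≥0∞ := fun x => (κ : ℝ≥0∞)⁻¹ * u x with hg
    have mg : Measurable g := hu.const_mul _
    have hug : ∀ x, u x = κ * g x := fun x => by
      rw [hg, ← mul_assoc, ENNReal.mul_inv_cancel hκE ENNReal.coe_ne_top, one_mul]
    have hgM : ∫⁻ x, g x ^ (1 + s) ∂μ = (κ : ℝ≥0∞) ^ (-(1 + s)) * M := by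
      simp only [hg, ENNReal.mul_rpow_of_nonneg _ _ hp.le]
      rw [lintegral_const_mul _ (hu.pow_const _), ENNReal.inv_rpow, ENNReal.rpow_neg]
    have e1 : ∀ k : ℕ, ∫⁻ x in {x | ((κ * A ^ k : ℝ≥0) : ℝ≥0∞) < u x}, u x ∂μ =
        κ * ∫⁻ x in {x | ((A ^ k : ℝ≥0) : ℝ≥0∞) < g x}, g x ∂μ := fun k => by
      rw [← lintegral_const_mul _ mg]
      simp only [hug, ENNReal.coe_mul, ENNReal.mul_lt_mul_iff_right hκE ENNReal.coe_ne_top]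
    have e2 : ∀ k : ℕ, ∫⁻ x in {x | u x ≤ ((κ * A ^ k : ℝ≥0) : ℝ≥0∞)}, u x ^ 2 ∂μ =
        κ ^ 2 * ∫⁻ x in {x | g x ≤ ((A ^ k : ℝ≥0) : ℝ≥0∞)}, g x ^ 2 ∂μ := fun k => by
      rw [← lintegral_const_mul _ (mg.pow_const 2)]
      simp only [hug, ENNReal.coe_mul, ENNReal.mul_le_mul_iff_right hκE ENNReal.coe_ne_top, mul_pow]
    have f1 := h₁ μ g mg
    have f2 := h₂ μ g mg
    rw [hgM] at f1 f2
    calc ∑' k, Q k ≤ ∑' k, κ ^ 2 * β * (v * ((((A ^ s) ^ k : ℝ≥0) : ℝ≥0∞) *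
          ∫⁻ x in {x | ((A ^ k : ℝ≥0) : ℝ≥0∞) < g x}, g x ∂μ) ^ 2 +
          (((A ^ (-(1 - s))) ^ k : ℝ≥0) : ℝ≥0∞) *
            ∫⁻ x in {x | g x ≤ ((A ^ k : ℝ≥0) : ℝ≥0∞)}, g x ^ 2 ∂μ) := by
          -- The hypothesis holds for every height; the height `κ A^k` is the one that makes both
          -- sums over levels converge.
          refine ENNReal.tsum_le_tsum fun k => (hQ k (κ * A ^ k)).trans (le_of_eq ?_)
          rw [e1, e2]
          ring
      _ = κ ^ 2 * β * (v * ∑' k, ((((A ^ s) ^ k : ℝ≥0) : ℝ≥0∞) *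
          ∫⁻ x in {x | ((A ^ k : ℝ≥0) : ℝ≥0∞) < g x}, g x ∂μ) ^ 2 +
          ∑' k, (((A ^ (-(1 - s))) ^ k : ℝ≥0) : ℝ≥0∞) *
            ∫⁻ x in {x | g x ≤ ((A ^ k : ℝ≥0) : ℝ≥0∞)}, g x ^ 2 ∂μ) := by
          rw [ENNReal.tsum_mul_left, ENNReal.tsum_add, ENNReal.tsum_mul_left]
      _ ≤ _ := by
          gcongr
          exact (tsum_sq_le_sq_tsum _).trans (by gcongr)
  have hr : 0 < 2 / (1 + s) := by positivity
  rcases eq_or_ne M 0 with h0 | h0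
  · refine (main 1 one_ne_zero).trans ?_
    rw [h0]
    simp
  rcases eq_or_ne β 0 with hβ | hβ
  · refine (main 1 one_ne_zero).trans ?_
    rw [hβ]
    simp
  rcases eq_or_ne M ⊤ with ht | ht
  · rw [ht, ENNReal.top_rpow_of_pos hr, ENNReal.mul_top]
    · exact le_top
    · refine mul_ne_zero (mul_ne_zero ?_ (ENNReal.coe_ne_zero.2 hβ)) ?_
      · exact ENNReal.coe_ne_zero.2 (by positivity)
      · rw [Ne, ENNReal.rpow_eq_zero_iff]
        simp [hv]
  lift M to ℝ≥0 using ht with N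
  have hN0 : N ≠ 0 := fun h => h0 (by rw [h]; rfl)
  -- This scale makes `κ^{-(1+s)} M` equal to `1/v`, which balances the `L¹` and `L²` contributions.
  set κ : ℝ≥0 := (N * v) ^ (1 / (1 + s)) with hκ
  have hNv : N * v ≠ 0 := mul_ne_zero hN0 hv
  have hκ0 : κ ≠ 0 := by
    rw [hκ, Ne, NNReal.rpow_eq_zero_iff]
    exact fun h => hNv h.1
  have hκN : (κ : ℝ≥0∞) ^ (-(1 + s)) * N = ((v⁻¹ : ℝ≥0) : ℝ≥0∞) := by
    rw [← ENNReal.coe_rpow_of_ne_zero hκ0, ← ENNReal.coe_mul, hκ, ← NNReal.rpow_mul,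
      show 1 / (1 + s) * -(1 + s) = -1 by field_simp, NNReal.rpow_neg_one]
    congr 1
    field_simp
  refine (main κ hκ0).trans ?_
  rw [hκN]
  have hκ2 : κ ^ 2 = N ^ (2 / (1 + s)) * v ^ (2 / (1 + s)) := by
    rw [hκ, ← NNReal.rpow_natCast, ← NNReal.rpow_mul, ← NNReal.mul_rpow]
    congr 1
    push_cast
    ring
  rw [← ENNReal.coe_rpow_of_ne_zero hv, ← ENNReal.coe_rpow_of_ne_zero hN0]
  norm_cast
  rw [hκ2, NNReal.rpow_sub hv, NNReal.rpow_one]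
  calc N ^ (2 / (1 + s)) * v ^ (2 / (1 + s)) * β * (v * (C₁ * v⁻¹) ^ 2 + C₂ * v⁻¹)
      = (C₁ ^ 2 + C₂) * β * (v ^ (2 / (1 + s)) / v) * N ^ (2 / (1 + s)) := by
        field_simp
    _ ≤ _ := mul_le_mul' (mul_le_mul' (mul_le_mul' le_self_add le_rfl) le_rfl) le_rfl

/-! ### The supports of the frequency cut-offs -/

/-- The intersection of the cone of index `l` with the shell of index `k`. -/
def coneShell (l : ℤ) (k : ℕ) : Set (RN n m) :=
  {ξ | ((2 : ℝ) ^ (l - 1) < ‖fstPart ξ‖ / ‖sndPart ξ‖ ∧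
    ‖fstPart ξ‖ / ‖sndPart ξ‖ ≤ (2 : ℝ) ^ (l + 1)) ∧
      ((2 : ℝ) ^ ((k : ℤ) - 1) < ‖ξ‖ ∧ ‖ξ‖ ≤ (2 : ℝ) ^ ((k : ℤ) + 1))}

theorem measurableSet_coneShell (l : ℤ) (k : ℕ) : MeasurableSet (coneShell l k : Set (RN n m)) := by
  have h1 : Measurable fun ξ : RN n m => ‖fstPart ξ‖ / ‖sndPart ξ‖ :=
    measurable_fstPart.norm.div measurable_sndPart.norm
  exact ((measurableSet_lt measurable_const h1).inter (measurableSet_le h1 measurable_const)).inter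
    ((measurableSet_lt measurable_const measurable_norm).inter
      (measurableSet_le measurable_norm measurable_const))

/-- The aperture of the cone of index `l`, from the `λ`-plane. -/
def aperture (l : ℤ) : ℝ≥0 := 2 ^ (min l 0)

theorem aperture_pos (l : ℤ) : 0 < aperture l := by
  unfold aperture
  positivity

theorem norm_le_norm_fstPart_add (ξ : RN n m) : ‖ξ‖ ≤ ‖fstPart ξ‖ + ‖sndPart ξ‖ := by
  have h : ‖ξ‖ ^ 2 = ‖fstPart ξ‖ ^ 2 + ‖sndPart ξ‖ ^ 2 := by
    simp [EuclideanSpace.norm_sq_eq, fstPart, sndPart]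
  refine abs_le_of_sq_le_sq' ?_ (by positivity) |>.2
  nlinarith [mul_nonneg (norm_nonneg (fstPart ξ)) (norm_nonneg (sndPart ξ))]

theorem norm_fstPart_le (ξ : RN n m) : ‖fstPart ξ‖ ≤ ‖ξ‖ := by
  refine abs_le_of_sq_le_sq' ?_ (norm_nonneg _) |>.2
  have h : ‖ξ‖ ^ 2 = ‖fstPart ξ‖ ^ 2 + ‖sndPart ξ‖ ^ 2 := by
    simp [EuclideanSpace.norm_sq_eq, fstPart, sndPart]
  nlinarith [sq_nonneg ‖sndPart ξ‖]

theorem norm_sndPart_le (ξ : RN n m) : ‖sndPart ξ‖ ≤ ‖ξ‖ := by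
  refine abs_le_of_sq_le_sq' ?_ (norm_nonneg _) |>.2
  have h : ‖ξ‖ ^ 2 = ‖fstPart ξ‖ ^ 2 + ‖sndPart ξ‖ ^ 2 := by
    simp [EuclideanSpace.norm_sq_eq, fstPart, sndPart]
  nlinarith [sq_nonneg ‖fstPart ξ‖]

/-- Two comparable numbers are comparable with multiples of their maximum. -/
theorem ratio_bounds {a b r : ℝ} {l : ℤ} (ha : 0 ≤ a) (hb : 0 < b) (har : a ≤ r) (hrab : r ≤ a + b)
    (h1 : (2 : ℝ) ^ (l - 1) * b ≤ a) (h2 : a ≤ (2 : ℝ) ^ (l + 1) * b) (hbr : b ≤ r) :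
    a ≤ 2 * (aperture l * r) ∧ aperture l * r ≤ 4 * a := by
  have hr : 0 ≤ r := ha.trans har
  rw [zpow_sub_one₀ two_ne_zero] at h1
  rw [zpow_add_one₀ two_ne_zero] at h2
  rcases le_total l 0 with h | h
  · have e : ((aperture l : ℝ≥0) : ℝ) = (2 : ℝ) ^ l := by
      simp [aperture, min_eq_left h]
    have e1 : (2 : ℝ) ^ l ≤ 1 := zpow_le_one_of_nonpos₀ one_le_two h
    have e0 : (0 : ℝ) < 2 ^ l := by positivity
    rw [e]
    constructor <;> nlinarith
  · have e : ((aperture l : ℝ≥0) : ℝ) = 1 := by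
      simp [aperture, min_eq_right h]
    have e1 : (1 : ℝ) ≤ 2 ^ l := one_le_zpow₀ one_le_two h
    rw [e]
    constructor <;> nlinarith

/-- Up to constants, the larger of the two components has size `2^k` and the smaller `2^{k-|l|}`.
The bounds for `λ` are those for `τ` with the roles exchanged and `l` replaced by `-l`. -/
theorem coneShell_bounds {l : ℤ} {k : ℕ} {ξ : RN n m} (h : ξ ∈ (coneShell l k : Set (RN n m))) :
    (‖fstPart ξ‖ ≤ 4 * (aperture l * 2 ^ k) ∧ aperture l * 2 ^ k ≤ 8 * ‖fstPart ξ‖) ∧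
    (‖sndPart ξ‖ ≤ 4 * (aperture (-l) * 2 ^ k) ∧ aperture (-l) * 2 ^ k ≤ 8 * ‖sndPart ξ‖) := by
  obtain ⟨⟨h1, h2⟩, h3, h4⟩ := h
  -- If `λ = 0` the quotient is zero by convention, which contradicts its positive lower bound.
  have hb : 0 < ‖sndPart ξ‖ := by
    rcases (norm_nonneg (sndPart ξ)).eq_or_lt with h0 | h0
    · rw [← h0, div_zero] at h1
      exact absurd h1 (by positivity : (0 : ℝ) ≤ 2 ^ (l - 1)).not_gt
    · exact h0
  rw [lt_div_iff₀ hb] at h1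
  rw [div_le_iff₀ hb] at h2
  have ha : 0 < ‖fstPart ξ‖ := lt_trans (by positivity) h1
  have h1' : ‖sndPart ξ‖ ≤ (2 : ℝ) ^ (-l + 1) * ‖fstPart ξ‖ := by
    rw [show -l + 1 = -(l - 1) by ring, zpow_neg, ← div_eq_inv_mul, le_div_iff₀ (by positivity),
      mul_comm]
    exact h1.le
  rw [zpow_sub_one₀ two_ne_zero, zpow_natCast] at h3
  rw [zpow_add_one₀ two_ne_zero, zpow_natCast] at h4
  have p1 : (0 : ℝ) < aperture l := aperture_pos l
  have p2 : (0 : ℝ) < aperture (-l) := aperture_pos (-l)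
  have a1 := norm_fstPart_le ξ
  have a2 := norm_sndPart_le ξ
  have a3 := norm_le_norm_fstPart_add ξ
  obtain ⟨b1, b2⟩ := ratio_bounds ha.le hb a1 a3 h1.le h2 a2
  have h2' : (2 : ℝ) ^ (-l - 1) * ‖fstPart ξ‖ ≤ ‖sndPart ξ‖ := by
    rw [show -l - 1 = -(l + 1) by ring, zpow_neg, ← div_eq_inv_mul, div_le_iff₀ (by positivity),
      mul_comm]
    exact h2
  obtain ⟨b3, b4⟩ := ratio_bounds hb.le ha a2 (by linarith) h2' h1' a1
  refine ⟨⟨?_, ?_⟩, ?_, ?_⟩ <;> nlinarith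

/-! ### Estimates for the adjoint operators -/

theorem exists_volume_coneShell_le : ∃ V : ℝ≥0, ∀ (l : ℤ) (k : ℕ),
    volume (coneShell l k : Set (RN n m)) ≤
      ((V * ((aperture l * 2 ^ k) ^ n * (aperture (-l) * 2 ^ k) ^ m) : ℝ≥0) : ℝ≥0∞) := by
  set V₁ := volume (Metric.closedBall (0 : EuclideanSpace ℝ (Fin n)) 1) with hV₁
  set V₂ := volume (Metric.closedBall (0 : EuclideanSpace ℝ (Fin m)) 1) with hV₂
  have h₁ : V₁ ≠ ⊤ := measure_closedBall_lt_top.ne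
  have h₂ : V₂ ≠ ⊤ := measure_closedBall_lt_top.ne
  lift V₁ to ℝ≥0 using h₁ with v₁
  lift V₂ to ℝ≥0 using h₂ with v₂
  refine ⟨4 ^ n * v₁ * (4 ^ m * v₂), fun l k => ?_⟩
  set r₁ : ℝ≥0 := 4 * (aperture l * 2 ^ k) with hr₁
  set r₂ : ℝ≥0 := 4 * (aperture (-l) * 2 ^ k) with hr₂
  have hsub : (coneShell l k : Set (RN n m)) ⊆ joinEquiv.symm ⁻¹'
      (Metric.closedBall (0 : EuclideanSpace ℝ (Fin n)) r₁ ×ˢ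
        Metric.closedBall (0 : EuclideanSpace ℝ (Fin m)) r₂) := by
    intro ξ hξ
    obtain ⟨⟨h1, -⟩, h2, -⟩ := coneShell_bounds hξ
    refine Set.mem_preimage.2 (Set.mem_prod.2 ⟨?_, ?_⟩)
    · rw [mem_closedBall_zero_iff, hr₁]
      push_cast
      exact h1
    · rw [mem_closedBall_zero_iff, hr₂]
      push_cast
      exact h2
  refine (measure_mono hsub).trans (le_of_eq ?_)
  rw [measurePreserving_joinEquiv.symm.measure_preimage_equiv, Measure.volume_eq_prod,
    Measure.prod_prod, Measure.addHaar_closedBall' _ _ r₁.coe_nonneg,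
    Measure.addHaar_closedBall' _ _ r₂.coe_nonneg, ← hV₁, ← hV₂]
  simp only [finrank_euclideanSpace, Fintype.card_fin]
  rw [← NNReal.coe_pow, ← NNReal.coe_pow, ENNReal.ofReal_coe_nnreal, ENNReal.ofReal_coe_nnreal]
  rw [hr₁, hr₂]
  push_cast
  ring

section

variable {ρ ρ₁ ρ₂ : ℝ} {σ : RN n m → RN n m → ℂ} {Φ : RN n m → RN n m → ℝ}

/-- The size of a symbol on `coneShell l k`. -/
def shellWeight (ρ₁ ρ₂ : ℝ) (l : ℤ) (k : ℕ) : ℝ≥0 :=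
  (8 / (aperture l * 2 ^ k)) ^ ρ₁ * (8 / (aperture (-l) * 2 ^ k)) ^ ρ₂

theorem symbolWeight_le_shellWeight (h₁ : 0 ≤ ρ₁) (h₂ : 0 ≤ ρ₂) {l : ℤ} {k : ℕ} {ξ : RN n m}
    (h : ξ ∈ (coneShell l k : Set (RN n m))) : symbolWeight ρ₁ ρ₂ ξ ≤ shellWeight ρ₁ ρ₂ l k := by
  obtain ⟨⟨-, h3⟩, -, h4⟩ := coneShell_bounds h
  have p1 : (0 : ℝ) < aperture l := aperture_pos l
  have p2 : (0 : ℝ) < aperture (-l) := aperture_pos (-l)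
  have key : ∀ {a t : ℝ}, 0 < a → 0 ≤ t → a ≤ 8 * t → 1 / (1 + t) ≤ 8 / a := fun ha ht h => by
    rw [div_le_div_iff₀ (by positivity) ha]
    linarith
  rw [symbolWeight, shellWeight]
  push_cast
  exact mul_le_mul
    (Real.rpow_le_rpow (by positivity) (key (by positivity) (norm_nonneg _) h3) h₁)
    (Real.rpow_le_rpow (by positivity) (key (by positivity) (norm_nonneg _) h4) h₂)
    (by positivity) (by positivity)

theorem IsSymbol.exists_norm_osc_le (hσ : IsSymbol ρ₁ ρ₂ σ) (Φ : RN n m → RN n m → ℝ) :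
    ∃ B : ℝ≥0, ∀ y ξ, ‖osc Φ σ y ξ‖ ≤ B * symbolWeight ρ₁ ρ₂ ξ := by
  obtain ⟨B, hB⟩ := hσ.bound_left 0 Fin.elim0
  refine ⟨B.toNNReal, fun y ξ => (norm_osc_le y ξ).trans ?_⟩
  have := hB y ξ
  rw [iteratedFDeriv_zero_apply] at this
  refine this.trans (mul_le_mul_of_nonneg_right (Real.le_coe_toNNReal B) (symbolWeight_pos _ _ _).le)

/-- The integral `adjOsc` is pointwise at most the size of the symbol times the `L¹` norm; squaring
and integrating costs the volume of the region. -/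
theorem IsSymbol.exists_setLIntegral_adjOsc_le_L1 (hσ : IsSymbol ρ₁ ρ₂ σ) (h₁ : 0 ≤ ρ₁)
    (h₂ : 0 ≤ ρ₂) (Φ : RN n m → RN n m → ℝ) : ∃ D : ℝ≥0, ∀ (l : ℤ) (k : ℕ) (g : RN n m → ℂ),
      Measurable g → ∫⁻ ξ in coneShell l k, ‖adjOsc (osc Φ σ) g ξ‖ₑ ^ 2 ≤
        ((D * shellWeight ρ₁ ρ₂ l k ^ 2 * ((aperture l * 2 ^ k) ^ n * (aperture (-l) * 2 ^ k) ^ m)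
          : ℝ≥0) : ℝ≥0∞) * (∫⁻ y, ‖g y‖ₑ) ^ 2 := by
  obtain ⟨B, hB⟩ := hσ.exists_norm_osc_le Φ
  obtain ⟨V, hV⟩ := exists_volume_coneShell_le (n := n) (m := m)
  refine ⟨B ^ 2 * V, fun l k g hg => ?_⟩
  have hpt : ∀ ξ ∈ (coneShell l k : Set (RN n m)), ‖adjOsc (osc Φ σ) g ξ‖ₑ ^ 2 ≤
      (((B * shellWeight ρ₁ ρ₂ l k : ℝ≥0) : ℝ≥0∞) * ∫⁻ y, ‖g y‖ₑ) ^ 2 := by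
    intro ξ hξ
    gcongr
    rw [← lintegral_const_mul _ hg.enorm]
    refine (enorm_integral_le_lintegral_enorm _).trans (lintegral_mono fun y => ?_)
    rw [enorm_mul, mul_comm]
    gcongr
    rw [← ofReal_norm, RCLike.norm_conj, ← ENNReal.ofReal_coe_nnreal]
    refine ENNReal.ofReal_le_ofReal ((hB y ξ).trans ?_)
    push_cast
    gcongr
    exact symbolWeight_le_shellWeight h₁ h₂ hξ
  calc _ ≤ ∫⁻ _ in (coneShell l k : Set (RN n m)),
        (((B * shellWeight ρ₁ ρ₂ l k : ℝ≥0) : ℝ≥0∞) * ∫⁻ y, ‖g y‖ₑ) ^ 2 :=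
        setLIntegral_mono' (measurableSet_coneShell l k) hpt
    _ ≤ (((B * shellWeight ρ₁ ρ₂ l k : ℝ≥0) : ℝ≥0∞) * ∫⁻ y, ‖g y‖ₑ) ^ 2 *
          ((V * ((aperture l * 2 ^ k) ^ n * (aperture (-l) * 2 ^ k) ^ m) : ℝ≥0) : ℝ≥0∞) := by
        rw [setLIntegral_const]
        gcongr
        exact hV l k
    _ = _ := by
        push_cast
        ring

/-- The symbol divided by `symbolWeight` has order zero, so its adjoint is bounded on `L²`; the
weight depends on `ξ` only and leaves the `y`-integral as a factor. -/
theorem IsSymbol.exists_setLIntegral_adjOsc_le_L2 (hΦ : IsPhase Φ) (hσ : IsSymbol ρ₁ ρ₂ σ)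
    (hΦσ : IsNondegenerateOn Φ σ) (h₁ : 0 ≤ ρ₁) (h₂ : 0 ≤ ρ₂) :
    ∃ D : ℝ≥0, ∀ (l : ℤ) (k : ℕ) (g : RN n m → ℂ), Integrable g →
      ∫⁻ ξ in coneShell l k, ‖adjOsc (osc Φ σ) g ξ‖ₑ ^ 2 ≤
        ((D * shellWeight ρ₁ ρ₂ l k ^ 2 : ℝ≥0) : ℝ≥0∞) * ∫⁻ y, ‖g y‖ₑ ^ 2 := by
  obtain ⟨C, hC⟩ := (hσ.isAmplitude hΦσ (measurable_symbolWeight ρ₁ ρ₂) (symbolWeight_pos ρ₁ ρ₂)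
    (D := 1) fun ξ => (one_mul _).ge).exists_isL2Op hΦ
  set s : RN n m → RN n m → ℂ := fun x ξ => σ x ξ / (symbolWeight ρ₁ ρ₂ ξ : ℂ) with hs
  refine ⟨C ^ 2, fun l k g hg => ?_⟩
  have e : ∀ ξ, adjOsc (osc Φ σ) g ξ = (symbolWeight ρ₁ ρ₂ ξ : ℂ) * adjOsc (osc Φ s) g ξ := by
    intro ξ
    unfold adjOsc
    rw [← integral_const_mul]
    refine integral_congr_ae (Eventually.of_forall fun y => ?_)
    have hw : (symbolWeight ρ₁ ρ₂ ξ : ℂ) ≠ 0 :=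
      Complex.ofReal_ne_zero.2 (symbolWeight_pos ρ₁ ρ₂ ξ).ne'
    have : osc Φ σ y ξ = (symbolWeight ρ₁ ρ₂ ξ : ℂ) * osc Φ s y ξ := by
      unfold osc
      split_ifs
      · simp
      · simp only [hs]
        field_simp
    simp only [this, map_mul, Complex.conj_ofReal]
    ring
  calc _ ≤ ∫⁻ ξ in (coneShell l k : Set (RN n m)),
        ((shellWeight ρ₁ ρ₂ l k ^ 2 : ℝ≥0) : ℝ≥0∞) * ‖adjOsc (osc Φ s) g ξ‖ₑ ^ 2 := by
        refine setLIntegral_mono' (measurableSet_coneShell l k) fun ξ hξ => ?_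
        rw [e, enorm_mul, mul_pow, ENNReal.coe_pow]
        gcongr
        rw [← ofReal_norm, Complex.norm_real, Real.norm_of_nonneg (symbolWeight_pos _ _ _).le,
          ← ENNReal.ofReal_coe_nnreal]
        exact ENNReal.ofReal_le_ofReal (symbolWeight_le_shellWeight h₁ h₂ hξ)
    _ = ((shellWeight ρ₁ ρ₂ l k ^ 2 : ℝ≥0) : ℝ≥0∞) *
          ∫⁻ ξ in (coneShell l k : Set (RN n m)), ‖adjOsc (osc Φ s) g ξ‖ₑ ^ 2 :=
        lintegral_const_mul' _ _ ENNReal.coe_ne_top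
    _ ≤ ((shellWeight ρ₁ ρ₂ l k ^ 2 : ℝ≥0) : ℝ≥0∞) * (C ^ 2 * ∫⁻ y, ‖g y‖ₑ ^ 2) := by
        gcongr
        exact (setLIntegral_le_lintegral _ _).trans (hC.lintegral_sq_adjOsc_le hg)
    _ = _ := by
        push_cast
        ring

/-- The splitting of `f` at a height `h`. -/
theorem IsSymbol.exists_setLIntegral_adjOsc_le (hΦ : IsPhase Φ) (hσ : IsSymbol ρ₁ ρ₂ σ)
    (hΦσ : IsNondegenerateOn Φ σ) (h₁ : 0 ≤ ρ₁) (h₂ : 0 ≤ ρ₂) :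
    ∃ D : ℝ≥0, ∀ (l : ℤ) (k : ℕ) (f : RN n m → ℂ), Measurable f → Integrable f → ∀ h : ℝ≥0,
      ∫⁻ ξ in coneShell l k, ‖adjOsc (osc Φ σ) f ξ‖ₑ ^ 2 ≤
        ((D * shellWeight ρ₁ ρ₂ l k ^ 2 : ℝ≥0) : ℝ≥0∞) *
          ((((aperture l * 2 ^ k) ^ n * (aperture (-l) * 2 ^ k) ^ m : ℝ≥0) : ℝ≥0∞) *
            (∫⁻ y in {y | (h : ℝ≥0∞) < ‖f y‖ₑ}, ‖f y‖ₑ) ^ 2 +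
              ∫⁻ y in {y | ‖f y‖ₑ ≤ h}, ‖f y‖ₑ ^ 2) := by
  obtain ⟨D₁, hD₁⟩ := hσ.exists_setLIntegral_adjOsc_le_L1 h₁ h₂ Φ
  obtain ⟨D₂, hD₂⟩ := hσ.exists_setLIntegral_adjOsc_le_L2 hΦ hΦσ h₁ h₂
  obtain ⟨C, hC⟩ := (hσ.isAmplitude_self h₁ h₂ hΦσ).exists_isL2Op hΦ
  refine ⟨2 * (D₁ + D₂), fun l k f hf hf1 h => ?_⟩
  classical
  have m1 : MeasurableSet {y | (h : ℝ≥0∞) < ‖f y‖ₑ} := measurableSet_lt measurable_const hf.enorm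
  have m2 : MeasurableSet {y | ‖f y‖ₑ ≤ h} := measurableSet_le hf.enorm measurable_const
  set u := {y | (h : ℝ≥0∞) < ‖f y‖ₑ}.indicator f with hu
  set v := {y | ‖f y‖ₑ ≤ h}.indicator f with hv
  have huv : f = fun y => u y + v y := by
    funext y
    rcases lt_or_ge (h : ℝ≥0∞) ‖f y‖ₑ with hy | hy
    · simp only [hu, hv, Set.indicator_apply, Set.mem_ofPred_eq, if_pos hy, if_neg (not_le.2 hy),
        add_zero]
    · simp only [hu, hv, Set.indicator_apply, Set.mem_ofPred_eq, if_pos hy, if_neg (not_lt.2 hy),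
        zero_add]
  have hu1 : Integrable u := hf1.indicator m1
  have hv1 : Integrable v := hf1.indicator m2
  have e1 : ∫⁻ y, ‖u y‖ₑ = ∫⁻ y in {y | (h : ℝ≥0∞) < ‖f y‖ₑ}, ‖f y‖ₑ := by
    rw [← lintegral_indicator m1]
    refine lintegral_congr fun y => ?_
    rw [hu, enorm_indicator_eq_indicator_enorm]
  have e2 : ∫⁻ y, ‖v y‖ₑ ^ 2 = ∫⁻ y in {y | ‖f y‖ₑ ≤ h}, ‖f y‖ₑ ^ 2 := by
    rw [← lintegral_indicator m2]
    refine lintegral_congr fun y => ?_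
    rw [hv, Set.indicator_apply, Set.indicator_apply]
    split_ifs <;> simp
  have b1 := hD₁ l k u (hf.indicator m1)
  have b2 := hD₂ l k v hv1
  rw [e1] at b1
  rw [e2] at b2
  have hS := aestronglyMeasurable_adjOsc hC.measurable hu1.1
  calc _ ≤ ∫⁻ ξ in (coneShell l k : Set (RN n m)),
        (2 * ‖adjOsc (osc Φ σ) u ξ‖ₑ ^ 2 + 2 * ‖adjOsc (osc Φ σ) v ξ‖ₑ ^ 2) := by
        refine lintegral_mono fun ξ => ?_
        conv_lhs => rw [huv]
        rw [hC.adjOsc_add hu1 hv1]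
        refine (pow_le_pow_left₀ zero_le (enorm_add_le _ _) 2).trans ?_
        rw [← mul_add]
        have := ENNReal.rpow_add_le_mul_rpow_add_rpow ‖adjOsc (osc Φ σ) u ξ‖ₑ
          ‖adjOsc (osc Φ σ) v ξ‖ₑ (p := 2) one_le_two
        norm_num at this
        exact this
    _ = 2 * (∫⁻ ξ in (coneShell l k : Set (RN n m)), ‖adjOsc (osc Φ σ) u ξ‖ₑ ^ 2) +
          2 * ∫⁻ ξ in (coneShell l k : Set (RN n m)), ‖adjOsc (osc Φ σ) v ξ‖ₑ ^ 2 := by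
        rw [lintegral_add_left' ((hS.enorm.restrict.pow_const 2).const_mul _),
          lintegral_const_mul' _ _ ENNReal.ofNat_ne_top, lintegral_const_mul' _ _ ENNReal.ofNat_ne_top]
    _ ≤ _ := add_le_add (mul_le_mul_right b1 _) (mul_le_mul_right b2 _)
    _ = ((2 * D₁ * shellWeight ρ₁ ρ₂ l k ^ 2 : ℝ≥0) : ℝ≥0∞) *
          ((((aperture l * 2 ^ k) ^ n * (aperture (-l) * 2 ^ k) ^ m : ℝ≥0) : ℝ≥0∞) *
            (∫⁻ y in {y | (h : ℝ≥0∞) < ‖f y‖ₑ}, ‖f y‖ₑ) ^ 2) +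
        ((2 * D₂ * shellWeight ρ₁ ρ₂ l k ^ 2 : ℝ≥0) : ℝ≥0∞) *
              ∫⁻ y in {y | ‖f y‖ₑ ≤ h}, ‖f y‖ₑ ^ 2 := by
        push_cast
        ring
    _ ≤ _ := by
        rw [mul_add]
        refine add_le_add (mul_le_mul' (ENNReal.coe_le_coe.2 ?_) le_rfl)
          (mul_le_mul' (ENNReal.coe_le_coe.2 ?_) le_rfl)
        · exact mul_le_mul' (mul_le_mul' le_rfl le_self_add) le_rfl
        · exact mul_le_mul' (mul_le_mul' le_rfl le_add_self) le_rfl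

theorem shellWeight_sq (ρ₁ ρ₂ : ℝ) (l : ℤ) (k : ℕ) : shellWeight ρ₁ ρ₂ l k ^ 2 =
    8 ^ (2 * (ρ₁ + ρ₂)) * (aperture l ^ (-(2 * ρ₁)) * aperture (-l) ^ (-(2 * ρ₂))) *
      (2 ^ k) ^ (-(2 * (ρ₁ + ρ₂))) := by
  have key : ∀ (a t : ℝ≥0) (r : ℝ), ((8 / (a * t)) ^ r) ^ 2 =
      8 ^ (2 * r) * a ^ (-(2 * r)) * t ^ (-(2 * r)) := fun a t r => by
    rw [← NNReal.rpow_natCast, ← NNReal.rpow_mul, NNReal.div_rpow, NNReal.mul_rpow,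
      NNReal.rpow_neg, NNReal.rpow_neg, Nat.cast_ofNat, mul_comm r 2, div_eq_mul_inv, mul_inv,
      mul_assoc]
  have h2 : ((2 : ℝ≥0) ^ k) ≠ 0 := by positivity
  rw [shellWeight, mul_pow, key, key, mul_add 2 ρ₁, NNReal.rpow_add (by norm_num : (8 : ℝ≥0) ≠ 0),
    neg_add, NNReal.rpow_add h2]
  ring

/-- Interpolation between the `L¹` and `L²` bounds, with a splitting height adapted to each shell.
The volume factor independent of `k` plays the part of `v` in `exists_tsum_le_of_levels`, which
yields its power `2ρ/N`. -/
theorem IsSymbol.exists_tsum_adjOsc_le (hΦ : IsPhase Φ) (hσ : IsSymbol ρ₁ ρ₂ σ)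
    (hΦσ : IsNondegenerateOn Φ σ) (h₁ : 0 ≤ ρ₁) (h₂ : 0 ≤ ρ₂) (hρ : 0 < ρ₁ + ρ₂)
    (hρN : 2 * (ρ₁ + ρ₂) < (n : ℝ) + m) {p : ℝ}
    (hp : (ρ₁ + ρ₂) / ((n : ℝ) + m) = 1 / p - 1 / 2) :
    ∃ D : ℝ≥0, ∀ (l : ℤ) (f : RN n m → ℂ), Measurable f → Integrable f →
      ∑' k, ∫⁻ ξ in coneShell l k, ‖adjOsc (osc Φ σ) f ξ‖ₑ ^ 2 ≤
        ((D * (aperture l ^ (-(2 * ρ₁)) * aperture (-l) ^ (-(2 * ρ₂))) *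
          (aperture l ^ n * aperture (-l) ^ m) ^ (2 * (ρ₁ + ρ₂) / ((n : ℝ) + m)) : ℝ≥0) : ℝ≥0∞) *
            (∫⁻ y, ‖f y‖ₑ ^ p) ^ (2 / p) := by
  have hd : (0 : ℝ) < (n : ℝ) + m := by linarith
  have ha : 0 < ((n : ℝ) + m) / 2 + (ρ₁ + ρ₂) := by positivity
  set s : ℝ := (((n : ℝ) + m) / 2 - (ρ₁ + ρ₂)) / (((n : ℝ) + m) / 2 + (ρ₁ + ρ₂)) with hs
  have hs0 : 0 < s := div_pos (by linarith) ha
  have hs1 : s < 1 := (div_lt_one ha).2 (by linarith)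
  -- With this `A`, the squared symbol size `2^{-2ρk}` is `A^{-(1-s)k}`, and its product with the
  -- volume growth `2^{Nk}` is `A^{2sk}`.
  set A : ℝ≥0 := 2 ^ (((n : ℝ) + m) / 2 + (ρ₁ + ρ₂)) with hA
  have hA1 : 1 < A := NNReal.one_lt_rpow one_lt_two ha
  have hp' : 1 / p = (((n : ℝ) + m) / 2 + (ρ₁ + ρ₂)) / ((n : ℝ) + m) := by
    rw [eq_sub_iff_add_eq] at hp
    rw [← hp]
    field_simp
    ring
  have hps : p = 1 + s := by
    rw [← one_div_one_div p, hp', one_div_div, hs]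
    field_simp
    ring
  have hp2 : 2 / (1 + s) - 1 = 2 * (ρ₁ + ρ₂) / ((n : ℝ) + m) := by
    rw [← hps, show 2 / p = 2 * (1 / p) by ring, hp']
    field_simp
    ring
  have pw : ∀ (r : ℝ) (k : ℕ), (A ^ r) ^ k = (2 ^ k) ^ ((((n : ℝ) + m) / 2 + (ρ₁ + ρ₂)) * r) := by
    intro r k
    rw [hA, ← NNReal.rpow_mul, rpow_pow_comm]
  have hs' : (((n : ℝ) + m) / 2 + (ρ₁ + ρ₂)) * s = ((n : ℝ) + m) / 2 - (ρ₁ + ρ₂) := by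
    rw [hs]
    field_simp
  have e1 : ∀ k : ℕ, (A ^ (-(1 - s))) ^ k = (2 ^ k) ^ (-(2 * (ρ₁ + ρ₂))) := fun k => by
    rw [pw]
    congr 1
    linarith
  have e2 : ∀ k : ℕ, ((2 : ℝ≥0) ^ k) ^ (-(2 * (ρ₁ + ρ₂))) * ((2 ^ k) ^ n * (2 ^ k) ^ m) =
      ((A ^ s) ^ k) ^ 2 := fun k => by
    have h2 : ((2 : ℝ≥0) ^ k) ≠ 0 := by positivity
    rw [pw, hs', ← NNReal.rpow_natCast _ n, ← NNReal.rpow_natCast _ m, ← NNReal.rpow_add h2,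
      ← NNReal.rpow_add h2, ← NNReal.rpow_natCast _ 2, ← NNReal.rpow_mul]
    congr 1
    push_cast
    ring
  obtain ⟨D, hD⟩ := hσ.exists_setLIntegral_adjOsc_le hΦ hΦσ h₁ h₂
  obtain ⟨C, hC⟩ := exists_tsum_le_of_levels (X := RN n m) hA1 hs0 hs1
  refine ⟨C * (D * 8 ^ (2 * (ρ₁ + ρ₂))), fun l f hf hf1 => ?_⟩
  have hv : aperture l ^ n * aperture (-l) ^ m ≠ 0 :=
    mul_ne_zero (pow_ne_zero _ (aperture_pos l).ne') (pow_ne_zero _ (aperture_pos (-l)).ne')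
  have := hC volume (fun y => ‖f y‖ₑ) hf.enorm
    (D * 8 ^ (2 * (ρ₁ + ρ₂)) * (aperture l ^ (-(2 * ρ₁)) * aperture (-l) ^ (-(2 * ρ₂)))) _ hv
    (fun k => ∫⁻ ξ in coneShell l k, ‖adjOsc (osc Φ σ) f ξ‖ₑ ^ 2) fun k h => by
      refine (hD l k f hf hf1 h).trans (le_of_eq ?_)
      rw [mul_pow (((A ^ s) ^ k : ℝ≥0) : ℝ≥0∞), ← ENNReal.coe_pow ((A ^ s) ^ k), e1, ← e2,
        shellWeight_sq]
      push_cast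
      ring
  rw [hps]
  refine this.trans (le_of_eq ?_)
  rw [hp2, ← ENNReal.coe_rpow_of_ne_zero hv]
  push_cast
  ring

end

/-! ### The gain in the exponent and the final estimate for the adjoints. -/

/-- Put `N = a + b`. As `r ≤ bρ/(N-1)` and `ρ ≤ (N-1)/2`, the left side is at most `bρ/(N(N-1)) ≤
b/(2N) ≤ 1/2 - 1/(2N)`, using `b ≤ N - 1`. On the right, `N/2 - ρ ≥ 1/2`. -/
theorem order_sub_le {a b ρ r : ℝ} (ha : 1 ≤ a) (hb : 1 ≤ b) (hr : (a + b - 1) * r ≤ b * ρ)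
    (hρ : ρ ≤ (a + b - 1) / 2) :
    r - b * ρ / (a + b) ≤ (a + b) / 2 - ρ - 1 / (2 * (a + b)) := by
  have hN : 0 < a + b := by linarith
  have h1 : 0 ≤ (a + b - 1) * ((a + b) ^ 2 - 1 + 2 * b * ρ - 2 * (a + b) * ρ - 2 * (a + b) * r) := by
    nlinarith [mul_le_mul_of_nonneg_left hr hN.le, mul_nonneg (by linarith : 0 ≤ a + b - 1)
      (by linarith : 0 ≤ a - 1), mul_le_mul_of_nonneg_left hρ (by linarith : 0 ≤ b),
      mul_le_mul_of_nonneg_left hρ (mul_nonneg hN.le (by linarith : 0 ≤ a + b - 1))]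
  have h2 := nonneg_of_mul_nonneg_right h1 (by linarith)
  rw [← sub_nonneg]
  have : (a + b) / 2 - ρ - 1 / (2 * (a + b)) - (r - b * ρ / (a + b)) =
      ((a + b) ^ 2 - 1 + 2 * b * ρ - 2 * (a + b) * ρ - 2 * (a + b) * r) / (2 * (a + b)) := by
    field_simp
    ring
  rw [this]
  positivity

section

variable {ρ ρ₁ ρ₂ : ℝ} {σ : RN n m → RN n m → ℂ} {Φ : RN n m → RN n m → ℝ}

/-- One of the two apertures is always one. For `l ≥ 0` the exponent is `2l(ρ₂ - mρ/N)`, for `l ≤ 0`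
it is `2|l|(ρ₁ - nρ/N)`, and `order_sub_le` bounds each of them. -/
theorem aperture_rpow_le (hn : 0 < n) (hm : 0 < m) (hρ : 0 < ρ)
    (hρN : ρ ≤ ((n : ℝ) + m - 1) / 2) (hadm : IsAdmissible n m ρ ρ₁ ρ₂) (l : ℤ) :
    (aperture l ^ (-(2 * ρ₁)) * aperture (-l) ^ (-(2 * ρ₂))) *
      (aperture l ^ n * aperture (-l) ^ m) ^ (2 * ρ / ((n : ℝ) + m)) ≤
        (2 ^ ((((n : ℝ) + m) / 2 - ρ - 1 / (2 * ((n : ℝ) + m))) * |(l : ℝ)|)) ^ 2 := by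
  obtain ⟨h1, h2, h3⟩ := hadm.2 hρ
  have hn' : (1 : ℝ) ≤ n := by exact_mod_cast hn
  have hm' : (1 : ℝ) ≤ m := by exact_mod_cast hm
  have hN : (0 : ℝ) < (n : ℝ) + m - 1 := by linarith
  rw [div_mul_eq_mul_div, div_lt_iff₀ hN] at h1 h2
  have b2 := order_sub_le hn' hm' (r := ρ₂) (ρ := ρ) (by nlinarith) hρN
  have b1 := order_sub_le hm' hn' (r := ρ₁) (ρ := ρ) (by nlinarith) (by linarith)
  rw [add_comm (m : ℝ) n] at b1
  set E : ℝ := ((n : ℝ) + m) / 2 - ρ - 1 / (2 * ((n : ℝ) + m)) with hE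
  have ap : ∀ l : ℤ, aperture l = 2 ^ (min (l : ℝ) 0) := fun l => by
    rw [aperture, ← NNReal.rpow_intCast]
    push_cast
    rfl
  have two : (2 : ℝ≥0) ≠ 0 := two_ne_zero
  rw [ap, ap, ← NNReal.rpow_natCast _ n, ← NNReal.rpow_natCast _ m, ← NNReal.rpow_natCast _ 2]
  simp only [← NNReal.rpow_mul, ← NNReal.rpow_add two]
  refine NNReal.rpow_le_rpow_of_exponent_le one_le_two ?_
  push_cast
  rcases le_total (l : ℝ) 0 with h | h
  · rw [min_eq_left h, min_eq_right (by linarith), abs_of_nonpos h]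
    have := mul_le_mul_of_nonneg_right b1 (neg_nonneg.2 h)
    calc _ = 2 * ((ρ₁ - n * ρ / ((n : ℝ) + m)) * -l) := by ring
      _ ≤ 2 * (E * -l) := by linarith
      _ = _ := by ring
  · rw [min_eq_right h, min_eq_left (by linarith), abs_of_nonneg h]
    have := mul_le_mul_of_nonneg_right b2 h
    calc _ = 2 * ((ρ₂ - m * ρ / ((n : ℝ) + m)) * l) := by ring
      _ ≤ 2 * (E * l) := by linarith
      _ = _ := by ring

theorem eLpNorm_ofReal_eq {p : ℝ} (hp : 0 < p) (f : RN n m → ℂ) :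
    eLpNorm f (ENNReal.ofReal p) volume = (∫⁻ y, ‖f y‖ₑ ^ p) ^ (1 / p) := by
  rw [eLpNorm_eq_lintegral_rpow_enorm_toReal (by simpa using hp) ENNReal.ofReal_ne_top,
    ENNReal.toReal_ofReal hp.le]

theorem exists_setLIntegral_iUnion_adjOsc_le (hn : 0 < n) (hm : 0 < m) (hρ : 0 ≤ ρ)
    (hρN : ρ ≤ ((n : ℝ) + m - 1) / 2) (hadm : IsAdmissible n m ρ ρ₁ ρ₂) (hΦ : IsPhase Φ)
    (hσ : IsSymbol ρ₁ ρ₂ σ) (hΦσ : IsNondegenerateOn Φ σ) {p : ℝ}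
    (hp : ρ / ((n : ℝ) + m) = 1 / p - 1 / 2) (hp0 : 0 < p) :
    ∃ D : ℝ≥0, ∀ (l : ℤ) (f : RN n m → ℂ), Measurable f → Integrable f →
      ∫⁻ ξ in ⋃ k, coneShell l k, ‖adjOsc (osc Φ σ) f ξ‖ₑ ^ 2 ≤
        (D * ENNReal.ofReal
          ((2 : ℝ) ^ ((((n : ℝ) + m) / 2 - ρ - 1 / (2 * ((n : ℝ) + m))) * |(l : ℝ)|)) *
            eLpNorm f (ENNReal.ofReal p) volume) ^ 2 := by
  have hn' : (1 : ℝ) ≤ n := by exact_mod_cast hn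
  have hm' : (1 : ℝ) ≤ m := by exact_mod_cast hm
  set E : ℝ := ((n : ℝ) + m) / 2 - ρ - 1 / (2 * ((n : ℝ) + m)) with hE
  have hz : ∀ l : ℤ, ENNReal.ofReal ((2 : ℝ) ^ (E * |(l : ℝ)|)) =
      ((2 ^ (E * |(l : ℝ)|) : ℝ≥0) : ℝ≥0∞) := fun l => by
    rw [← ENNReal.ofReal_coe_nnreal, NNReal.coe_rpow]
    rfl
  simp only [hz]
  -- At order zero the level sums would need `s = 1`. There `p = 2`, the plain `L²` bound applies,
  -- and the exponent `E` is nonnegative.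
  rcases hρ.eq_or_lt with h0 | h0
  · obtain ⟨e1, e2⟩ := hadm.1 h0.symm
    obtain ⟨C, hC⟩ := (hσ.isAmplitude_self e1.ge e2.ge hΦσ).exists_isL2Op hΦ
    have hp2 : p = 2 := by
      rw [← h0, zero_div] at hp
      rw [← one_div_one_div p, show 1 / p = 1 / 2 by linarith, one_div_one_div]
    refine ⟨C, fun l f hf hf1 => ?_⟩
    refine (setLIntegral_le_lintegral _ _).trans ((hC.lintegral_sq_adjOsc_le hf1).trans ?_)
    rw [hp2, ENNReal.ofReal_ofNat, ← sq_eLpNorm_two, ← mul_pow]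
    have hE0 : 0 ≤ E := by
      rw [hE, ← h0, sub_zero, sub_nonneg]
      exact div_le_div₀ (by linarith) (by linarith) two_pos (by linarith)
    have h1 : (1 : ℝ≥0) ≤ 2 ^ (E * |(l : ℝ)|) := NNReal.one_le_rpow one_le_two (by positivity)
    refine pow_le_pow_left₀ zero_le (mul_le_mul' ?_ le_rfl) 2
    calc (C : ℝ≥0∞) = C * 1 := (mul_one _).symm
      _ ≤ _ := mul_le_mul_right (by exact_mod_cast h1) _
  · obtain ⟨a1, -, a2, -⟩ := hadm.bounds hn hm h0 hρN
    have h3 := (hadm.2 h0).2.2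
    obtain ⟨D, hD⟩ := hσ.exists_tsum_adjOsc_le hΦ hΦσ a1.le a2.le (by rw [h3]; exact h0)
      (by rw [h3]; linarith) (p := p) (by rw [h3]; exact hp)
    refine ⟨NNReal.sqrt D, fun l f hf hf1 => ?_⟩
    refine (lintegral_iUnion_le _ _).trans ((hD l f hf hf1).trans ?_)
    rw [h3, eLpNorm_ofReal_eq hp0, mul_pow, mul_pow]
    refine mul_le_mul' ?_ (le_of_eq ?_)
    · rw [← ENNReal.coe_pow, ← ENNReal.coe_pow, ← ENNReal.coe_mul, NNReal.sq_sqrt, mul_assoc]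
      exact ENNReal.coe_le_coe.2 (mul_le_mul' le_rfl (aperture_rpow_le hn hm h0 hρN hadm l))
    · rw [← ENNReal.rpow_natCast, ← ENNReal.rpow_mul]
      congr 1
      push_cast
      ring

/-- The cut-offs of index `l` live on the union of the sets `coneShell l k`. Restricting `adjOsc` to
that union changes no term, and its `L²` norm there is already estimated, so bounded overlap and
Plancherel finish. -/
theorem exists_adjoint_estimate (hn : 0 < n) (hm : 0 < m) (hρ : 0 ≤ ρ)
    (hρN : ρ ≤ ((n : ℝ) + m - 1) / 2) (hadm : IsAdmissible n m ρ ρ₁ ρ₂) {φ : ℝ → ℂ}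
    (hφ : IsCutoff φ) (hΦ : IsPhase Φ) (hσ : IsSymbol ρ₁ ρ₂ σ) (hΦσ : IsNondegenerateOn Φ σ)
    {p : ℝ} (hp : ρ / ((n : ℝ) + m) = 1 / p - 1 / 2) :
    ∃ C : ℝ≥0, ∀ (l : ℤ) (f : RN n m → ℂ), MemLp f (ENNReal.ofReal p) volume →
      ∃ g, IsNaturalLAdj φ Φ σ l f g ∧ eLpNorm g 2 volume ≤
        C * ENNReal.ofReal
          ((2 : ℝ) ^ ((((n : ℝ) + m) / 2 - ρ - 1 / (2 * ((n : ℝ) + m))) * |(l : ℝ)|)) *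
            eLpNorm f (ENNReal.ofReal p) volume := by
  classical
  have hn' : (1 : ℝ) ≤ n := by exact_mod_cast hn
  have hm' : (1 : ℝ) ≤ m := by exact_mod_cast hm
  have hN : (0 : ℝ) < (n : ℝ) + m := by linarith
  have hp' : 1 / p = ρ / ((n : ℝ) + m) + 1 / 2 := by linarith
  have hp1 : 1 / p ≤ 1 := by
    rw [hp', ← le_sub_iff_add_le, div_le_iff₀ hN]
    linarith
  have hp0 : 0 < p := by
    have : 0 < 1 / p := by rw [hp']; positivity
    exact one_div_pos.1 this
  have hp1' : 1 ≤ p := by rwa [div_le_one hp0] at hp1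
  obtain ⟨B, hB⟩ := hφ.exists_bound
  have hρ' : 0 ≤ ρ₁ ∧ 0 ≤ ρ₂ := by
    rcases hρ.eq_or_lt with h0 | h0
    · exact ⟨(hadm.1 h0.symm).1.ge, (hadm.1 h0.symm).2.ge⟩
    · have := hadm.bounds hn hm h0 hρN
      exact ⟨this.1.le, this.2.2.1.le⟩
  obtain ⟨C, hC⟩ := (hσ.isAmplitude_self hρ'.1 hρ'.2 hΦσ).exists_isL2Op hΦ
  obtain ⟨D, hD⟩ := exists_setLIntegral_iUnion_adjOsc_le hn hm hρ hρN hadm hΦ hσ hΦσ hp hp0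
  obtain ⟨K, hK, hKσ⟩ := hσ.compact_support
  refine ⟨2 * B * (6 * B) * D, fun l f hf => ?_⟩
  set z := ENNReal.ofReal
    ((2 : ℝ) ^ ((((n : ℝ) + m) / 2 - ρ - 1 / (2 * ((n : ℝ) + m))) * |(l : ℝ)|)) with hz
  -- Kernels of the adjoints vanish for `y` outside `K`, so only `f` on `K` matters. As `p ≥ 1` and
  -- `K` has finite measure, the truncation is integrable.
  set f' := K.indicator (hf.1.mk f) with hf'
  have hfm : Measurable f' := hf.1.stronglyMeasurable_mk.measurable.indicator hK.measurableSet
  have hmk : MemLp (hf.1.mk f) (ENNReal.ofReal p) volume := (memLp_congr_ae hf.1.ae_eq_mk).1 hf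
  have hf1 : Integrable f' := by
    rw [hf', integrable_indicator_iff hK.measurableSet]
    have : IsFiniteMeasure (volume.restrict K) :=
      ⟨by rw [Measure.restrict_apply_univ]; exact hK.measure_lt_top⟩
    exact memLp_one_iff_integrable.1 (hmk.restrict K |>.mono_exponent
      (by rw [← ENNReal.ofReal_one]; exact ENNReal.ofReal_le_ofReal hp1'))
  have hfn : eLpNorm f' (ENNReal.ofReal p) volume ≤ eLpNorm f (ENNReal.ofReal p) volume := by
    rw [eLpNorm_congr_ae hf.1.ae_eq_mk]
    exact eLpNorm_indicator_le _
  have hadj : ∀ ψ : RN n m → ℂ, ∀ x, adjointOp (kern Φ σ ψ) f x = adjointOp (kern Φ σ ψ) f' x := by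
    intro ψ x
    refine integral_congr_ae (hf.1.ae_eq_mk.mono fun y hy => ?_)
    simp only [hf', Set.indicator_apply]
    split_ifs with h
    · rw [hy]
    · have : kern Φ σ ψ y x = 0 := by simp [kern, hKσ y h]
      simp [this]
  have hS := aestronglyMeasurable_adjOsc hC.measurable hf1.1
  have hU : MeasurableSet (⋃ k, coneShell l k : Set (RN n m)) :=
    MeasurableSet.iUnion (measurableSet_coneShell l)
  set F : RN n m → ℂ := (⋃ k, coneShell l k).indicator (adjOsc (osc Φ σ) f') with hF
  have hFn : eLpNorm F 2 volume ≤ D * z * eLpNorm f (ENNReal.ofReal p) volume := by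
    rw [← ENNReal.pow_le_pow_left_iff two_ne_zero, sq_eLpNorm_two]
    have e : ∫⁻ ξ, ‖F ξ‖ₑ ^ 2 = ∫⁻ ξ in ⋃ k, coneShell l k, ‖adjOsc (osc Φ σ) f' ξ‖ₑ ^ 2 := by
      rw [← lintegral_indicator hU]
      refine lintegral_congr fun ξ => ?_
      rw [hF, Set.indicator_apply, Set.indicator_apply]
      split_ifs <;> simp
    rw [e]
    exact (hD l f' hfm hf1).trans (pow_le_pow_left₀ zero_le (mul_le_mul_right hfn _) 2)
  have hF2 : MemLp F 2 volume := ⟨hS.indicator hU, hFn.trans_lt (ENNReal.mul_lt_top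
    (ENNReal.mul_lt_top ENNReal.coe_lt_top ENNReal.ofReal_lt_top) hf.2)⟩
  have hcut : ∀ j, IsFreqCut fun ξ : RN n m =>
      (starRingEnd ℂ) (coneCut φ l ξ * shellCut φ j ξ) := fun j => by
    obtain ⟨h1, ⟨b, h2⟩, R, h3⟩ := hφ.isFreqCut_coneCut_mul (n := n) (m := m) l j
    exact ⟨Complex.continuous_conj.measurable.comp h1,
      ⟨b, fun ξ => by rw [RCLike.norm_conj]; exact h2 ξ⟩, R, fun ξ hξ => by
        have := h3 ξ hξ
        rw [this, map_zero]⟩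
  obtain ⟨g, hg, hg'⟩ := isL2Op_expKer.exists_isL2Sum
    (ψ := fun (j : {j : ℤ // 2 * |l| < j}) ξ => (starRingEnd ℂ) (coneCut φ l ξ * shellCut φ j ξ))
    (fun j => hcut j) (D := 2 * B * (6 * B))
    (fun ξ t => by
      push_cast
      simp only [RCLike.norm_conj]
      exact hφ.sum_norm_mul_shellCut_le hB (ψ := fun _ => coneCut φ l)
        (fun _ => norm_coneCut_le hB l) ξ t) hF2
    (u := fun j : {j : ℤ // 2 * |l| < j} => opLJAdj φ Φ σ l j f) fun j x => by
      rw [opLJAdj, kernLJ, hadj,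
        adjointOp_kern_eq hn hC hf1 (hφ.isFreqCut_coneCut_mul l j)]
      congr 1
      funext ξ
      by_cases h : coneCut φ l ξ * shellCut φ j ξ = 0
      · rw [h, map_zero, zero_mul, zero_mul]
      · have hmem : ξ ∈ (⋃ k, coneShell l k : Set (RN n m)) := by
          have hj : ((j : ℤ).toNat : ℤ) = j :=
            Int.toNat_of_nonneg (by have := j.2; have := abs_nonneg l; omega)
          refine Set.mem_iUnion.2 ⟨(j : ℤ).toNat, hφ.coneCut_support (left_ne_zero_of_mul h), ?_⟩
          rw [hj]
          exact hφ.shellCut_support (right_ne_zero_of_mul h)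
        rw [hF, Set.indicator_of_mem hmem]
  refine ⟨g, hg, hg'.trans ?_⟩
  rw [ENNReal.coe_one, one_mul]
  refine (mul_le_mul_right hFn _).trans (le_of_eq ?_)
  push_cast
  ring

end

end ConeFIO

end

/-! ### The three estimates together. -/

theorem mainTheorem2 (n m : ℕ) (hn : 0 < n) (hm : 0 < m) :
    (∀ (φ : ℝ → ℂ) (Φ : ConeFIO.RN n m → ConeFIO.RN n m → ℝ)
        (σ : ConeFIO.RN n m → ConeFIO.RN n m → ℂ),
      ConeFIO.IsCutoff φ → ConeFIO.IsPhase Φ → ConeFIO.IsSymbol 0 0 σ →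
      ConeFIO.IsNondegenerateOn Φ σ →
      ∃ C : ℝ≥0, ∀ f : ConeFIO.RN n m → ℂ, MemLp f 2 volume →
        ∃ gN gS gF : ConeFIO.RN n m → ℂ,
          MemLp (ConeFIO.opO φ Φ σ f) 2 volume ∧
          ConeFIO.IsNatural φ Φ σ f gN ∧ ConeFIO.IsSharp φ Φ σ f gS ∧
          ConeFIO.IsFlat φ Φ σ f gF ∧
          eLpNorm (ConeFIO.opO φ Φ σ f) 2 volume + eLpNorm gN 2 volume +
            eLpNorm gS 2 volume + eLpNorm gF 2 volume ≤ C * eLpNorm f 2 volume) ∧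
    (∀ ρ ρ₁ ρ₂ : ℝ, 0 ≤ ρ → ρ ≤ ((n : ℝ) + m - 1) / 2 → ConeFIO.IsAdmissible n m ρ ρ₁ ρ₂ →
      ∃ ε : ℝ, 0 < ε ∧
      ∀ (φ : ℝ → ℂ) (Φ : ConeFIO.RN n m → ConeFIO.RN n m → ℝ)
        (σ : ConeFIO.RN n m → ConeFIO.RN n m → ℂ),
      ConeFIO.IsCutoff φ → ConeFIO.IsPhase Φ → ConeFIO.IsSymbol ρ₁ ρ₂ σ →
      ConeFIO.IsNondegenerateOn Φ σ →
      (∀ p₁ p₂ : ℝ, ρ₁ / n = 1 / p₁ - 1 / 2 → ρ₂ / m = 1 / p₂ - 1 / 2 →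
        ∃ C : ℝ≥0, ∀ f : ConeFIO.RN n m → ℂ, ConeFIO.MemMixed p₁ p₂ f →
          (∀ l : ℤ, ∃ g, ConeFIO.IsNaturalL φ Φ σ l f g ∧
            eLpNorm g 2 volume ≤ C * ConeFIO.mixedNorm p₁ p₂ f) ∧
          (∃ g, ConeFIO.IsSharp φ Φ σ f g ∧
            eLpNorm g 2 volume ≤ C * ConeFIO.mixedNorm p₁ p₂ f) ∧
          (∃ g, ConeFIO.IsFlat φ Φ σ f g ∧
            eLpNorm g 2 volume ≤ C * ConeFIO.mixedNorm p₁ p₂ f)) ∧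
      (∀ p : ℝ, ρ / ((n : ℝ) + m) = 1 / p - 1 / 2 →
        ∃ C : ℝ≥0, ∀ (l : ℤ) (f : ConeFIO.RN n m → ℂ), MemLp f (ENNReal.ofReal p) volume →
          ∃ g, ConeFIO.IsNaturalLAdj φ Φ σ l f g ∧
            eLpNorm g 2 volume ≤
              C * ENNReal.ofReal ((2 : ℝ) ^ ((((n : ℝ) + m) / 2 - ρ - ε) * |(l : ℝ)|)) *
                eLpNorm f (ENNReal.ofReal p) volume)) := by
  refine ⟨fun φ Φ σ hφ hΦ hσ hΦσ => ConeFIO.exists_L2_estimate hn hφ hΦ hσ hΦσ,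
    -- The gain is the one from `order_sub_le`; it depends on the dimension only.
    fun ρ ρ₁ ρ₂ hρ hρN hadm => ⟨1 / (2 * ((n : ℝ) + m)),
      by have : (0 : ℝ) < n := Nat.cast_pos.2 hn; positivity,
      fun φ Φ σ hφ hΦ hσ hΦσ => ⟨fun p₁ p₂ hp₁ hp₂ =>
        ConeFIO.exists_mixed_estimate hn hm hρ hρN hadm hφ hΦ hσ hΦσ hp₁ hp₂,
        fun p hp => ConeFIO.exists_adjoint_estimate hn hm hρ hρN hadm hφ hΦ hσ hΦσ hp⟩⟩⟩
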